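/- Let $n\ge 1$, $n\neq 2$, and $d=n-1$. Let $\mathbb B_d$ be the open unit ball of $\mathbb C^d$ and let $G=\mathrm{Aut}(\mathbb B_d)$ be its group of biholomorphic self-maps, with the compact-open topology. Let $\mathbb X^0_{d,n}$ be the space of unordered $n$-tuples of distinct points of $\mathbb B_d$, with its topology and smooth structure as the quotient of the space of ordered $n$-tuples of distinct points by the symmetric group $S_n$, and with the diagonal action of $G$. Let $\mathbb X^{0,reg}_{d,n}$ be the open set of regular points, that is, of the points $x$ such that the stabilizers in $G$ of all points near $x$ are conjugate to the stabilizer of $x$. Let $H^2_d$ be the Drury–Arveson space, the reproducing kernel Hilbert space on $\mathbb B_d$ with kernel $k(z,w)=\frac1{1-\langle z,w\rangle}$, and put $k_w=k(\cdot,w)$. The tautological bundle $\mathcal E$ on $\mathbb X^0_{d,n}$ has the fibre $\mathcal E_x=\mathrm{Span}\{k_\lambda\mid\lambda\in x\}$ over $x$; its total space is a subspace of $\mathbb X^0_{d,n}\times H^2_d$. Let $\mathrm{Pick}_n$ be the space of irreducible complete Pick reproducing kernel Hilbert spaces of dimension $n$ on $n$ points (irreducible: no two kernel functions are linearly dependent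 or orthogonal), up to isometric isomorphism of reproducing kernel Hilbert spaces. An isomorphism of reproducing kernel Hilbert spaces is a bounded invertible operator that maps kernel functions to nonzero multiples of kernel functions along a bijection of the underlying sets. The topology of $\mathrm{Pick}_n$ is given by the distance $$\rho_{RK}(\mathcal H_1,\mathcal H_2)=\log\inf\{\|T\|\,\|T^{-1}\|\mid T\colon\mathcal H_1\to\mathcal H_2\text{ an isomorphism of reproducing kernel Hilbert spaces}\}.$$ Let $\mathrm{Pick}_n^{reg}\subset\mathrm{Pick}_n$ be the set of the classes of the spaces $\mathcal E_x$, regarded as spaces of functions on the set $x$, for $x\in\mathbb X^{0,reg}_{d,n}$. Then: 1. A point of $\mathbb X^0_{d,n}$ is regular if and only if its stabilizer in $G$ is trivial. The set $\mathrm{Pick}_n^{reg}$ is open and dense in $\mathrm{Pick}_n$. 2. The map $p\colon\mathbb X^{0,reg}_{d,n}\to\mathrm{Pick}_n^{reg}$, $x\mapsto[\mathcal E_x]$, is well defined. The smooth manifold structure of $\mathbb X^0_{d,n}$ restricts to one on $\mathbb X^{0,reg}_{d,n}$, and $\mathrm{Pick}_n^{reg}$ has a structure of a smooth (Hausdorff,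 second countable) manifold for which $p$ is a smooth principal $G$-bundle: $G$ is a topological group acting continuously, $p$ is smooth, and $\mathrm{Pick}_n^{reg}$ is covered by open sets $U$ with a $G$-equivariant homeomorphism $p^{-1}(U)\cong U\times G$ over $U$, $x\mapsto(p(x),\gamma(x))$, whose unit section $U\to p^{-1}(U)$ is smooth and for which $(x,z)\mapsto\gamma(x)(z)$ is a smooth map $p^{-1}(U)\times\mathbb B_d\to\mathbb B_d$. 3. The bundle $\mathcal E|_{\mathbb X^{0,reg}_{d,n}}$ descends to a vector bundle on $\mathrm{Pick}_n^{reg}$: there are a complex vector bundle $\mathcal E_n^{reg}$ of rank $n$ on $\mathrm{Pick}_n^{reg}$ and an isomorphism $\theta\colon\mathcal E|_{\mathbb X^{0,reg}_{d,n}}\to p^*\mathcal E_n^{reg}$ of vector bundles that is compatible with the natural action of $G$ on $\mathcal E$ by unitaries up to phases. Explicitly, for all $\varphi\in G$ and $x\in\mathbb X^{0,reg}_{d,n}$ there is $c\in\mathbb C$ with $|c|=1$ such that, with $a=\varphi^{-1}(0)$, $$\theta_x(k_\lambda)=\theta_{\varphi(x)}\Big(c\,\sqrt{1-\|a\|^2}\;k_\lambda(a)\,k_{\varphi(\lambda)}\Big)\qquad\text{for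 all }\lambda\in x.$$ -/

import Mathlib

namespace PickSpace

noncomputable section

open scoped Manifold ContDiff Topology

/-! ### The ball, its automorphism group and the configuration spaces -/

/-- The Hilbert space `ℂ^d`. -/
abbrev Cn (d : ℕ) : Type := EuclideanSpace ℂ (Fin d)

/-- The open unit ball of `ℂ^d`. -/
def Ball (d : ℕ) : TopologicalSpace.Opens (Cn d) :=
  ⟨Metric.ball 0 1, Metric.isOpen_ball⟩

/-- The centre of the ball. -/
def Ball.origin (d : ℕ) : Ball d := ⟨0, Metric.mem_ball_self one_pos⟩

/-- A self-map of the ball is holomorphic. -/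
def IsHolo {d : ℕ} (f : Ball d → Ball d) : Prop :=
  ∃ F : Cn d → Cn d, DifferentiableOn ℂ F (Ball d) ∧ ∀ z : Ball d, F z = f z

theorem IsHolo.comp {d : ℕ} {f g : Ball d → Ball d} (hf : IsHolo f) (hg : IsHolo g) :
    IsHolo (f ∘ g) := by
  obtain ⟨F, hF, hFf⟩ := hf
  obtain ⟨G, hG, hGg⟩ := hg
  refine ⟨F ∘ G, hF.comp hG fun z hz => ?_, fun z => ?_⟩
  · have := (g ⟨z, hz⟩).2
    rw [← hGg] at this
    exact this
  · simp [hGg, hFf]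

theorem IsHolo.continuous {d : ℕ} {f : Ball d → Ball d} (hf : IsHolo f) : Continuous f := by
  obtain ⟨F, hF, hFf⟩ := hf
  refine Continuous.subtype_mk (f := fun z => (f z : Cn d)) ?_ _
  simp only [← hFf]
  exact continuousOn_iff_continuous_domRestrict.1 hF.continuousOn

/-- `Aut(𝔹_d)` as a group of permutations: the biholomorphic self-maps of the ball. -/
def autSubgroup (d : ℕ) : Subgroup (Equiv.Perm (Ball d)) where
  carrier := {φ | IsHolo φ ∧ IsHolo φ.symm}
  mul_mem' ha hb := ⟨ha.1.comp hb.1, hb.2.comp ha.2⟩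
  one_mem' := ⟨⟨id, differentiableOn_id, fun _ => rfl⟩, ⟨id, differentiableOn_id, fun _ => rfl⟩⟩
  inv_mem' h := ⟨h.2, h.1⟩

/-- `Aut(𝔹_d)`, the group of biholomorphic self-maps of the ball. -/
def BallAut (d : ℕ) : Type := autSubgroup d

instance (d : ℕ) : Group (BallAut d) := inferInstanceAs (Group (autSubgroup d))

instance (d : ℕ) : MulAction (BallAut d) (Ball d) where
  smul φ z := φ.1 z
  one_smul _ := rfl
  mul_smul _ _ _ := rfl

instance (d : ℕ) : ContinuousConstSMul (BallAut d) (Ball d) :=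
  ⟨fun φ => φ.2.1.continuous⟩

/-- The topology of `Aut(𝔹_d)` is the compact-open topology. -/
instance (d : ℕ) : TopologicalSpace (BallAut d) :=
  TopologicalSpace.induced
    (fun φ => (⟨fun z => φ • z, continuous_const_smul φ⟩ : C(Ball d, Ball d))) inferInstance

/-- The manifold of ordered `n`-tuples of distinct points of the ball, as an open subset
of `(ℂ^d)^n`. -/
def Conf (d n : ℕ) : TopologicalSpace.Opens (Fin n → Cn d) :=
  ⟨{x | (∀ i, x i ∈ Ball d) ∧ Function.Injective x}, by
    have h1 : IsOpen {x : Fin n → Cn d | ∀ i, x i ∈ Ball d} := by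
      simp only [Set.ofPred_forall]
      exact isOpen_iInter_of_finite fun i => (Ball d).isOpen.preimage (continuous_apply i)
    have h2 : IsOpen {x : Fin n → Cn d | Function.Injective x} := by
      have : {x : Fin n → Cn d | Function.Injective x}
          = ⋂ i, ⋂ j, {x : Fin n → Cn d | i = j ∨ x i ≠ x j} := by
        ext x
        simp only [Function.Injective, Set.mem_ofPred_eq, Set.mem_iInter]
        exact forall₂_congr fun i j => by tauto
      rw [this]
      refine isOpen_iInter_of_finite fun i => isOpen_iInter_of_finite fun j => ?_
      by_cases hij : i = j
      · simp [hij]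
      · simpa [hij] using isOpen_ne_fun (continuous_apply i) (continuous_apply j)
    exact h1.inter h2⟩

/-- The `i`-th point of an ordered configuration. -/
def confPt {d n : ℕ} (x : Conf d n) (i : Fin n) : Ball d := ⟨x.1 i, x.2.1 i⟩

/-- The symmetric group permutes the points of an ordered configuration. -/
instance (d n : ℕ) : MulAction (Equiv.Perm (Fin n)) (Conf d n) where
  smul σ x := ⟨fun i => x.1 (σ⁻¹ i), fun i => x.2.1 _, x.2.2.comp σ⁻¹.injective⟩
  one_smul _ := rfl
  mul_smul σ τ x := by
    apply Subtype.ext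
    funext i
    change x.1 ((σ * τ)⁻¹ i) = x.1 (τ⁻¹ (σ⁻¹ i))
    rw [mul_inv_rev]
    rfl

instance (d n : ℕ) : ContinuousConstSMul (Equiv.Perm (Fin n)) (Conf d n) :=
  ⟨fun σ => by
    have h : Continuous fun x : Conf d n => fun i => x.1 (σ⁻¹ i) :=
      continuous_pi fun i => (continuous_apply (σ⁻¹ i)).comp continuous_subtype_val
    exact h.subtype_mk _⟩

instance (d n : ℕ) : IsCancelSMul (Equiv.Perm (Fin n)) (Conf d n) where
  right_cancel' σ τ x h := by
    have : ∀ i, σ⁻¹ i = τ⁻¹ i := fun i => x.2.2 (congrFun (congrArg Subtype.val h) i)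
    exact inv_injective (Equiv.ext this)

instance (d n : ℕ) : LocallyCompactSpace (Conf d n) := by
  have : ProperSpace (Cn d) := FiniteDimensional.proper_rclike ℂ _
  exact (Conf d n).isOpen.locallyCompactSpace

/-- `Aut(𝔹_d)` acts diagonally on ordered configurations. -/
instance (d n : ℕ) : MulAction (BallAut d) (Conf d n) where
  smul φ x := ⟨fun i => (φ • confPt x i : Ball d), fun i => (φ • confPt x i).2, fun i j h => by
    have h1 : confPt x i = confPt x j := MulAction.injective φ (Subtype.ext h)
    exact x.2.2 (congrArg Subtype.val h1)⟩
  one_smul _ := rfl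
  mul_smul _ _ _ := rfl

instance (d n : ℕ) : ContinuousConstSMul (BallAut d) (Conf d n) :=
  ⟨fun φ => by
    have h1 : ∀ i, Continuous fun x : Conf d n => confPt x i := fun i =>
      ((continuous_apply i).comp continuous_subtype_val).subtype_mk _
    have h : Continuous fun x : Conf d n => fun i => ((φ • confPt x i : Ball d) : Cn d) :=
      continuous_pi fun i => continuous_subtype_val.comp ((h1 i).const_smul φ)
    exact h.subtype_mk _⟩

/-- `𝕏⁰_{d,n}`: the space of unordered `n`-tuples of distinct points of the ball, the quotient of
the space of ordered ones by the free action of the symmetric group.  Its topology and its smooth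
structure are the quotient ones (the projection is a covering map and a local diffeomorphism);
the latter is the instance `MulAction.instChartedSpaceQuotient`. -/
abbrev X0 (d n : ℕ) : Type := MulAction.orbitRel.Quotient (Equiv.Perm (Fin n)) (Conf d n)

instance (d n : ℕ) : ChartedSpace (Fin n → Cn d) (X0 d n) :=
  MulAction.instChartedSpaceQuotient

/-- The unordered configuration underlying an ordered one. -/
def X0.mk {d n : ℕ} (x : Conf d n) : X0 d n := Quotient.mk _ x

/-- `z` is one of the points of the unordered configuration `x`. -/
def X0.HasPoint {d n : ℕ} (x : X0 d n) (z : Ball d) : Prop :=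
  ∃ y : Conf d n, X0.mk y = x ∧ ∃ i, confPt y i = z

/-- `Aut(𝔹_d)` acts on unordered configurations. -/
instance (d n : ℕ) : MulAction (BallAut d) (X0 d n) where
  smul φ := Quotient.map (fun x => φ • x) (by
    intro x y h
    obtain ⟨σ, hσ⟩ := h
    exact ⟨σ, by rw [← hσ]; rfl⟩)
  one_smul x := Quotient.inductionOn x fun _ => rfl
  mul_smul _ _ x := Quotient.inductionOn x fun _ => rfl

instance (d n : ℕ) : ContinuousConstSMul (BallAut d) (X0 d n) :=
  ⟨fun φ => by
    have h : Continuous fun x : Conf d n => X0.mk (φ • x) :=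
      continuous_quotient_mk'.comp (continuous_const_smul φ)
    exact h.quotient_lift _⟩

/-! ### Regular points of a group action -/

/-- A point is regular if the orbit type is constant near it: the stabilizers of all nearby points
are conjugate to its stabilizer. -/
def IsRegularPoint (G : Type*) {X : Type*} [Group G] [MulAction G X] [TopologicalSpace X]
    (x : X) : Prop :=
  ∀ᶠ y in 𝓝 x, ∃ g : G,
    MulAction.stabilizer G y = (MulAction.stabilizer G x).map (MulAut.conj g).toMonoidHom

theorem isOpen_isRegularPoint (G : Type*) {X : Type*} [Group G] [MulAction G X]
    [TopologicalSpace X] : IsOpen {x : X | IsRegularPoint G x} := by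
  rw [isOpen_iff_eventually]
  intro x hx
  have hx' : IsRegularPoint G x := hx
  filter_upwards [hx'.and hx'.eventually_nhds] with y hy
  obtain ⟨⟨g, hg⟩, hy⟩ := hy
  refine hy.mono fun z hz => ?_
  obtain ⟨h, hh⟩ := hz
  refine ⟨h * g⁻¹, ?_⟩
  rw [hh, hg, Subgroup.map_map]
  congr 1
  ext k
  simp [mul_assoc]

theorem IsRegularPoint.smul {G X : Type*} [Group G] [MulAction G X] [TopologicalSpace X]
    [ContinuousConstSMul G X] {x : X} (hx : IsRegularPoint G x) (g : G) :
    IsRegularPoint G (g • x) := by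
  have h : Filter.Tendsto (fun y : X => g⁻¹ • y) (𝓝 (g • x)) (𝓝 x) := by
    have := ((continuous_const_smul g⁻¹).tendsto (g • x) : Filter.Tendsto _ _ (𝓝 (g⁻¹ • g • x)))
    rwa [inv_smul_smul] at this
  refine (h.eventually hx).mono fun y hy => ?_
  obtain ⟨k, hk⟩ := hy
  refine ⟨g * k * g⁻¹, ?_⟩
  have h1 := MulAction.stabilizer_smul_eq_stabilizer_map_conj g (g⁻¹ • y)
  have h2 := MulAction.stabilizer_smul_eq_stabilizer_map_conj g x
  rw [smul_inv_smul] at h1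
  rw [h1, h2, hk, Subgroup.map_map, Subgroup.map_map]
  congr 1
  ext a
  simp [mul_assoc]

/-- `𝕏^{0,reg}_{d,n}`: the open submanifold of regular points of the action of `Aut(𝔹_d)`. -/
def X0reg (d n : ℕ) : TopologicalSpace.Opens (X0 d n) :=
  ⟨{x | IsRegularPoint (BallAut d) x}, isOpen_isRegularPoint _⟩

instance (d n : ℕ) : ChartedSpace (Fin n → Cn d) (X0reg d n) :=
  TopologicalSpace.Opens.instChartedSpace (X0reg d n)

instance (d n : ℕ) : MulAction (BallAut d) (X0reg d n) where
  smul φ x := ⟨φ • x.1, IsRegularPoint.smul x.2 φ⟩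
  one_smul x := Subtype.ext (one_smul _ x.1)
  mul_smul φ ψ x := Subtype.ext (mul_smul φ ψ x.1)

/-! ### The Drury-Arveson space and the tautological bundle -/

/-- The kernel `k(z, w) = 1 / (1 - ⟨z, w⟩)`, where `⟨z, w⟩` is linear in `z`. -/
def daKer {d : ℕ} (z w : Ball d) : ℂ := 1 / (1 - inner ℂ (w : Cn d) (z : Cn d))

/-- The same kernel, with complex numbers regarded as operators on `ℂ`. -/
def daMatrix (d : ℕ) : Matrix (Ball d) (Ball d) (ℂ →L[ℂ] ℂ) :=
  Matrix.of fun z w => daKer z w • ContinuousLinearMap.id ℂ ℂ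

open scoped ComplexOrder in
theorem inner_pow_sum_nonneg {d : ℕ} (s : Finset (Ball d)) (c : Ball d → ℂ) (m : ℕ) :
    0 ≤ (∑ w ∈ s, ∑ z ∈ s,
      inner ℂ (w : Cn d) (z : Cn d) ^ m * c w * star (c z)).re := by
  have hpsd : (Matrix.of fun z w : s => inner ℂ (w.1 : Cn d) (z.1 : Cn d) ^ m).PosSemidef := by
    induction m with
    | zero =>
      have := Matrix.posSemidef_vecMulVec_self_star (fun _ : s => (1 : ℂ))
      convert this using 1
      ext z w
      simp [Matrix.vecMulVec]
    | succ m ih =>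
      have h1 := (Matrix.posSemidef_gram ℂ (fun z : s => (z.1 : Cn d))).transpose
      have h2 := ih.hadamard h1
      have h3 : (Matrix.of fun z w : s => inner ℂ (w.1 : Cn d) (z.1 : Cn d) ^ (m + 1)) =
          (Matrix.of fun z w : s => inner ℂ (w.1 : Cn d) (z.1 : Cn d) ^ m).hadamard
            (Matrix.gram ℂ (fun z : s => (z.1 : Cn d))).transpose := by
        ext z w
        simp [Matrix.hadamard, Matrix.gram, pow_succ]
      rw [h3]
      exact h2
  have h := hpsd.dotProduct_mulVec_nonneg fun z : s => c z
  have h2 := (Complex.le_def.1 h).1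
  simp only [dotProduct, Matrix.mulVec, Matrix.of_apply, Pi.star_apply, Complex.zero_re,
    Finset.mul_sum] at h2
  rw [Finset.sum_comm] at h2
  rw [← Finset.sum_coe_sort s]
  simp only [← Finset.sum_coe_sort s]
  have h4 : ∀ a b e : ℂ, a * b * e = e * (a * b) := fun a b e => by ring
  simp only [h4]
  exact h2

theorem daKer_sum_nonneg {d : ℕ} (s : Finset (Ball d)) (c : Ball d → ℂ) :
    0 ≤ (∑ w ∈ s, ∑ z ∈ s, daKer z w * c w * star (c z)).re := by
  have hk : ∀ w z : Ball d, HasSum (fun m : ℕ => inner ℂ (w : Cn d) (z : Cn d) ^ m)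
      (daKer z w) := by
    intro w z
    have hw : ‖(w : Cn d)‖ < 1 := by simpa [Ball] using w.2
    have hz : ‖(z : Cn d)‖ < 1 := by simpa [Ball] using z.2
    have := hasSum_geometric_of_norm_lt_one (ξ := inner ℂ (w : Cn d) (z : Cn d))
      ((norm_inner_le_norm _ _).trans_lt
        (mul_lt_one_of_nonneg_of_lt_one_left (norm_nonneg _) hw hz.le))
    simpa [daKer] using this
  have hs := hasSum_sum (s := s) fun w _ => hasSum_sum (s := s) fun z _ =>
    ((hk w z).mul_right (c w)).mul_right (star (c z))
  exact (Complex.hasSum_re hs).nonneg fun m => inner_pow_sum_nonneg s c m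

instance (d : ℕ) : Fact (daMatrix d).PosSemidef := ⟨by
  have htfae := RKHS.posSemidef_tfae (K := daMatrix d)
  refine (htfae.out 0 2).2 (And.intro ?_ fun v => ?_)
  · ext z w
    simp [daMatrix, daKer, Matrix.conjTranspose, ContinuousLinearMap.star_eq_adjoint,
      ContinuousLinearMap.adjoint_id]
  · have h := daKer_sum_nonneg v.support v
    rw [← Complex.conj_re] at h
    simpa [Finsupp.sum, daMatrix, mul_comm, mul_assoc] using h⟩

/-- The Drury-Arveson space `H²_d`: the reproducing kernel Hilbert space on the ball with kernel
`k`. -/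
abbrev DA (d : ℕ) : Type := RKHS.OfKernel (daMatrix d)

/-- The kernel function `k_z` of the Drury-Arveson space. -/
def daFun {d : ℕ} (z : Ball d) : DA d := RKHS.kerFun (DA d) z 1

/-- The fibre of the tautological bundle over an unordered configuration `x`: the span of the
kernel functions at the points of `x`. -/
def tautFibre {d n : ℕ} (x : X0 d n) : Submodule ℂ (DA d) :=
  Submodule.span ℂ {f | ∃ z, x.HasPoint z ∧ daFun z = f}

/-- The total space of the tautological bundle over the regular part, topologized as a subspace
of `𝕏^{0,reg}_{d,n} × H²_d`. -/
abbrev TautTotal (d n : ℕ) : Type :=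
  {e : X0reg d n × DA d // e.2 ∈ tautFibre e.1.1}

/-- For an automorphism `φ` of the ball with `a = φ⁻¹(0)`, the factor `√(1 - ‖a‖²) k_z(a)` by which
the unitary `U_φ^*` of the Drury-Arveson space, which moves the kernel functions along `φ`, takes
`k_z` to a multiple of `k_{φ(z)}`. -/
def autWeight {d : ℕ} (φ : BallAut d) (z : Ball d) : ℂ :=
  (√(1 - ‖((φ⁻¹ • Ball.origin d : Ball d) : Cn d)‖ ^ 2) : ℝ) * daKer (φ⁻¹ • Ball.origin d) z

/-! ### Finite-dimensional complete Pick spaces -/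

/-- The kernel function at `x` of a reproducing kernel Hilbert space of scalar functions. -/
def kfun {X : Type*} (H : Type*) [NormedAddCommGroup H] [InnerProductSpace ℂ H] [CompleteSpace H]
    [RKHS ℂ H X ℂ] (x : X) : H := RKHS.kerFun H x 1

/-- The matrix-valued function `F` is a contractive multiplier `H ⊗ ℂ^q → H ⊗ ℂ^p`. -/
def IsContractiveMultiplier {X : Type*} (H : Type*) [NormedAddCommGroup H] [InnerProductSpace ℂ H]
    [RKHS ℂ H X ℂ] {p q : ℕ} (F : X → Matrix (Fin p) (Fin q) ℂ) : Prop :=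
  ∀ f : PiLp 2 (fun _ : Fin q => H), ∃ g : PiLp 2 (fun _ : Fin p => H),
    (∀ x i, g i x = ∑ j, F x i j * f j x) ∧ ‖g‖ ≤ ‖f‖

open scoped ComplexOrder in
/-- The complete Pick property: matrix-valued Pick interpolation problems of all sizes are solvable
by contractive multipliers exactly when the Pick matrix `((1 - W_i W_j^*) k(x_i, x_j))` is
positive semidefinite. -/
def IsCompletePick {X : Type*} (H : Type*) [NormedAddCommGroup H] [InnerProductSpace ℂ H]
    [CompleteSpace H] [RKHS ℂ H X ℂ] : Prop :=
  ∀ (p q m : ℕ) (x : Fin m → X) (W : Fin m → Matrix (Fin p) (Fin q) ℂ), Function.Injective x →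
    ((∃ F : X → Matrix (Fin p) (Fin q) ℂ, IsContractiveMultiplier H F ∧ ∀ i, F (x i) = W i) ↔
      (Matrix.of fun a b : Fin m × Fin p =>
        (1 - W a.1 * (W b.1).conjTranspose : Matrix (Fin p) (Fin p) ℂ) a.2 b.2 *
          kfun H (x b.1) (x a.1)).PosSemidef)

/-- Irreducibility: no two kernel functions are linearly dependent, and no two are orthogonal. -/
def IsIrreducible {X : Type*} (H : Type*) [NormedAddCommGroup H] [InnerProductSpace ℂ H]
    [CompleteSpace H] [RKHS ℂ H X ℂ] : Prop :=
  ∀ x y : X, x ≠ y → LinearIndependent ℂ ![kfun H x, kfun H y] ∧ inner ℂ (kfun H x) (kfun H y) ≠ 0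

/-- An (irreducible) complete Pick space of dimension `n` on a set of `n` points; the points are
labelled by `Fin n`. -/
structure CPSpace (n : ℕ) where
  /-- the underlying Hilbert space -/
  H : Type
  [normed : NormedAddCommGroup H]
  [inner : InnerProductSpace ℂ H]
  [complete : CompleteSpace H]
  [rkhs : RKHS ℂ H (Fin n) ℂ]
  finrank_eq : Module.finrank ℂ H = n
  irreducible : IsIrreducible H
  completePick : IsCompletePick H

attribute [instance] CPSpace.normed CPSpace.inner CPSpace.complete CPSpace.rkhs

/-- `T` is an isomorphism of reproducing kernel Hilbert spaces: it maps kernel functions to nonzero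
multiples of kernel functions, along a bijection of the underlying sets. -/
def IsRKHSIso {n : ℕ} {S S' : CPSpace n} (T : S.H ≃L[ℂ] S'.H) : Prop :=
  ∃ (φ : Equiv.Perm (Fin n)) (f : Fin n → ℂ), (∀ i, f i ≠ 0) ∧
    ∀ i, T (kfun S.H i) = f i • kfun S'.H (φ i)

/-- The Banach-Mazur type distance of two complete Pick spaces. -/
def rhoRK {n : ℕ} (S S' : CPSpace n) : ℝ :=
  Real.log (sInf {r | ∃ T : S.H ≃L[ℂ] S'.H, IsRKHSIso T ∧
    r = ‖(T : S.H →L[ℂ] S'.H)‖ * ‖(T.symm : S'.H →L[ℂ] S.H)‖})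

/-- The topology given by the distance `rhoRK`. -/
instance (n : ℕ) : TopologicalSpace (CPSpace n) where
  IsOpen U := ∀ S ∈ U, ∃ ε > 0, ∀ S', rhoRK S S' < ε → S' ∈ U
  isOpen_univ := fun _ _ => ⟨1, one_pos, fun _ _ => trivial⟩
  isOpen_inter := fun U V hU hV S hS => by
    obtain ⟨ε, hε, h⟩ := hU S hS.1
    obtain ⟨δ, hδ, h'⟩ := hV S hS.2
    exact ⟨min ε δ, lt_min hε hδ, fun S' hS' =>
      ⟨h S' (hS'.trans_le (min_le_left _ _)), h' S' (hS'.trans_le (min_le_right _ _))⟩⟩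
  isOpen_sUnion := fun 𝒰 h𝒰 S hS => by
    obtain ⟨U, hU, hSU⟩ := hS
    obtain ⟨ε, hε, h⟩ := h𝒰 U hU S hSU
    exact ⟨ε, hε, fun S' hS' => ⟨U, hU, h S' hS'⟩⟩

/-- Two complete Pick spaces are equivalent if there is an isometric isomorphism of reproducing
kernel Hilbert spaces between them. -/
instance cpSetoid (n : ℕ) : Setoid (CPSpace n) where
  r S S' := ∃ T : S.H ≃L[ℂ] S'.H, IsRKHSIso T ∧ ∀ v, ‖T v‖ = ‖v‖
  iseqv := by
    refine ⟨fun S => ⟨.refl ℂ S.H, ⟨1, fun _ => 1, fun _ => one_ne_zero, fun i => ?_⟩,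
      fun _ => rfl⟩, ?_, ?_⟩
    · simp
    · rintro S S' ⟨T, ⟨φ, f, hf, h⟩, hT⟩
      refine ⟨T.symm, ⟨φ.symm, fun i => (f (φ.symm i))⁻¹, fun i => inv_ne_zero (hf _),
        fun i => ?_⟩, fun v => ?_⟩
      · rw [ContinuousLinearEquiv.symm_apply_eq, map_smul, h, smul_smul, inv_mul_cancel₀ (hf _),
          one_smul, Equiv.apply_symm_apply]
      · rw [← hT, ContinuousLinearEquiv.apply_symm_apply]
    · rintro S S' S'' ⟨T, ⟨φ, f, hf, h⟩, hT⟩ ⟨T', ⟨φ', f', hf', h'⟩, hT'⟩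
      refine ⟨T.trans T', ⟨φ.trans φ', fun i => f i * f' (φ i),
        fun i => mul_ne_zero (hf _) (hf' _), fun i => ?_⟩, fun v => ?_⟩
      · simp [h, h', smul_smul]
      · simp [hT, hT']

/-- `Pick_n`: the space of isomorphism classes of complete Pick spaces of dimension `n`, with the
topology given by the distance `rhoRK`. -/
abbrev Pick (n : ℕ) : Type 1 := Quotient (cpSetoid n)

/-- The complete Pick space `S` is a copy of the space `Span{k_{x_1}, …, k_{x_n}}`: it is embedded
isometrically into the Drury-Arveson space with kernel functions `k_{x_1}, …, k_{x_n}`. -/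
def IsSpanOf {d n : ℕ} (S : CPSpace n) (x : Conf d n) : Prop :=
  ∃ J : S.H →ₗᵢ[ℂ] DA d, ∀ i, J (kfun S.H i) = daFun (confPt x i)

/-- The relation `P = [Span{k_{x_1}, …, k_{x_n}}]` between a point `P` of `Pick_n` and an unordered
configuration `x` with points `x_1, …, x_n`. -/
def IsClassOf {d n : ℕ} (P : Pick n) (x : X0 d n) : Prop :=
  ∃ y : Conf d n, X0.mk y = x ∧ ∃ S : CPSpace n, IsSpanOf S y ∧ (⟦S⟧ : Pick n) = P

/-- `Pick_n^reg`: the image of the regular points of `𝕏⁰_{n-1,n}` in `Pick_n`. -/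
def PickReg (n : ℕ) : Set (Pick n) := {P | ∃ x ∈ X0reg (n - 1) n, IsClassOf P x}

/-! ### Smooth principal bundles -/

/-- `p : M → B` is a smooth principal bundle for the group `Aut(𝔹_d)` acting on `M` from the left:
`p` is smooth, and near every point of `B` there is an equivariant trivialization
`x ↦ (p x, γ x)` onto `U × Aut(𝔹_d)` whose unit section `u ↦ s(u)` is smooth and whose
component `γ` is smooth, the latter meaning that `(x, z) ↦ γ(x)(z)` is smooth; so
`x = γ(x) • s(p(x))`. -/
structure IsSmoothPrincipalBundle (d : ℕ)
    (E : Type*) [NormedAddCommGroup E] [NormedSpace ℝ E]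
    {M : Type*} [TopologicalSpace M] [ChartedSpace E M] [MulAction (BallAut d) M]
    (E' : Type*) [NormedAddCommGroup E'] [NormedSpace ℝ E']
    {B : Type*} [TopologicalSpace B] [ChartedSpace E' B] (p : M → B) : Prop where
  topologicalGroup : IsTopologicalGroup (BallAut d)
  continuousSMul : ContinuousSMul (BallAut d) M
  smooth : ContMDiff 𝓘(ℝ, E) 𝓘(ℝ, E') ∞ p
  locallyTrivial : ∀ b : B, ∃ e : Bundle.Trivialization (BallAut d) p, b ∈ e.baseSet ∧
    (∀ x ∈ e.source, ∀ φ : BallAut d, φ • x ∈ e.source ∧ e (φ • x) = ((e x).1, φ * (e x).2)) ∧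
    ContMDiffOn 𝓘(ℝ, E') 𝓘(ℝ, E) ∞ (fun u => e.toOpenPartialHomeomorph.symm (u, 1)) e.baseSet ∧
    ContMDiffOn (𝓘(ℝ, E).prod 𝓘(ℝ, Cn d)) 𝓘(ℝ, Cn d) ∞
      (fun q : M × Ball d => (((e q.1).2 • q.2 : Ball d) : Cn d)) (e.source ×ˢ Set.univ)

end

end PickSpace

namespace PickSpace
noncomputable section
open scoped Manifold ContDiff Topology ComplexConjugate

/-! ### Möbius automorphisms of the ball -/

variable {d : ℕ}

theorem ball_norm_lt (z : Ball d) : ‖(z : Cn d)‖ < 1 := by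
  simpa [Ball] using z.2

theorem mem_Ball_iff {z : Cn d} : z ∈ Ball d ↔ ‖z‖ < 1 := by
  simp [Ball]

theorem one_sub_inner_ne_zero {z w : Cn d} (hz : ‖z‖ < 1) (hw : ‖w‖ < 1) :
    1 - inner ℂ z w ≠ 0 := by
  intro h
  have h1 : inner ℂ z w = (1 : ℂ) := (sub_eq_zero.1 h).symm
  have h2 := norm_inner_le_norm (𝕜 := ℂ) z w
  rw [h1, norm_one] at h2
  nlinarith [norm_nonneg z, norm_nonneg w]

/-- The number `√(1 - ‖a‖²)`. -/
def ballS (a : Cn d) : ℝ := √(1 - ‖a‖ ^ 2)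

theorem ballS_sq {a : Cn d} (ha : ‖a‖ < 1) : (ballS a : ℂ) ^ 2 = 1 - inner ℂ a a := by
  have h : (ballS a) ^ 2 = 1 - ‖a‖ ^ 2 := Real.sq_sqrt (by nlinarith [norm_nonneg a])
  rw [inner_self_eq_norm_sq_to_K, ← Complex.ofReal_pow, h]
  push_cast
  rfl

theorem ballS_pos {a : Cn d} (ha : ‖a‖ < 1) : 0 < ballS a :=
  Real.sqrt_pos.2 (by nlinarith [norm_nonneg a])

theorem one_add_ballS_ne_zero (a : Cn d) : (1 + ballS a : ℂ) ≠ 0 := by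
  have : (1 + ballS a : ℝ) ≠ 0 := by have := Real.sqrt_nonneg (1 - ‖a‖ ^ 2); unfold ballS; positivity
  exact_mod_cast this

/-- The linear map `P_a + √(1 - ‖a‖²) (1 - P_a)`, where `P_a` is the projection onto `a`. -/
def mobLin (a w : Cn d) : Cn d := (ballS a : ℂ) • w + (inner ℂ a w / (1 + ballS a)) • a

/-- The involutive Möbius automorphism of the ball that exchanges `a` and `0`. -/
def mobFun (a z : Cn d) : Cn d := (1 - inner ℂ a z)⁻¹ • mobLin a (a - z)

/-- With `s = ballS a`, the component along `a` is multiplied by `s + (1 - s²)/(1 + s) = 1`.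
Dividing by `1 + s` instead of `‖a‖²` keeps `mobLin` meaningful and smooth at `a = 0`. -/
theorem inner_mobLin {a : Cn d} (ha : ‖a‖ < 1) (w : Cn d) : inner ℂ a (mobLin a w) = inner ℂ a w := by
  have h1 := one_add_ballS_ne_zero a
  have h2 : inner ℂ a a = (1 - (ballS a : ℂ) ^ 2 : ℂ) := by rw [ballS_sq ha]; ring
  rw [mobLin, inner_add_right, inner_smul_right, inner_smul_right, h2]
  field_simp
  ring

theorem mobLin_self {a : Cn d} (ha : ‖a‖ < 1) : mobLin a a = a := by
  have h1 := one_add_ballS_ne_zero a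
  have h2 : inner ℂ a a = (1 - (ballS a : ℂ) ^ 2 : ℂ) := by rw [ballS_sq ha]; ring
  rw [mobLin, h2, ← add_smul]
  convert one_smul ℂ a using 2
  field_simp
  ring

theorem mobLin_mobLin {a : Cn d} (ha : ‖a‖ < 1) (w : Cn d) :
    mobLin a (mobLin a w) = ((ballS a : ℂ) ^ 2) • w + inner ℂ a w • a := by
  have h1 := one_add_ballS_ne_zero a
  rw [mobLin, inner_mobLin ha, mobLin, smul_add, add_assoc, smul_smul, smul_smul, ← add_smul]
  congr 2
  · ring
  · field_simp
    ring

theorem mobLin_add (a v w : Cn d) : mobLin a (v + w) = mobLin a v + mobLin a w := by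
  simp only [mobLin, inner_add_right, add_div, add_smul, smul_add]
  abel

theorem mobLin_smul (a w : Cn d) (c : ℂ) : mobLin a (c • w) = c • mobLin a w := by
  simp only [mobLin, inner_smul_right, smul_add, smul_smul]
  congr 2 <;> ring

theorem mobLin_sub (a v w : Cn d) : mobLin a (v - w) = mobLin a v - mobLin a w := by
  rw [sub_eq_add_neg, mobLin_add, ← neg_one_smul ℂ w, mobLin_smul, neg_one_smul, sub_eq_add_neg]

/-- `mobLin a` is self-adjoint, so everything reduces to its square. -/
theorem inner_mobLin_mobLin {a : Cn d} (ha : ‖a‖ < 1) (v w : Cn d) :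
    inner ℂ (mobLin a v) (mobLin a w) =
      (1 - inner ℂ a a) * inner ℂ v w + inner ℂ v a * inner ℂ a w := by
  have h1 : inner ℂ (mobLin a v) (mobLin a w) = inner ℂ v (mobLin a (mobLin a w)) := by
    have h2 : conj (1 + (ballS a : ℂ)) = 1 + ballS a := by simp
    conv_lhs => rw [mobLin]
    conv_rhs => rw [mobLin]
    simp only [inner_add_left, inner_add_right, inner_smul_left, inner_smul_right, map_div₀, h2,
      Complex.conj_ofReal, inner_conj_symm]
    ring
  rw [h1, mobLin_mobLin ha, inner_add_right, inner_smul_right, inner_smul_right, ballS_sq ha]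
  ring

/-- The basic identity of Möbius maps: for `z = w` it shows that the ball is preserved, and in
general it gives the transformation rule of the kernel. -/
theorem one_sub_inner_mobFun {a z w : Cn d} (ha : ‖a‖ < 1) (hz : ‖z‖ < 1) (hw : ‖w‖ < 1) :
    1 - inner ℂ (mobFun a w) (mobFun a z) =
      (ballS a : ℂ) ^ 2 * (1 - inner ℂ w z) / ((1 - inner ℂ a z) * (1 - inner ℂ w a)) := by
  have h1 := one_sub_inner_ne_zero ha hz
  have h2 := one_sub_inner_ne_zero hw ha
  have h3 : conj (1 - inner ℂ a w)⁻¹ = (1 - inner ℂ w a)⁻¹ := by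
    rw [map_inv₀, map_sub, inner_conj_symm, map_one]
  rw [mobFun, mobFun, inner_smul_left, inner_smul_right, inner_mobLin_mobLin ha, h3, ballS_sq ha]
  simp only [inner_sub_left, inner_sub_right]
  field_simp
  ring

theorem norm_mobFun_lt {a z : Cn d} (ha : ‖a‖ < 1) (hz : ‖z‖ < 1) : ‖mobFun a z‖ < 1 := by
  have h := one_sub_inner_mobFun ha hz hz
  have h3 : 1 - inner ℂ z a = conj (1 - inner ℂ a z) := by
    rw [map_sub, inner_conj_symm, map_one]
  rw [h3, Complex.mul_conj, inner_self_eq_norm_sq_to_K, inner_self_eq_norm_sq_to_K] at h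
  simp only [Complex.coe_algebraMap] at h
  have h4 : 1 - ‖mobFun a z‖ ^ 2 = ballS a ^ 2 * (1 - ‖z‖ ^ 2) / Complex.normSq (1 - inner ℂ a z) := by
    apply Complex.ofReal_injective
    push_cast
    exact h
  have h5 : 0 < Complex.normSq (1 - inner ℂ a z) :=
    Complex.normSq_pos.2 (one_sub_inner_ne_zero ha hz)
  have h6 : 0 < 1 - ‖z‖ ^ 2 := by nlinarith [norm_nonneg z]
  have h7 : 0 < ballS a ^ 2 * (1 - ‖z‖ ^ 2) / Complex.normSq (1 - inner ℂ a z) := by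
    have := ballS_pos ha
    positivity
  nlinarith [norm_nonneg (mobFun a z)]

theorem mobFun_mobFun {a z : Cn d} (ha : ‖a‖ < 1) (hz : ‖z‖ < 1) : mobFun a (mobFun a z) = z := by
  have h1 := one_sub_inner_ne_zero ha hz
  have hs : (1 - inner ℂ a a : ℂ) ≠ 0 := one_sub_inner_ne_zero ha ha
  have h2 : 1 - inner ℂ a (mobFun a z) = (1 - inner ℂ a a) / (1 - inner ℂ a z) := by
    rw [mobFun, inner_smul_right, inner_mobLin ha, inner_sub_right]
    field_simp
    ring
  have h3 : a - mobFun a z = (1 - inner ℂ a z)⁻¹ • mobLin a (z - inner ℂ a z • a) := by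
    rw [mobFun, eq_inv_smul_iff₀ h1, smul_sub, smul_smul, mul_inv_cancel₀ h1, one_smul,
      mobLin_sub, mobLin_sub, mobLin_smul, mobLin_self ha, sub_smul, one_smul]
    abel
  rw [mobFun, h2, h3, mobLin_smul, mobLin_mobLin ha, ballS_sq ha, inner_sub_right, inner_smul_right,
    smul_sub, smul_smul, smul_smul, inv_div, div_mul_eq_mul_div, mul_inv_cancel₀ h1]
  have h4 : ((1 - inner ℂ a a) • z - ((1 - inner ℂ a a) * inner ℂ a z) • a +
      (inner ℂ a z - inner ℂ a z * inner ℂ a a) • a) = (1 - inner ℂ a a) • z := by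
    rw [sub_add, ← sub_smul]
    ring_nf
    simp
  rw [h4, smul_smul, one_div, inv_mul_cancel₀ hs, one_smul]

theorem mobFun_self (a : Cn d) : mobFun a a = 0 := by
  simp [mobFun, mobLin]

theorem mobFun_zero {a : Cn d} (ha : ‖a‖ < 1) : mobFun a 0 = a := by
  simp [mobFun, mobLin_self ha]

theorem differentiableOn_mobFun {a : Cn d} (ha : ‖a‖ < 1) :
    DifferentiableOn ℂ (mobFun a) (Ball d) := by
  have h1 : ∀ b : Cn d, Differentiable ℂ fun z : Cn d => inner ℂ a (b - z) := fun b =>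
    (innerSL ℂ a).differentiable.comp (differentiable_id.const_sub b)
  have h2 : Differentiable ℂ fun z : Cn d => inner ℂ a z := (innerSL ℂ a).differentiable
  intro z hz
  have h3 := one_sub_inner_ne_zero ha (mem_Ball_iff.1 hz)
  refine DifferentiableAt.differentiableWithinAt ?_
  unfold mobFun mobLin
  refine DifferentiableAt.fun_smul (DifferentiableAt.fun_inv ((h2 z).const_sub 1) h3) ?_
  refine DifferentiableAt.fun_add ?_ ?_
  · exact (differentiableAt_id.const_sub a).const_smul (ballS a : ℂ)
  · simp only [div_eq_mul_inv]
    exact ((h1 a z).mul_const _).smul_const a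

/-- Smoothness is needed jointly in the centre and the argument, since the centre will be a moving
point of the configuration. It is only real smoothness: `a` enters through conjugates and norms. -/
theorem contDiffAt_mobFun {a z : Cn d} (ha : ‖a‖ < 1) (hz : ‖z‖ < 1) :
    ContDiffAt ℝ ∞ (fun q : Cn d × Cn d => mobFun q.1 q.2) (a, z) := by
  have h0 : ContDiffAt ℝ ∞ (fun q : Cn d × Cn d => (ballS q.1 : ℂ)) (a, z) := by
    refine Complex.ofRealCLM.contDiff.contDiffAt.comp _ ?_
    refine ContDiffAt.sqrt ?_ ?_
    · exact contDiffAt_const.sub (contDiffAt_fst.norm_sq ℝ)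
    · have : 0 < 1 - ‖a‖ ^ 2 := by nlinarith [norm_nonneg a]
      exact this.ne'
  have h1 : ContDiffAt ℝ ∞ (fun q : Cn d × Cn d => inner ℂ q.1 q.2) (a, z) :=
    contDiffAt_fst.inner ℂ contDiffAt_snd
  have h2 : ContDiffAt ℝ ∞ (fun q : Cn d × Cn d => inner ℂ q.1 (q.1 - q.2)) (a, z) :=
    contDiffAt_fst.inner ℂ (contDiffAt_fst.sub contDiffAt_snd)
  unfold mobFun mobLin
  refine ContDiffAt.smul (ContDiffAt.inv (contDiffAt_const.sub h1) (one_sub_inner_ne_zero ha hz)) ?_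
  refine ContDiffAt.add (h0.smul (contDiffAt_fst.sub contDiffAt_snd)) ?_
  have h3 : ContDiffAt ℝ ∞ (fun q : Cn d × Cn d => q.1) (a, z) := contDiffAt_fst
  have h4 : ContDiffAt ℝ ∞ (fun q : Cn d × Cn d => 1 + (ballS q.1 : ℂ)) (a, z) :=
    contDiffAt_const.add h0
  have h5 : ContDiffAt ℝ ∞ (fun q : Cn d × Cn d => inner ℂ q.1 (q.1 - q.2) /
      (1 + (ballS q.1 : ℂ))) (a, z) := by
    simp only [div_eq_mul_inv]
    exact h2.mul (ContDiffAt.inv h4 (one_add_ballS_ne_zero a))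
  exact h5.smul h3

/-- The Möbius involution as a permutation of the ball. -/
def mobPerm (a : Ball d) : Equiv.Perm (Ball d) :=
  Function.Involutive.toPerm
    (fun z => ⟨mobFun a z, mem_Ball_iff.2 (norm_mobFun_lt (ball_norm_lt a) (ball_norm_lt z))⟩)
    fun z => Subtype.ext (mobFun_mobFun (ball_norm_lt a) (ball_norm_lt z))

/-- The Möbius involution of the ball that exchanges `a` and the origin. -/
def mob (a : Ball d) : BallAut d :=
  ⟨mobPerm a, ⟨mobFun a, differentiableOn_mobFun (ball_norm_lt a), fun _ => rfl⟩,
    ⟨mobFun a, differentiableOn_mobFun (ball_norm_lt a), fun _ => rfl⟩⟩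

theorem coe_mob_smul (a z : Ball d) : ((mob a • z : Ball d) : Cn d) = mobFun a z := rfl

theorem BallAut.ext {φ ψ : BallAut d} (h : ∀ z : Ball d, φ • z = ψ • z) : φ = ψ :=
  Subtype.ext (Equiv.ext h)

theorem mob_mul_self (a : Ball d) : mob a * mob a = 1 := by
  refine BallAut.ext fun z => ?_
  rw [mul_smul, one_smul]
  exact Subtype.ext (mobFun_mobFun (ball_norm_lt a) (ball_norm_lt z))

theorem mob_inv (a : Ball d) : (mob a)⁻¹ = mob a := inv_eq_of_mul_eq_one_left (mob_mul_self a)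

theorem mob_smul_mob_smul (a z : Ball d) : mob a • mob a • z = z := by
  rw [← mul_smul, mob_mul_self, one_smul]

theorem mob_smul_self (a : Ball d) : mob a • a = Ball.origin d := Subtype.ext (mobFun_self _)

theorem mob_smul_origin (a : Ball d) : mob a • Ball.origin d = a :=
  Subtype.ext (mobFun_zero (ball_norm_lt a))

/-- A unitary map as an automorphism of the ball. -/
def linAut (U : Cn d ≃ₗᵢ[ℂ] Cn d) : BallAut d :=
  ⟨⟨fun z => ⟨U z, mem_Ball_iff.2 (by rw [U.norm_map]; exact (ball_norm_lt z))⟩,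
    fun z => ⟨U.symm z, mem_Ball_iff.2 (by rw [U.symm.norm_map]; exact (ball_norm_lt z))⟩,
    fun z => by simp, fun z => by simp⟩,
    ⟨U, U.toContinuousLinearEquiv.differentiable.differentiableOn, fun _ => rfl⟩,
    ⟨U.symm, U.symm.toContinuousLinearEquiv.differentiable.differentiableOn, fun _ => rfl⟩⟩

theorem coe_linAut_smul (U : Cn d ≃ₗᵢ[ℂ] Cn d) (z : Ball d) :
    ((linAut U • z : Ball d) : Cn d) = U z := rfl

theorem coe_linAut_inv_smul (U : Cn d ≃ₗᵢ[ℂ] Cn d) (z : Ball d) :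
    (((linAut U)⁻¹ • z : Ball d) : Cn d) = U.symm z := rfl

/-! ### Automorphisms fixing the origin are unitary -/

/-- The Schwarz lemma in the ball; applied to the inverse as well, it gives equality. -/
theorem norm_smul_le_of_fix {φ : BallAut d} (h0 : φ • Ball.origin d = Ball.origin d) (z : Ball d) :
    ‖((φ • z : Ball d) : Cn d)‖ ≤ ‖(z : Cn d)‖ := by
  obtain ⟨F, hF, hFf⟩ := φ.2.1
  have hF' : ∀ z : Ball d, F z = ((φ • z : Ball d) : Cn d) := hFf
  rw [← hF']
  refine Complex.norm_le_norm_of_mapsTo_ball (R := 1) hF ?_ ?_ (ball_norm_lt z)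
  · intro w hw
    have := hF' ⟨w, hw⟩
    simp only at this
    rw [this]
    exact Metric.ball_subset_closedBall (φ • (⟨w, hw⟩ : Ball d)).2
  · have := hF' (Ball.origin d)
    rw [h0] at this
    exact this

theorem norm_smul_of_fix {φ : BallAut d} (h0 : φ • Ball.origin d = Ball.origin d) (z : Ball d) :
    ‖((φ • z : Ball d) : Cn d)‖ = ‖(z : Cn d)‖ := by
  refine le_antisymm (norm_smul_le_of_fix h0 z) ?_
  have h1 : φ⁻¹ • Ball.origin d = Ball.origin d := by rw [inv_smul_eq_iff, h0]
  simpa using norm_smul_le_of_fix h1 (φ • z)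

/-- The Schwarz lemma holds with equality, so the map is linear on every complex line through the
origin. It therefore coincides with its derivative at the origin, which is then norm preserving. -/
theorem exists_linAut_of_fix {φ : BallAut d} (h0 : φ • Ball.origin d = Ball.origin d) :
    ∃ U : Cn d ≃ₗᵢ[ℂ] Cn d, φ = linAut U := by
  obtain ⟨F, hF, hFf⟩ := φ.2.1
  have hF' : ∀ z : Ball d, F z = ((φ • z : Ball d) : Cn d) := hFf
  have hF0 : F 0 = 0 := by
    have := hF' (Ball.origin d)
    rw [h0] at this
    exact this
  have key : ∀ u : Cn d, ‖u‖ < 1 → F u = fderiv ℂ F 0 u := by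
    intro u hu
    rcases eq_or_ne u 0 with rfl | hu0
    · simp [hF0]
    have hu1 : 0 < ‖u‖ := norm_pos_iff.2 hu0
    have hmem : ∀ ζ ∈ Metric.ball (0 : ℂ) (1 / ‖u‖), ζ • u ∈ Ball d := by
      intro ζ hζ
      rw [mem_ball_zero_iff, lt_div_iff₀ hu1] at hζ
      rwa [mem_Ball_iff, norm_smul]
    have h1 : DifferentiableOn ℂ (fun ζ : ℂ => F (ζ • u)) (Metric.ball 0 (1 / ‖u‖)) :=
      hF.comp ((differentiable_id.smul_const u).differentiableOn) hmem
    have hFu : ‖F u‖ = ‖u‖ := by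
      have := norm_smul_of_fix h0 ⟨u, mem_Ball_iff.2 hu⟩
      rwa [← hF'] at this
    -- The equality case of the Schwarz lemma on the disc of radius `1 / ‖u‖`: the slope between `0`
    -- and `1` has norm `‖F u‖ = ‖u‖`, the extremal value.
    have h2 : Set.EqOn (fun ζ : ℂ => F (ζ • u)) (fun ζ : ℂ => F ((0 : ℂ) • u) +
        (ζ - 0) • dslope (fun ζ : ℂ => F (ζ • u)) 0 1) (Metric.ball 0 (1 / ‖u‖)) := by
      refine Complex.affine_of_mapsTo_ball_of_norm_dslope_eq_div (R₂ := 1) h1 ?_ ?_ ?_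
      · intro ζ hζ
        have := (φ • (⟨ζ • u, hmem ζ hζ⟩ : Ball d)).2
        rw [← hF'] at this
        simpa [hF0, Ball] using (mem_Ball_iff.1 this).le
      · simpa using (one_lt_inv₀ hu1).2 hu
      · rw [dslope_of_ne _ one_ne_zero, slope]
        simp [hF0, hFu]
    have h3 : HasDerivAt (fun ζ : ℂ => F (ζ • u)) (F u) 0 := by
      have h4 : HasDerivAt (fun ζ : ℂ => ζ • F u) ((1 : ℂ) • F u) 0 :=
        (hasDerivAt_id (0 : ℂ)).smul_const (F u)
      rw [one_smul] at h4
      refine h4.congr_of_eventuallyEq ?_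
      filter_upwards [Metric.ball_mem_nhds (0 : ℂ) (one_div_pos.2 hu1)] with ζ hζ
      have := h2 hζ
      simpa [hF0, dslope_of_ne _ (one_ne_zero : (1 : ℂ) ≠ 0), slope] using this
    have h5 : HasDerivAt (fun ζ : ℂ => F (ζ • u)) (fderiv ℂ F 0 u) 0 := by
      have h6 : HasDerivAt (fun ζ : ℂ => ζ • u) ((1 : ℂ) • u) 0 :=
        (hasDerivAt_id (0 : ℂ)).smul_const u
      rw [one_smul] at h6
      have h7 : HasFDerivAt F (fderiv ℂ F 0) ((0 : ℂ) • u) := by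
        rw [zero_smul]
        exact ((hF 0 (Ball.origin d).2).differentiableAt
          ((Ball d).isOpen.mem_nhds (Ball.origin d).2)).hasFDerivAt
      exact h7.comp_hasDerivAt (0 : ℂ) h6
    exact h3.unique h5
  have hiso : ∀ u, ‖fderiv ℂ F 0 u‖ = ‖u‖ := by
    intro u
    have hc : (0 : ℝ) < (1 + ‖u‖)⁻¹ := by positivity
    have hcu : ‖((1 + ‖u‖ : ℝ) : ℂ)⁻¹ • u‖ < 1 := by
      rw [norm_smul, norm_inv, Complex.norm_real, Real.norm_of_nonneg (by positivity),
        inv_mul_lt_iff₀ (by positivity)]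
      linarith
    have h1 := norm_smul_of_fix h0 ⟨_, mem_Ball_iff.2 hcu⟩
    rw [← hF', key _ hcu, map_smul, norm_smul, norm_smul] at h1
    refine mul_left_cancel₀ ?_ h1
    rw [norm_inv, Complex.norm_real, Real.norm_of_nonneg (by positivity)]
    exact hc.ne'
  let L : Cn d →ₗᵢ[ℂ] Cn d := ⟨(fderiv ℂ F 0 : Cn d →ₗ[ℂ] Cn d), hiso⟩
  refine ⟨L.toLinearIsometryEquiv rfl, BallAut.ext fun z => Subtype.ext ?_⟩
  rw [coe_linAut_smul, ← hF', key z (ball_norm_lt z)]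
  rfl

theorem BallAut.eq_linAut_mul_mob (φ : BallAut d) :
    ∃ U : Cn d ≃ₗᵢ[ℂ] Cn d, φ = linAut U * mob (φ⁻¹ • Ball.origin d) := by
  have h : (φ * mob (φ⁻¹ • Ball.origin d)) • Ball.origin d = Ball.origin d := by
    rw [mul_smul, mob_smul_origin, smul_inv_smul]
  obtain ⟨U, hU⟩ := exists_linAut_of_fix h
  refine ⟨U, ?_⟩
  rw [← hU, mul_assoc, mob_mul_self, mul_one]

/-! ### The kernel and the automorphisms -/

theorem autWeight_eq (φ : BallAut d) (z : Ball d) :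
    autWeight φ z = ballS ((φ⁻¹ • Ball.origin d : Ball d) : Cn d) *
      daKer (φ⁻¹ • Ball.origin d) z := rfl

theorem daKer_ne_zero (z w : Ball d) : daKer z w ≠ 0 :=
  one_div_ne_zero (one_sub_inner_ne_zero (ball_norm_lt w) (ball_norm_lt z))

theorem autWeight_ne_zero (φ : BallAut d) (z : Ball d) : autWeight φ z ≠ 0 := by
  rw [autWeight_eq]
  exact mul_ne_zero (Complex.ofReal_ne_zero.2 (ballS_pos (ball_norm_lt _)).ne') (daKer_ne_zero _ _)

theorem conj_daKer (z w : Ball d) : conj (daKer z w) = daKer w z := by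
  simp only [daKer, map_div₀, map_sub, map_one, inner_conj_symm]

/-- Only the Möbius factor of `φ` contributes, because the unitary factor preserves inner products.
-/
theorem daKer_smul (φ : BallAut d) (z w : Ball d) :
    daKer z w = conj (autWeight φ z) * autWeight φ w * daKer (φ • z) (φ • w) := by
  obtain ⟨U, hU⟩ := φ.eq_linAut_mul_mob
  rw [autWeight_eq, autWeight_eq]
  set a : Ball d := φ⁻¹ • Ball.origin d
  have hin : ∀ x y : Ball d, inner ℂ ((φ • x : Ball d) : Cn d) ((φ • y : Ball d) : Cn d) =
      inner ℂ (mobFun (a : Cn d) x) (mobFun (a : Cn d) y) := by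
    intro x y
    rw [hU, mul_smul, mul_smul, coe_linAut_smul, coe_linAut_smul, U.inner_map_map]
    rfl
  have h1 := one_sub_inner_ne_zero (ball_norm_lt a) (ball_norm_lt z)
  have h2 := one_sub_inner_ne_zero (ball_norm_lt w) (ball_norm_lt a)
  have h3 := one_sub_inner_ne_zero (ball_norm_lt w) (ball_norm_lt z)
  have h4 : (ballS (a : Cn d) : ℂ) ≠ 0 := Complex.ofReal_ne_zero.2 (ballS_pos (ball_norm_lt a)).ne'
  rw [map_mul, conj_daKer, Complex.conj_ofReal]
  simp only [daKer, hin]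
  rw [one_sub_inner_mobFun (ball_norm_lt a) (ball_norm_lt z) (ball_norm_lt w)]
  field_simp

/-! ### The topological group of automorphisms -/

instance (d : ℕ) : LocallyCompactSpace (Ball d) := by
  have : ProperSpace (Cn d) := FiniteDimensional.proper_rclike ℂ _
  exact (Ball d).isOpen.locallyCompactSpace

/-- The exponential law for the compact-open topology, which uses that the ball is locally compact.
-/
theorem continuous_ballAut_iff {X : Type*} [TopologicalSpace X] {f : X → BallAut d} :
    Continuous f ↔ Continuous fun q : X × Ball d => f q.1 • q.2 := by
  have h1 : Continuous f ↔ Continuous fun x =>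
      (⟨fun z => f x • z, continuous_const_smul (f x)⟩ : C(Ball d, Ball d)) :=
    continuous_induced_rng
  rw [h1]
  constructor
  · intro h
    exact ContinuousEval.continuous_eval.comp (h.prodMap continuous_id)
  · intro h
    exact ContinuousMap.continuous_of_continuous_uncurry _ h

instance (d : ℕ) : ContinuousSMul (BallAut d) (Ball d) :=
  ⟨continuous_ballAut_iff.1 continuous_id⟩

theorem continuous_mobFun : Continuous fun q : Ball d × Ball d => mobFun (q.1 : Cn d) q.2 := by
  rw [continuous_iff_continuousAt]
  intro q
  exact (contDiffAt_mobFun (ball_norm_lt q.1) (ball_norm_lt q.2)).continuousAt.comp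
    (f := fun q : Ball d × Ball d => ((q.1 : Cn d), (q.2 : Cn d))) (by fun_prop)

theorem continuous_coe_mob_smul {X : Type*} [TopologicalSpace X] {f g : X → Ball d}
    (hf : Continuous f) (hg : Continuous g) :
    Continuous fun x => ((mob (f x) • g x : Ball d) : Cn d) := by
  have h : Continuous fun x => (f x, g x) := hf.prodMk hg
  have h2 := (continuous_mobFun (d := d)).comp h
  exact h2

theorem half_single_mem (i : Fin d) : EuclideanSpace.single i (1 / 2 : ℂ) ∈ Ball d := by
  rw [mem_Ball_iff, EuclideanSpace.single, PiLp.norm_single]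
  norm_num

/-- Continuity of inversion requires an expression for `φ⁻¹` in terms of `φ`. After a Möbius
correction `φ` is a unitary `U`, and the coordinates of `U⁻¹ w` are the inner products of `w` with
the vectors `U e_i`. As `e_i` is not in the open ball, `e_i / 2` is used, whence the factor 2. -/
theorem coe_inv_smul_apply (φ : BallAut d) (z : Ball d) (i : Fin d) :
    ((φ⁻¹ • z : Ball d) : Cn d) i = 2 * inner ℂ
      ((mob (φ • Ball.origin d) • φ • (⟨_, half_single_mem i⟩ : Ball d) : Ball d) : Cn d)
      ((mob (φ • Ball.origin d) • z : Ball d) : Cn d) := by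
  have h : (mob (φ • Ball.origin d) * φ) • Ball.origin d = Ball.origin d := by
    rw [mul_smul, mob_smul_self]
  obtain ⟨U, hU⟩ := exists_linAut_of_fix h
  have h2 : φ⁻¹ • z = (linAut U)⁻¹ • mob (φ • Ball.origin d) • z := by
    rw [← hU, mul_inv_rev, mob_inv, mul_smul, mob_smul_mob_smul]
  rw [h2, coe_linAut_inv_smul, ← mul_smul, hU, coe_linAut_smul]
  conv_rhs => rw [← U.apply_symm_apply ((mob (φ • Ball.origin d) • z : Ball d) : Cn d)]
  rw [U.inner_map_map, EuclideanSpace.inner_single_left, map_div₀, map_one, Complex.conj_ofNat]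
  ring

instance (d : ℕ) : IsTopologicalGroup (BallAut d) where
  continuous_mul := by
    rw [continuous_ballAut_iff]
    simp only [mul_smul]
    fun_prop
  continuous_inv := by
    rw [continuous_ballAut_iff]
    refine continuous_induced_rng.2 ?_
    rw [(PiLp.homeomorph 2 _).isInducing.continuous_iff]
    refine continuous_pi fun i => ?_
    have h0 : Continuous fun q : BallAut d × Ball d => q.1 • Ball.origin d := by
      fun_prop
    have h1 : Continuous fun q : BallAut d × Ball d =>
        q.1 • (⟨_, half_single_mem i⟩ : Ball d) := by fun_prop
    have h2 := continuous_coe_mob_smul h0 h1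
    have h3 := continuous_coe_mob_smul h0 continuous_snd
    have h4 := continuous_const.mul (h2.inner (𝕜 := ℂ) h3) (f := fun _ => (2 : ℂ))
    refine h4.congr fun q => ?_
    exact (coe_inv_smul_apply q.1 q.2 i).symm

attribute [irreducible] mobFun mobLin

end
end PickSpace

/-! ### The equivariant moving frame and the normal form of a configuration. -/

namespace PickSpace
noncomputable section
open scoped Manifold ContDiff Topology ComplexConjugate
open InnerProductSpace

variable {d : ℕ}

/-! ### Gram-Schmidt frames -/

theorem gramSchmidt_map {ι E F : Type*} [LinearOrder ι] [LocallyFiniteOrderBot ι] [WellFoundedLT ι]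
    [NormedAddCommGroup E] [InnerProductSpace ℂ E] [NormedAddCommGroup F] [InnerProductSpace ℂ F]
    (V : E →ₗᵢ[ℂ] F) (f : ι → E) (i : ι) :
    gramSchmidt ℂ (fun j => V (f j)) i = V (gramSchmidt ℂ f i) := by
  induction i using WellFoundedLT.induction with
  | ind i ih =>
    have h1 := gramSchmidt_def'' ℂ (fun j => V (f j)) i
    have h2 := gramSchmidt_def'' ℂ f i
    have h3 : ∑ j ∈ Finset.Iio i, (inner ℂ (gramSchmidt ℂ (fun j => V (f j)) j) (V (f i)) /
        RCLike.ofReal (K := ℂ) ‖gramSchmidt ℂ (fun j => V (f j)) j‖ ^ 2) • gramSchmidt ℂ (fun j => V (f j)) j =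
        V (∑ j ∈ Finset.Iio i, (inner ℂ (gramSchmidt ℂ f j) (f i) /
        RCLike.ofReal (K := ℂ) ‖gramSchmidt ℂ f j‖ ^ 2) • gramSchmidt ℂ f j) := by
      rw [map_sum]
      refine Finset.sum_congr rfl fun j hj => ?_
      rw [ih j (Finset.mem_Iio.1 hj), V.inner_map_map, V.norm_map, map_smul]
    rw [h3] at h1
    have h4 : V (f i) = V (gramSchmidt ℂ f i) + V (∑ j ∈ Finset.Iio i,
        (inner ℂ (gramSchmidt ℂ f j) (f i) /
        RCLike.ofReal (K := ℂ) ‖gramSchmidt ℂ f j‖ ^ 2) • gramSchmidt ℂ f j) := by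
      rw [← map_add]
      exact congrArg V h2
    exact add_right_cancel (h1.symm.trans h4)

theorem gramSchmidtNormed_map {ι E F : Type*} [LinearOrder ι] [LocallyFiniteOrderBot ι]
    [WellFoundedLT ι] [NormedAddCommGroup E] [InnerProductSpace ℂ E] [NormedAddCommGroup F]
    [InnerProductSpace ℂ F] (V : E →ₗᵢ[ℂ] F) (f : ι → E) (i : ι) :
    gramSchmidtNormed ℂ (fun j => V (f j)) i = V (gramSchmidtNormed ℂ f i) := by
  rw [gramSchmidtNormed, gramSchmidtNormed, gramSchmidt_map, V.norm_map, map_smul]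

/-- In the recursion the only denominators are squared norms of earlier vectors, which do not vanish
for a linearly independent family. -/
theorem contDiffAt_gramSchmidt {f : Fin d → Cn d} (hf : LinearIndependent ℂ f) (i : Fin d) :
    ContDiffAt ℝ ∞ (fun f : Fin d → Cn d => gramSchmidt ℂ f i) f := by
  induction i using WellFoundedLT.induction with
  | ind i ih =>
    have h1 : (fun f : Fin d → Cn d => gramSchmidt ℂ f i) = fun f => f i -
        ∑ j ∈ Finset.Iio i, (inner ℂ (gramSchmidt ℂ f j) (f i) *
          (inner ℂ (gramSchmidt ℂ f j) (gramSchmidt ℂ f j))⁻¹) • gramSchmidt ℂ f j := by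
      funext f
      rw [eq_sub_iff_add_eq]
      conv_rhs => rw [gramSchmidt_def'' ℂ f i]
      simp only [inner_self_eq_norm_sq_to_K, div_eq_mul_inv]
    rw [h1]
    have h2 : ContDiffAt ℝ ∞ (fun f : Fin d → Cn d => f i) f :=
      (contDiff_apply ℝ (Cn d) i).contDiffAt
    refine h2.sub (ContDiffAt.sum fun j hj => ?_)
    have h3 := ih j (Finset.mem_Iio.1 hj)
    refine ContDiffAt.smul (ContDiffAt.mul (h3.inner ℂ h2) (ContDiffAt.inv (h3.inner ℂ h3) ?_)) h3
    exact inner_self_ne_zero.2 (gramSchmidt_ne_zero j hf)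

theorem contDiffAt_gramSchmidtNormed {f : Fin d → Cn d} (hf : LinearIndependent ℂ f) (i : Fin d) :
    ContDiffAt ℝ ∞ (fun f : Fin d → Cn d => gramSchmidtNormed ℂ f i) f := by
  have h1 := contDiffAt_gramSchmidt hf i
  have h2 : ContDiffAt ℝ ∞ (fun f : Fin d → Cn d => ‖gramSchmidt ℂ f i‖⁻¹) f :=
    (h1.norm ℂ (gramSchmidt_ne_zero i hf)).inv (norm_ne_zero_iff.2 (gramSchmidt_ne_zero i hf))
  have h3 : (fun f : Fin d → Cn d => gramSchmidtNormed ℂ f i) =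
      fun f => ‖gramSchmidt ℂ f i‖⁻¹ • gramSchmidt ℂ f i := by
    funext f
    rw [gramSchmidtNormed, ← Complex.coe_smul, Complex.ofReal_inv]
    rfl
  rw [h3]
  exact h2.smul h1

/-- The unitary map that takes the standard basis to the Gram-Schmidt orthonormalization. -/
def gsUnitary (f : Fin d → Cn d) : Cn d ≃ₗᵢ[ℂ] Cn d :=
  (gramSchmidtOrthonormalBasis (𝕜 := ℂ) (ι := Fin d) (E := Cn d) (by simp) f).repr.symm

theorem gsUnitary_apply {f : Fin d → Cn d} (hf : LinearIndependent ℂ f) (z : Cn d) :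
    gsUnitary f z = ∑ i, z i • gramSchmidtNormed ℂ f i := by
  rw [gsUnitary, ← OrthonormalBasis.sum_repr_symm]
  refine Finset.sum_congr rfl fun i _ => ?_
  rw [gramSchmidtOrthonormalBasis_apply]
  exact (gramSchmidtNormed_linearIndependent hf).ne_zero i

theorem gsUnitary_symm_apply {f : Fin d → Cn d} (hf : LinearIndependent ℂ f) (z : Cn d)
    (i : Fin d) : (gsUnitary f).symm z i = inner ℂ (gramSchmidtNormed ℂ f i) z := by
  rw [gsUnitary, LinearIsometryEquiv.symm_symm, OrthonormalBasis.repr_apply_apply,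
    gramSchmidtOrthonormalBasis_apply]
  exact (gramSchmidtNormed_linearIndependent hf).ne_zero i

/-- Gram-Schmidt commutes with isometries; this is the unitary part of the equivariance of the
moving frame. -/
theorem gsUnitary_map (V : Cn d ≃ₗᵢ[ℂ] Cn d) {f : Fin d → Cn d} (hf : LinearIndependent ℂ f) :
    gsUnitary (fun i => V (f i)) = (gsUnitary f).trans V := by
  have hf' : LinearIndependent ℂ fun i => V (f i) :=
    hf.map' V.toLinearEquiv.toLinearMap (LinearEquiv.ker _)
  ext1 z
  rw [gsUnitary_apply hf', LinearIsometryEquiv.trans_apply, gsUnitary_apply hf, map_sum]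
  refine Finset.sum_congr rfl fun i _ => ?_
  rw [map_smul]
  exact congrArg _ (gramSchmidtNormed_map V.toLinearIsometry f i)

theorem gsUnitary_symm_triangular {f : Fin d → Cn d} {i j : Fin d} (hij : i < j) :
    (gsUnitary f).symm (f i) j = 0 := by
  rw [gsUnitary, LinearIsometryEquiv.symm_symm]
  exact gramSchmidtOrthonormalBasis_inv_triangular' _ f hij

theorem gsUnitary_symm_diag {f : Fin d → Cn d} (hf : LinearIndependent ℂ f) (i : Fin d) :
    (gsUnitary f).symm (f i) i = (‖gramSchmidt ℂ f i‖ : ℂ) := by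
  have h0 := gramSchmidt_ne_zero i hf
  rw [gsUnitary_symm_apply hf]
  conv_lhs => rw [gramSchmidt_def'' ℂ f i, gramSchmidtNormed]
  rw [inner_add_right, inner_sum, Finset.sum_eq_zero, add_zero, inner_smul_left,
    inner_self_eq_norm_sq_to_K]
  · have : (‖gramSchmidt ℂ f i‖ : ℂ) ≠ 0 := by simpa using h0
    simp
    field_simp
  · intro j hj
    rw [inner_smul_right, inner_smul_left, gramSchmidt_orthogonal ℂ f (Finset.mem_Iio.1 hj).ne']
    simp

/-- Uniqueness of the Cholesky decomposition. -/
theorem triangular_unique {l l' : Fin d → Cn d} (hl : ∀ i j, i < j → l i j = 0)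
    (hl' : ∀ i j, i < j → l' i j = 0) (hd : ∀ i, ∃ r : ℝ, 0 < r ∧ l i i = (r : ℂ))
    (hd' : ∀ i, ∃ r : ℝ, 0 ≤ r ∧ l' i i = (r : ℂ)) (h : ∀ i j, inner ℂ (l i) (l j) = inner ℂ (l' i) (l' j)) :
    l = l' := by
  have key : ∀ j, ∀ i, l i j = l' i j := by
    intro j
    induction j using WellFoundedLT.induction with
    | ind j ih =>
      -- Row `j` has no entries beyond column `j`. So its inner products determine column `j` from
      -- the earlier columns, once the diagonal entry is pinned down by its sign.
      have hsum : ∀ m : Fin d → Cn d, (∀ i j, i < j → m i j = 0) → ∀ i, inner ℂ (m j) (m i) =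
          m i j * conj (m j j) + ∑ k ∈ Finset.Iio j, m i k * conj (m j k) := by
        intro m hm i
        rw [PiLp.inner_apply, ← Finset.sum_subset (Finset.subset_univ (Finset.Iic j))]
        · rw [← Finset.Iio_insert, Finset.sum_insert (by simp)]
          rfl
        · intro k _ hk
          have : j < k := by simpa using hk
          simp [hm j k this]
      have h1 : ∀ i, l i j * conj (l j j) = l' i j * conj (l' j j) := by
        intro i
        have h2 := h j i
        rw [hsum l hl, hsum l' hl'] at h2
        have h3 : ∑ k ∈ Finset.Iio j, l i k * conj (l j k) =
            ∑ k ∈ Finset.Iio j, l' i k * conj (l' j k) :=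
          Finset.sum_congr rfl fun k hk => by
            rw [ih k (Finset.mem_Iio.1 hk), ih k (Finset.mem_Iio.1 hk)]
        rw [h3] at h2
        exact add_right_cancel h2
      obtain ⟨r, hr, hrl⟩ := hd j
      obtain ⟨r', hr', hrl'⟩ := hd' j
      have h4 := h1 j
      rw [hrl, hrl', Complex.conj_ofReal, Complex.conj_ofReal] at h4
      have h5 : r * r = r' * r' := Complex.ofReal_injective (by push_cast; exact h4)
      have h6 : r = r' := by nlinarith
      intro i
      have h7 := h1 i
      rw [hrl, hrl', ← h6, Complex.conj_ofReal] at h7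
      exact mul_right_cancel₀ (Complex.ofReal_ne_zero.2 hr.ne') h7
  funext i
  ext j
  exact key j i

/-! ### The moving frame of a configuration -/

/-- The images of the points `x 1, …, x d` under the Möbius involution that moves `x 0` to `0`. -/
def relVec (x : Fin (d + 1) → Cn d) (i : Fin d) : Cn d := mobFun (x 0) (x i.succ)

/-- A configuration is in general position if it is not contained in a proper affine subspace. -/
def IsGeneral (x : Fin (d + 1) → Cn d) : Prop := LinearIndependent ℂ (relVec x)

theorem mobLin_injective {a : Cn d} (ha : ‖a‖ < 1) : Function.Injective (mobLin a) := by
  intro v w h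
  have h1 : inner ℂ a v = inner ℂ a w := by rw [← inner_mobLin ha v, h, inner_mobLin ha]
  have h2 : ((ballS a : ℂ) ^ 2) ≠ 0 :=
    pow_ne_zero 2 (Complex.ofReal_ne_zero.2 (ballS_pos ha).ne')
  have h3 : mobLin a (mobLin a v) = mobLin a (mobLin a w) := by rw [h]
  rw [mobLin_mobLin ha, mobLin_mobLin ha, h1] at h3
  exact smul_right_injective _ h2 (add_right_cancel h3)

theorem mobFun_eq (a z : Cn d) : mobFun a z = (1 - inner ℂ a z)⁻¹ • mobLin a (a - z) := by
  rw [mobFun]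

/-- Up to nonzero scalars, the relative vectors are the images of the differences under the
injective linear map `mobLin (x 0)`. -/
theorem isGeneral_iff_sub {x : Fin (d + 1) → Cn d} (hx : ∀ i, ‖x i‖ < 1) :
    IsGeneral x ↔ LinearIndependent ℂ fun i : Fin d => x i.succ - x 0 := by
  let M : Cn d →ₗ[ℂ] Cn d := ⟨⟨mobLin (x 0), mobLin_add (x 0)⟩, fun c w => mobLin_smul (x 0) w c⟩
  have hM : LinearMap.ker M = ⊥ := LinearMap.ker_eq_bot.2 (mobLin_injective (hx 0))
  let u : Fin d → ℂˣ := fun i =>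
    -(Units.mk0 _ (one_sub_inner_ne_zero (hx 0) (hx i.succ)))⁻¹
  have h1 : relVec x = u • fun i : Fin d => M (x i.succ - x 0) := by
    funext i
    have h2 : (u i : ℂ) = -(1 - inner ℂ (x 0) (x i.succ))⁻¹ := by simp [u]
    change mobFun (x 0) (x i.succ) = (u i : ℂ) • mobLin (x 0) (x i.succ - x 0)
    rw [h2, mobFun_eq, ← neg_sub (x i.succ) (x 0), ← neg_one_smul ℂ (x i.succ - x 0), mobLin_smul,
      smul_smul, mul_neg_one]
  rw [IsGeneral, h1, LinearIndependent.units_smul_iff]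
  exact M.linearIndependent_iff hM

/-- `relVec` singles out the zeroth point; affine independence does not, and this yields invariance
under reorderings. -/
theorem isGeneral_iff_affineIndependent {x : Fin (d + 1) → Cn d} (hx : ∀ i, ‖x i‖ < 1) :
    IsGeneral x ↔ AffineIndependent ℂ x := by
  rw [isGeneral_iff_sub hx, affineIndependent_iff_linearIndependent_vsub ℂ x 0]
  rw [← linearIndependent_equiv (finSuccAboveEquiv (0 : Fin (d + 1)))]
  rfl

theorem Conf.norm_lt {n : ℕ} (y : Conf d n) (i : Fin n) : ‖y.1 i‖ < 1 := mem_Ball_iff.1 (y.2.1 i)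

theorem isGeneral_perm (σ : Equiv.Perm (Fin (d + 1))) {y : Conf d (d + 1)} (hy : IsGeneral y.1) :
    IsGeneral (σ • y).1 := by
  rw [isGeneral_iff_affineIndependent (Conf.norm_lt _)] at hy ⊢
  exact (affineIndependent_equiv σ⁻¹).2 hy

theorem coe_smul_conf {n : ℕ} (φ : BallAut d) (y : Conf d n) (i : Fin n) :
    (φ • y).1 i = ((φ • confPt y i : Ball d) : Cn d) := rfl

theorem confPt_smul {n : ℕ} (φ : BallAut d) (y : Conf d n) (i : Fin n) :
    confPt (φ • y) i = φ • confPt y i := rfl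

theorem confPt_perm {n : ℕ} (σ : Equiv.Perm (Fin n)) (y : Conf d n) (i : Fin n) :
    confPt (σ • y) i = confPt y (σ⁻¹ i) := rfl

theorem relVec_eq (y : Conf d (d + 1)) (i : Fin d) :
    relVec y.1 i = ((mob (confPt y 0) • confPt y i.succ : Ball d) : Cn d) := rfl

/-- Conjugating `φ` by the two Möbius involutions centred at the zeroth points gives an automorphism
that fixes the origin, hence a unitary map. -/
theorem exists_relVec_smul (φ : BallAut d) (y : Conf d (d + 1)) : ∃ V : Cn d ≃ₗᵢ[ℂ] Cn d,
    φ * mob (confPt y 0) = mob (confPt (φ • y) 0) * linAut V ∧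
    relVec (φ • y).1 = fun i => V (relVec y.1 i) := by
  have h : (mob (confPt (φ • y) 0) * φ * mob (confPt y 0)) • Ball.origin d = Ball.origin d := by
    rw [mul_smul, mob_smul_origin, mul_smul, ← confPt_smul, mob_smul_self]
  obtain ⟨V, hV⟩ := exists_linAut_of_fix h
  refine ⟨V, ?_, ?_⟩
  · rw [← hV, ← mul_assoc, ← mul_assoc, mob_mul_self, one_mul]
  · funext i
    rw [relVec_eq, relVec_eq, ← coe_linAut_smul, ← hV, confPt_smul φ y i.succ, mul_smul, mul_smul,
      mob_smul_mob_smul]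

theorem isGeneral_smul (φ : BallAut d) {y : Conf d (d + 1)} (hy : IsGeneral y.1) :
    IsGeneral (φ • y).1 := by
  obtain ⟨V, -, hV⟩ := exists_relVec_smul φ y
  rw [IsGeneral, hV]
  exact hy.map' V.toLinearEquiv.toLinearMap (LinearEquiv.ker _)

/-- The moving frame: an automorphism of the ball attached equivariantly to a configuration. -/
def frame (y : Conf d (d + 1)) : BallAut d := mob (confPt y 0) * linAut (gsUnitary (relVec y.1))

theorem frame_smul (φ : BallAut d) {y : Conf d (d + 1)} (hy : IsGeneral y.1) :
    frame (φ • y) = φ * frame y := by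
  obtain ⟨V, hV1, hV⟩ := exists_relVec_smul φ y
  have h1 : linAut ((gsUnitary (relVec y.1)).trans V) =
      linAut V * linAut (gsUnitary (relVec y.1)) := BallAut.ext fun z => rfl
  rw [frame, frame, hV, gsUnitary_map V hy, h1, ← mul_assoc, ← mul_assoc, hV1]

/-- The normal form of a configuration under the action of the automorphism group. -/
def normalForm (y : Conf d (d + 1)) : Conf d (d + 1) := (frame y)⁻¹ • y

theorem frame_smul_normalForm (y : Conf d (d + 1)) : frame y • normalForm y = y :=
  smul_inv_smul _ _

theorem normalForm_smul (φ : BallAut d) {y : Conf d (d + 1)} (hy : IsGeneral y.1) :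
    normalForm (φ • y) = normalForm y := by
  rw [normalForm, frame_smul φ hy, mul_inv_rev, mul_smul, inv_smul_smul, normalForm]

theorem frame_normalForm {y : Conf d (d + 1)} (hy : IsGeneral y.1) :
    frame (normalForm y) = 1 := by
  rw [normalForm, frame_smul _ hy, inv_mul_cancel]

theorem exists_smul_of_normalForm_eq {y y' : Conf d (d + 1)} (h : normalForm y = normalForm y') :
    y' = (frame y' * (frame y)⁻¹) • y := by
  rw [mul_smul, ← normalForm, h, frame_smul_normalForm]

/-- The configurations in normal form. -/
def slice (d : ℕ) : Set (Fin (d + 1) → Cn d) :=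
  {x | x 0 = 0 ∧ (∀ i j : Fin d, i < j → x i.succ j = 0) ∧
    ∀ i : Fin d, ∃ r : ℝ, 0 < r ∧ x i.succ i = (r : ℂ)}

theorem normalForm_zero (y : Conf d (d + 1)) : (normalForm y).1 0 = 0 := by
  rw [normalForm, coe_smul_conf, frame, mul_inv_rev, mul_smul, mob_inv, mob_smul_self,
    coe_linAut_inv_smul]
  exact map_zero _

theorem normalForm_succ (y : Conf d (d + 1)) (i : Fin d) :
    (normalForm y).1 i.succ = (gsUnitary (relVec y.1)).symm (relVec y.1 i) := by
  rw [normalForm, coe_smul_conf, frame, mul_inv_rev, mul_smul, mob_inv, coe_linAut_inv_smul,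
    relVec_eq]

theorem normalForm_mem_slice {y : Conf d (d + 1)} (hy : IsGeneral y.1) :
    (normalForm y).1 ∈ slice d := by
  refine ⟨normalForm_zero y, fun i j hij => ?_, fun i => ⟨‖gramSchmidt ℂ (relVec y.1) i‖, ?_, ?_⟩⟩
  · rw [normalForm_succ, gsUnitary_symm_triangular hij]
  · exact norm_pos_iff.2 (gramSchmidt_ne_zero i hy)
  · rw [normalForm_succ, gsUnitary_symm_diag hy]

/-- The Möbius involution centred at the origin is `z ↦ -z`. -/
theorem relVec_of_zero {x : Fin (d + 1) → Cn d} (h : x 0 = 0) (i : Fin d) :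
    relVec x i = -x i.succ := by
  rw [relVec, h, mobFun, mobLin]
  simp [ballS]

theorem inner_normalForm {y : Conf d (d + 1)} (h0 : y.1 0 = 0) (i j : Fin (d + 1)) :
    inner ℂ ((normalForm y).1 i) ((normalForm y).1 j) = inner ℂ (y.1 i) (y.1 j) := by
  refine Fin.cases ?_ (fun i => ?_) i
  · rw [normalForm_zero, h0, inner_zero_left, inner_zero_left]
  · refine Fin.cases ?_ (fun j => ?_) j
    · rw [normalForm_zero, h0, inner_zero_right, inner_zero_right]
    · rw [normalForm_succ, normalForm_succ, LinearIsometryEquiv.inner_map_map, relVec_of_zero h0,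
        relVec_of_zero h0, inner_neg_neg]

theorem isGeneral_of_mem_slice {x : Fin (d + 1) → Cn d} (hx : x ∈ slice d) : IsGeneral x := by
  have h1 : LinearIndependent ℂ fun i : Fin d => x i.succ := by
    have hdet : IsUnit (Matrix.of fun i j : Fin d => x i.succ j) := by
      rw [Matrix.isUnit_iff_isUnit_det, Matrix.det_of_isLowerTriangular, isUnit_iff_ne_zero,
        Finset.prod_ne_zero_iff]
      · intro i _
        obtain ⟨r, hr, h⟩ := hx.2.2 i
        rw [Matrix.of_apply, h]
        exact Complex.ofReal_ne_zero.2 hr.ne'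
      · intro i j hij
        exact hx.2.1 i j hij
    have h2 := Matrix.linearIndependent_rows_iff_isUnit.2 hdet
    exact (LinearMap.linearIndependent_iff (WithLp.linearEquiv 2 ℂ (Fin d → ℂ)).toLinearMap
      (LinearEquiv.ker _)).1 h2
  have h2 : relVec x = (-1 : ℂˣ) • fun i : Fin d => x i.succ := by
    funext i
    rw [relVec_of_zero hx.1]
    simp [Units.smul_def]
  rw [IsGeneral, h2]
  exact h1.units_smul fun _ => (-1 : ℂˣ)

/-- Since the zeroth point is already the origin, `y` and its normal form have the same Gram matrix.
Both are triangular with positive diagonal, so uniqueness of the Cholesky decomposition applies. -/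
theorem normalForm_of_mem_slice {y : Conf d (d + 1)} (hy : y.1 ∈ slice d) : normalForm y = y := by
  have h := normalForm_mem_slice (isGeneral_of_mem_slice hy)
  have h1 := triangular_unique (l := fun i => (normalForm y).1 i.succ) (l' := fun i => y.1 i.succ)
    h.2.1 hy.2.1 h.2.2 (fun i => (hy.2.2 i).imp fun r hr => ⟨hr.1.le, hr.2⟩)
    fun i j => inner_normalForm hy.1 _ _
  refine Subtype.ext (funext fun i => Fin.cases ?_ (fun i => ?_) i)
  · rw [normalForm_zero, hy.1]
  · exact congrFun h1 i

theorem frame_eq_one_of_mem_slice {y : Conf d (d + 1)} (hy : y.1 ∈ slice d) : frame y = 1 := by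
  rw [← normalForm_of_mem_slice hy]
  exact frame_normalForm (isGeneral_of_mem_slice hy)

/-! ### Smoothness of the moving frame -/

/-- The action of the moving frame, as a function on the ambient space. -/
def frameFun (x : Fin (d + 1) → Cn d) (z : Cn d) : Cn d :=
  mobFun (x 0) (∑ j, z j • gramSchmidtNormed ℂ (relVec x) j)

/-- The normal form, as a function on the ambient space. -/
def normalFun (x : Fin (d + 1) → Cn d) (i : Fin (d + 1)) : Cn d :=
  Fin.cases 0 (fun i => WithLp.toLp 2 fun j =>
    inner ℂ (gramSchmidtNormed ℂ (relVec x) j) (relVec x i)) i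

/-- `gsUnitary` completes a degenerate family to an orthonormal basis by choice, so the ambient
formula is claimed only in general position. -/
theorem coe_frame_smul {y : Conf d (d + 1)} (hy : IsGeneral y.1) (z : Ball d) :
    ((frame y • z : Ball d) : Cn d) = frameFun y.1 z := by
  rw [frame, mul_smul, coe_mob_smul, coe_linAut_smul, gsUnitary_apply hy]
  rfl

theorem coe_normalForm {y : Conf d (d + 1)} (hy : IsGeneral y.1) :
    (normalForm y).1 = normalFun y.1 := by
  funext i
  refine Fin.cases ?_ (fun i => ?_) i
  · rw [normalForm_zero]
    rfl
  · rw [normalForm_succ]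
    ext j
    rw [gsUnitary_symm_apply hy]
    rfl

theorem contDiffAt_relVec {x : Fin (d + 1) → Cn d} (hx : ∀ i, ‖x i‖ < 1) :
    ContDiffAt ℝ ∞ (fun x : Fin (d + 1) → Cn d => relVec x) x := by
  rw [contDiffAt_pi]
  intro i
  have h1 : ContDiffAt ℝ ∞ (fun x : Fin (d + 1) → Cn d => (x 0, x i.succ)) x :=
    ContDiffAt.prodMk (contDiff_apply ℝ (Cn d) 0).contDiffAt
      (contDiff_apply ℝ (Cn d) i.succ).contDiffAt
  exact (contDiffAt_mobFun (hx 0) (hx i.succ)).comp x h1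

theorem contDiffAt_gramSchmidtNormed_relVec {x : Fin (d + 1) → Cn d} (hx : ∀ i, ‖x i‖ < 1)
    (hg : IsGeneral x) (j : Fin d) :
    ContDiffAt ℝ ∞ (fun x : Fin (d + 1) → Cn d => gramSchmidtNormed ℂ (relVec x) j) x :=
  (contDiffAt_gramSchmidtNormed hg j).comp x (contDiffAt_relVec hx)

theorem contDiffAt_normalFun {x : Fin (d + 1) → Cn d} (hx : ∀ i, ‖x i‖ < 1) (hg : IsGeneral x) :
    ContDiffAt ℝ ∞ (fun x : Fin (d + 1) → Cn d => normalFun x) x := by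
  rw [contDiffAt_pi]
  intro i
  refine Fin.cases ?_ (fun i => ?_) i
  · exact contDiffAt_const
  · refine (contDiffAt_piLp 2).2 fun j => ?_
    exact (contDiffAt_gramSchmidtNormed_relVec hx hg j).inner ℂ
      (contDiffAt_pi.1 (contDiffAt_relVec hx) i)

theorem contDiffAt_frameFun {y : Conf d (d + 1)} (hg : IsGeneral y.1) (z : Ball d) :
    ContDiffAt ℝ ∞ (fun q : (Fin (d + 1) → Cn d) × Cn d => frameFun q.1 q.2) (y.1, (z : Cn d)) := by
  have h1 : ContDiffAt ℝ ∞ (fun q : (Fin (d + 1) → Cn d) × Cn d =>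
      ∑ j, q.2 j • gramSchmidtNormed ℂ (relVec q.1) j) (y.1, (z : Cn d)) := by
    refine ContDiffAt.sum fun j _ => ?_
    have h2 : ContDiffAt ℝ ∞ (fun q : (Fin (d + 1) → Cn d) × Cn d => q.2 j) (y.1, (z : Cn d)) :=
      (contDiffAt_piLp 2).1 contDiffAt_snd j
    have h3 : ContDiffAt ℝ ∞ (fun q : (Fin (d + 1) → Cn d) × Cn d =>
        gramSchmidtNormed ℂ (relVec q.1) j) (y.1, (z : Cn d)) :=
      ContDiffAt.comp (y.1, (z : Cn d))
        (g := fun x : Fin (d + 1) → Cn d => gramSchmidtNormed ℂ (relVec x) j) (f := Prod.fst)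
        (contDiffAt_gramSchmidtNormed_relVec (Conf.norm_lt y) hg j) contDiffAt_fst
    exact h2.smul h3
  have h2 : ContDiffAt ℝ ∞ (fun q : (Fin (d + 1) → Cn d) × Cn d => q.1 0) (y.1, (z : Cn d)) :=
    ((contDiff_apply ℝ (Cn d) 0).comp contDiff_fst).contDiffAt
  have h3 : ‖∑ j, (z : Cn d) j • gramSchmidtNormed ℂ (relVec y.1) j‖ < 1 := by
    rw [← gsUnitary_apply hg, LinearIsometryEquiv.norm_map]
    exact ball_norm_lt z
  exact ContDiffAt.comp (y.1, (z : Cn d)) (g := fun q : Cn d × Cn d => mobFun q.1 q.2)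
    (contDiffAt_mobFun (Conf.norm_lt y 0) h3) (h2.prodMk h1)

attribute [irreducible] frame normalForm frameFun normalFun relVec

end
end PickSpace

/-! ### Free configurations: openness, density, and their identification with the regular points. -/

namespace PickSpace
noncomputable section
open scoped Manifold ContDiff Topology ComplexConjugate
open InnerProductSpace

variable {d : ℕ}

/-! ### Continuity of the moving frame -/

theorem continuous_relVec : Continuous fun y : Conf d (d + 1) => relVec y.1 := by
  rw [continuous_iff_continuousAt]
  intro y
  exact (contDiffAt_relVec (Conf.norm_lt y)).continuousAt.comp continuous_subtype_val.continuousAt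

theorem isOpen_isGeneral : IsOpen {y : Conf d (d + 1) | IsGeneral y.1} :=
  isOpen_setOfPred_linearIndependent.preimage continuous_relVec

theorem continuousAt_normalForm {y : Conf d (d + 1)} (hy : IsGeneral y.1) :
    ContinuousAt normalForm y := by
  rw [Topology.IsInducing.subtypeVal.continuousAt_iff]
  have h1 : ContinuousAt (fun y : Conf d (d + 1) => normalFun y.1) y :=
    (contDiffAt_normalFun (Conf.norm_lt y) hy).continuousAt.comp
      continuous_subtype_val.continuousAt
  refine h1.congr ?_
  filter_upwards [isOpen_isGeneral.mem_nhds hy] with y' hy'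
  exact (coe_normalForm hy').symm

theorem continuousOn_frame : ContinuousOn frame {y : Conf d (d + 1) | IsGeneral y.1} := by
  rw [continuousOn_iff_continuous_domRestrict, continuous_ballAut_iff, continuous_induced_rng]
  rw [continuous_iff_continuousAt]
  intro q
  have h1 := (contDiffAt_frameFun q.1.2 q.2).continuousAt
  have h2 : ContinuousAt (fun q : {y : Conf d (d + 1) | IsGeneral y.1} × Ball d =>
      (q.1.1.1, (q.2 : Cn d))) q := by fun_prop
  have h3 := ContinuousAt.comp (x := q) (g := fun q : (Fin (d + 1) → Cn d) × Cn d =>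
    frameFun q.1 q.2) h1 h2
  refine h3.congr (Filter.Eventually.of_forall fun q => ?_)
  exact (coe_frame_smul q.1.2 q.2).symm

/-! ### Configurations with trivial stabilizer -/

theorem X0.mk_eq_mk_iff {n : ℕ} {y y' : Conf d n} :
    X0.mk y = X0.mk y' ↔ ∃ σ : Equiv.Perm (Fin n), σ • y' = y :=
  Quotient.eq (r := MulAction.orbitRel _ _)

theorem X0.smul_mk {n : ℕ} (φ : BallAut d) (y : Conf d n) : φ • X0.mk y = X0.mk (φ • y) := rfl

theorem X0.mk_perm {n : ℕ} (σ : Equiv.Perm (Fin n)) (y : Conf d n) : X0.mk (σ • y) = X0.mk y :=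
  X0.mk_eq_mk_iff.2 ⟨σ, rfl⟩

theorem X0.mk_surjective {n : ℕ} : Function.Surjective (X0.mk : Conf d n → X0 d n) :=
  Quotient.mk_surjective

theorem X0.continuous_mk {n : ℕ} : Continuous (X0.mk : Conf d n → X0 d n) :=
  continuous_quotient_mk'

theorem X0.isOpenMap_mk {n : ℕ} : IsOpenMap (X0.mk : Conf d n → X0 d n) :=
  isOpenMap_quotient_mk'_mul

theorem smul_perm_comm {n : ℕ} (φ : BallAut d) (σ : Equiv.Perm (Fin n)) (y : Conf d n) :
    φ • σ • y = σ • φ • y := rfl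

/-- A configuration is free if it is in general position and no reordering of it has the same
normal form. -/
def IsFree (y : Conf d (d + 1)) : Prop :=
  IsGeneral y.1 ∧ ∀ σ : Equiv.Perm (Fin (d + 1)), σ ≠ 1 → normalForm (σ • y) ≠ normalForm y

theorem isOpen_isFree : IsOpen {y : Conf d (d + 1) | IsFree y} := by
  rw [isOpen_iff_eventually]
  intro y hy
  have h1 : ∀ᶠ y' in 𝓝 y, ∀ σ : Equiv.Perm (Fin (d + 1)), σ ≠ 1 →
      normalForm (σ • y') ≠ normalForm y' := by
    rw [Filter.eventually_all]
    intro σ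
    by_cases hσ : σ = 1
    · simp [hσ]
    · have h2 : ContinuousAt (fun y' => normalForm (σ • y')) y :=
        ContinuousAt.comp (g := normalForm) (f := fun y' => σ • y')
          (continuousAt_normalForm (isGeneral_perm σ hy.1)) (continuous_const_smul σ).continuousAt
      exact ((h2.prodMk (continuousAt_normalForm hy.1)).eventually
        (isClosed_diagonal.isOpen_compl.mem_nhds (hy.2 σ hσ))).mono fun _ h _ => h
  filter_upwards [isOpen_isGeneral.mem_nhds hy.1, h1] with y' h h'
  exact ⟨h, h'⟩

theorem linAut_eq_one {V : Cn d ≃ₗᵢ[ℂ] Cn d} (h : linAut V = 1) (u : Cn d) : V u = u := by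
  have hc : (((1 + ‖u‖ : ℝ) : ℂ))⁻¹ ≠ 0 := by
    have : (0 : ℝ) < 1 + ‖u‖ := by positivity
    exact inv_ne_zero (Complex.ofReal_ne_zero.2 this.ne')
  have hcu : ‖((1 + ‖u‖ : ℝ) : ℂ)⁻¹ • u‖ < 1 := by
    rw [norm_smul, norm_inv, Complex.norm_real, Real.norm_of_nonneg (by positivity),
      inv_mul_lt_iff₀ (by positivity)]
    linarith
  have h1 : linAut V • (⟨_, mem_Ball_iff.2 hcu⟩ : Ball d) = ⟨_, mem_Ball_iff.2 hcu⟩ := by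
    rw [h, one_smul]
  have h2 := congrArg Subtype.val h1
  rw [coe_linAut_smul, map_smul] at h2
  exact smul_right_injective _ hc h2

theorem conf_ext {n : ℕ} {y y' : Conf d n} (h : ∀ i, confPt y i = confPt y' i) : y = y' :=
  Subtype.ext (funext fun i => congrArg Subtype.val (h i))

/-- With the zeroth point moved to the origin, all points lie in a proper subspace, and the
reflection in that subspace fixes them. -/
theorem exists_smul_eq_self_of_not_isGeneral {y : Conf d (d + 1)} (hy : ¬ IsGeneral y.1) :
    ∃ φ : BallAut d, φ ≠ 1 ∧ φ • y = y := by
  set K := Submodule.span ℂ (Set.range (relVec y.1)) with hK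
  have hKtop : K ≠ ⊤ := fun h => hy (linearIndependent_of_top_le_span_of_card_eq_finrank h.ge
    (by simp))
  have hKo : Kᗮ ≠ ⊥ := fun h => hKtop ((Submodule.orthogonal_eq_bot_iff).1 h)
  obtain ⟨u, hu, hu0⟩ := Submodule.exists_mem_ne_zero_of_ne_bot hKo
  set φ := mob (confPt y 0) * linAut K.reflection * mob (confPt y 0) with hφ
  refine ⟨φ, fun h => ?_, ?_⟩
  · have h1 : linAut K.reflection = 1 := by
      have : linAut K.reflection = mob (confPt y 0) * φ * mob (confPt y 0) := by
        rw [hφ, mul_assoc, mul_assoc, mul_assoc, mob_mul_self, mul_one, ← mul_assoc, mob_mul_self,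
          one_mul]
      rw [this, h, mul_one, mob_mul_self]
    have h2 := linAut_eq_one h1 u
    rw [Submodule.reflection_mem_subspace_orthogonalComplement_eq_neg hu] at h2
    have h3 : (2 : ℂ) • u = 0 := by
      rw [two_smul]
      nth_rewrite 1 [← h2]
      exact neg_add_cancel u
    exact hu0 ((smul_eq_zero.1 h3).resolve_left two_ne_zero)
  · refine conf_ext fun i => ?_
    have h3 : linAut K.reflection • mob (confPt y 0) • confPt y i =
        mob (confPt y 0) • confPt y i := by
      apply Subtype.ext
      rw [coe_linAut_smul]
      refine K.reflection_mem_subspace_eq_self ?_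
      refine Fin.cases ?_ (fun i => ?_) i
      · rw [mob_smul_self]
        exact K.zero_mem
      · exact Submodule.subset_span ⟨i, relVec_eq y i⟩
    rw [confPt_smul, hφ, mul_smul, mul_smul, h3, mob_smul_mob_smul]

/-- An automorphism fixes the unordered configuration when it acts on `y` as some reordering `σ`. In
general position such a `σ` exists exactly when `σ • y` and `y` have the same normal form, and `σ =
1` forces the automorphism to be trivial by equivariance of the frame. Degenerate configurations are
ruled out by a reflection. -/
theorem stabilizer_eq_bot_iff (y : Conf d (d + 1)) :
    MulAction.stabilizer (BallAut d) (X0.mk y) = ⊥ ↔ IsFree y := by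
  rw [Subgroup.eq_bot_iff_forall]
  constructor
  · intro h
    have hgen : IsGeneral y.1 := by
      by_contra hy
      obtain ⟨φ, hφ, hφy⟩ := exists_smul_eq_self_of_not_isGeneral hy
      exact hφ (h φ (by rw [MulAction.mem_stabilizer_iff, X0.smul_mk, hφy]))
    refine ⟨hgen, fun σ hσ hn => hσ ?_⟩
    have h1 := exists_smul_of_normalForm_eq hn
    have h2 := h _ (MulAction.mem_stabilizer_iff.2 (show (frame y * (frame (σ • y))⁻¹) • X0.mk y =
      X0.mk y by rw [X0.smul_mk, ← X0.mk_perm σ, ← smul_perm_comm, ← h1]))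
    rw [h2, one_smul] at h1
    exact IsCancelSMul.right_cancel σ 1 y (by rw [one_smul, ← h1])
  · intro h φ hφ
    rw [MulAction.mem_stabilizer_iff, X0.smul_mk, X0.mk_eq_mk_iff] at hφ
    obtain ⟨σ, hσ⟩ := hφ
    have h1 : normalForm (σ • y) = normalForm y := by rw [hσ, normalForm_smul φ h.1]
    have h2 : σ = 1 := by
      by_contra hne
      exact h.2 σ hne h1
    rw [h2, one_smul] at hσ
    have h3 := frame_smul φ h.1
    rw [← hσ] at h3
    exact mul_eq_right.1 h3.symm

/-! ### Density of the free configurations -/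

/-- On the real line through `y` and a point where `f` does not vanish, the identity theorem forbids
`f` to vanish near `y`. That point need not be a configuration. -/
theorem dense_ne_zero {n : ℕ} {f : (Fin n → Cn d) → ℂ} (hf : ContDiff ℝ ω f)
    (h : ∃ z, f z ≠ 0) : Dense {y : Conf d n | f y.1 ≠ 0} := by
  obtain ⟨z, hz⟩ := h
  intro y
  have hl : ContDiff ℝ ω fun s : ℝ => y.1 + s • (z - y.1) := by fun_prop
  have hg : AnalyticOnNhd ℝ (fun s : ℝ => f (y.1 + s • (z - y.1))) Set.univ := fun s _ =>
    (hf.comp hl).contDiffAt.analyticAt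
  have hfr : ∃ᶠ s in 𝓝 (0 : ℝ), f (y.1 + s • (z - y.1)) ≠ 0 := by
    intro hev
    have h1 := hg.eqOn_zero_of_preconnected_of_eventuallyEq_zero isPreconnected_univ
      (Set.mem_univ 0) (hev.mono fun s hs => not_not.1 hs)
    have h2 := h1 (Set.mem_univ 1)
    simp only [one_smul, add_sub_cancel, Pi.zero_apply] at h2
    exact hz h2
  have ht : Filter.Tendsto (fun s : ℝ => y.1 + s • (z - y.1)) (𝓝 0) (𝓝 y.1) := by
    have := hl.continuous.tendsto 0
    simpa using this
  rw [Topology.IsInducing.subtypeVal.closure_eq_preimage_closure_image, Set.mem_preimage,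
    mem_closure_iff_frequently]
  refine ht.frequently ((hfr.and_eventually (ht.eventually ((Conf d n).isOpen.mem_nhds y.2))).mono
    fun s hs => ⟨⟨_, hs.2⟩, hs.1, rfl⟩)

/-- The cross-multiplied difference of the pseudo-hyperbolic distances of two pairs of points. -/
def distDiff {n : ℕ} (i j k l : Fin n) (x : Fin n → Cn d) : ℂ :=
  (1 - inner ℂ (x i) (x j)) * (1 - inner ℂ (x j) (x i)) *
      ((1 - inner ℂ (x k) (x k)) * (1 - inner ℂ (x l) (x l))) -
    (1 - inner ℂ (x k) (x l)) * (1 - inner ℂ (x l) (x k)) *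
      ((1 - inner ℂ (x i) (x i)) * (1 - inner ℂ (x j) (x j)))

theorem contDiff_distDiff {n : ℕ} (i j k l : Fin n) :
    ContDiff ℝ ω (distDiff i j k l : (Fin n → Cn d) → ℂ) := by
  have h : ∀ i j : Fin n, ContDiff ℝ ω fun x : Fin n → Cn d => 1 - inner ℂ (x i) (x j) :=
    fun i j => contDiff_const.sub ((contDiff_apply ℝ (Cn d) i).inner ℂ (contDiff_apply ℝ (Cn d) j))
  exact (((h i j).mul (h j i)).mul ((h k k).mul (h l l))).sub
    (((h k l).mul (h l k)).mul ((h i i).mul (h j j)))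

theorem exists_distDiff_ne_zero {i j k l : Fin (d + 1)} (hij : i ≠ j) (hik : i ≠ k) (hil : i ≠ l) :
    ∃ x : Fin (d + 1) → Cn d, distDiff i j k l x ≠ 0 := by
  have hd : 0 < d := by
    rcases Nat.eq_zero_or_pos d with rfl | h
    · exact absurd (Subsingleton.elim (α := Fin 1) i j) hij
    · exact h
  set v : Cn d := EuclideanSpace.single ⟨0, hd⟩ (1 / 2 : ℂ)
  have hv : inner ℂ v v = (1 / 4 : ℂ) := by
    rw [EuclideanSpace.inner_single_left, map_div₀, map_one, Complex.conj_ofNat]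
    simp [v]
    norm_num
  -- All points except the `i`-th are put at the origin. Since `i` is none of `j`, `k`, `l`, only
  -- the pair `(i, j)` has positive distance.
  refine ⟨Pi.single i v, ?_⟩
  rw [distDiff]
  simp only [Pi.single_eq_same, Pi.single_eq_of_ne hij.symm, Pi.single_eq_of_ne hik.symm,
    Pi.single_eq_of_ne hil.symm, inner_zero_left, inner_zero_right, hv]
  norm_num

/-- The determinant that detects general position. -/
def generalDet (x : Fin (d + 1) → Cn d) : ℂ :=
  (Matrix.of fun i j : Fin d => (x i.succ - x 0) j).det

theorem isGeneral_of_generalDet {y : Conf d (d + 1)} (h : generalDet y.1 ≠ 0) : IsGeneral y.1 := by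
  rw [isGeneral_iff_sub (Conf.norm_lt y)]
  have h2 := Matrix.linearIndependent_rows_iff_isUnit.2
    ((Matrix.isUnit_iff_isUnit_det _).2 (isUnit_iff_ne_zero.2 h))
  exact (LinearMap.linearIndependent_iff (WithLp.linearEquiv 2 ℂ (Fin d → ℂ)).toLinearMap
      (LinearEquiv.ker _)).1 h2

theorem contDiff_generalDet : ContDiff ℝ ω (generalDet : (Fin (d + 1) → Cn d) → ℂ) := by
  unfold generalDet
  simp only [Matrix.det_apply']
  refine ContDiff.sum fun σ _ => contDiff_const.mul (contDiff_prod fun i _ => ?_)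
  have h : ContDiff ℝ ω fun x : Fin (d + 1) → Cn d => x (σ i).succ - x 0 :=
    (contDiff_apply ℝ (Cn d) _).sub (contDiff_apply ℝ (Cn d) _)
  exact (contDiff_piLp 2).1 h i

theorem exists_generalDet_ne_zero : ∃ x : Fin (d + 1) → Cn d, generalDet x ≠ 0 := by
  refine ⟨Fin.cons 0 fun i => EuclideanSpace.single i 1, ?_⟩
  have : (Matrix.of fun i j : Fin d => ((Fin.cons 0 fun i => EuclideanSpace.single i 1 :
      Fin (d + 1) → Cn d) i.succ - (Fin.cons 0 fun i => EuclideanSpace.single i 1 :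
      Fin (d + 1) → Cn d) 0) j) = 1 := by
    ext i j
    simp [Matrix.one_apply, eq_comm]
  rw [generalDet, this, Matrix.det_one]
  exact one_ne_zero

theorem one_sub_inner_smul (φ : BallAut d) (z w : Ball d) :
    1 - inner ℂ ((φ • w : Ball d) : Cn d) ((φ • z : Ball d) : Cn d) =
      conj (autWeight φ z) * autWeight φ w * (1 - inner ℂ (w : Cn d) (z : Cn d)) := by
  have h := daKer_smul φ z w
  have h1 := one_sub_inner_ne_zero (ball_norm_lt w) (ball_norm_lt z)
  have h2 := one_sub_inner_ne_zero (ball_norm_lt (φ • w)) (ball_norm_lt (φ • z))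
  rw [daKer, daKer] at h
  field_simp at h
  rw [h]
  ring

/-- Automorphisms preserve the pseudo-hyperbolic distance: the weights that they introduce occur
equally in both products. -/
theorem distDiff_eq_zero_of_smul_eq {n : ℕ} {y : Conf d n} {φ : BallAut d}
    {σ : Equiv.Perm (Fin n)} (h : φ • y = σ • y) (i j : Fin n) :
    distDiff (σ⁻¹ i) (σ⁻¹ j) i j y.1 = 0 := by
  have h1 : ∀ i, y.1 (σ⁻¹ i) = ((φ • confPt y i : Ball d) : Cn d) := fun i =>
    (congrFun (congrArg Subtype.val h) i).symm
  have h2 : ∀ i, y.1 i = (confPt y i : Cn d) := fun _ => rfl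
  rw [distDiff]
  simp only [h1, one_sub_inner_smul]
  simp only [h2]
  ring

/-- A symmetry of the configuration permutes its pseudo-hyperbolic distances. Off the zero sets of
finitely many analytic functions these distances show enough asymmetry to exclude every nontrivial
permutation of three or more points. With two points the transposition always preserves the only
distance, which is why `d = 1` is exceptional. -/
theorem dense_isFree (hd : d ≠ 1) : Dense {y : Conf d (d + 1) | IsFree y} := by
  let I := {q : Fin (d + 1) × Fin (d + 1) × Fin (d + 1) × Fin (d + 1) //
    q.1 ≠ q.2.1 ∧ q.1 ≠ q.2.2.1 ∧ q.1 ≠ q.2.2.2}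
  let F : Option I → (Fin (d + 1) → Cn d) → ℂ := fun o => o.elim generalDet
    fun q => distDiff q.1.1 q.1.2.1 q.1.2.2.1 q.1.2.2.2
  have hF : ∀ o, ContDiff ℝ ω (F o) := by
    rintro (_ | q)
    · exact contDiff_generalDet
    · exact contDiff_distDiff _ _ _ _
  have hF0 : ∀ o, ∃ z, F o z ≠ 0 := by
    rintro (_ | q)
    · exact exists_generalDet_ne_zero
    · exact exists_distDiff_ne_zero q.2.1 q.2.2.1 q.2.2.2
  have hdense := dense_iInter_of_isOpen (f := fun o => {y : Conf d (d + 1) | F o y.1 ≠ 0})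
    (fun o => isOpen_ne_fun ((hF o).continuous.comp continuous_subtype_val) continuous_const)
    fun o => dense_ne_zero (hF o) (hF0 o)
  refine hdense.mono fun y hy => ?_
  rw [Set.mem_iInter] at hy
  have hgen : IsGeneral y.1 := isGeneral_of_generalDet (hy none)
  refine ⟨hgen, fun σ hσ hn => hσ ?_⟩
  have h1 := exists_smul_of_normalForm_eq hn.symm
  have h2 : ∀ i j, distDiff (σ⁻¹ i) (σ⁻¹ j) i j y.1 = 0 := distDiff_eq_zero_of_smul_eq h1.symm
  -- Otherwise `σ⁻¹ i` differs from `σ⁻¹ j`, `i` and `j`, and the corresponding `distDiff` was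
  -- required not to vanish.
  have h3 : ∀ i j, i ≠ j → σ⁻¹ i = i ∨ σ⁻¹ i = j := by
    intro i j hij
    by_contra hc
    push Not at hc
    exact hy (some ⟨(σ⁻¹ i, σ⁻¹ j, i, j), fun h => hij (σ⁻¹.injective h), hc.1, hc.2⟩) (h2 i j)
  have h4 : σ⁻¹ = 1 := by
    ext1 i
    by_contra hi
    have h5 : ∀ j, i ≠ j → σ⁻¹ i = j := fun j hij => (h3 i j hij).resolve_left hi
    -- If `i` is moved, every other index equals `σ⁻¹ i`, so there are at most two points; as `d ≠
    -- 1`, only one point is left.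
    have h6 : Fintype.card (Fin (d + 1)) ≤ 2 := by
      have : (Finset.univ : Finset (Fin (d + 1))) ⊆ {i, σ⁻¹ i} := by
        intro j _
        by_cases hij : i = j
        · simp [hij]
        · simp [h5 j hij]
      exact (Finset.card_le_card this).trans Finset.card_le_two
    rw [Fintype.card_fin] at h6
    have hd0 : d = 0 := by omega
    subst hd0
    exact hi (Subsingleton.elim (α := Fin 1) _ _)
  exact inv_eq_one.1 h4

/-! ### The regular points -/

/-- By density there are free configurations near any point, so at a regular point the stabilizer is
conjugate to a trivial one. The converse is openness of the free configurations. -/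
theorem isRegularPoint_mk_iff (hd : d ≠ 1) (y : Conf d (d + 1)) :
    IsRegularPoint (BallAut d) (X0.mk y) ↔ IsFree y := by
  constructor
  · intro h
    have h1 : ∃ᶠ y' in 𝓝 y, IsFree y' := mem_closure_iff_frequently.1 (dense_isFree hd y)
    have h2 := X0.continuous_mk.continuousAt.eventually h
    obtain ⟨y', hy', g, hg⟩ := (h1.and_eventually h2).exists
    rw [(stabilizer_eq_bot_iff y').2 hy'] at hg
    rw [← stabilizer_eq_bot_iff]
    exact ((Subgroup.map_eq_bot_iff_of_injective _ (MulAut.conj g).injective).1 hg.symm)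
  · intro h
    have h1 : X0.mk '' {y | IsFree y} ∈ 𝓝 (X0.mk y) :=
      (X0.isOpenMap_mk _ isOpen_isFree).mem_nhds ⟨y, h, rfl⟩
    refine Filter.mem_of_superset h1 ?_
    rintro _ ⟨y', hy', rfl⟩
    refine ⟨1, ?_⟩
    rw [(stabilizer_eq_bot_iff y').2 hy', (stabilizer_eq_bot_iff y).2 h, Subgroup.map_bot]

theorem mk_mem_X0reg_iff (hd : d ≠ 1) (y : Conf d (d + 1)) :
    X0.mk y ∈ X0reg d (d + 1) ↔ IsFree y := isRegularPoint_mk_iff hd y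

theorem mem_X0reg_iff (hd : d ≠ 1) (x : X0 d (d + 1)) :
    x ∈ X0reg d (d + 1) ↔ MulAction.stabilizer (BallAut d) x = ⊥ := by
  obtain ⟨y, rfl⟩ := X0.mk_surjective x
  rw [mk_mem_X0reg_iff hd, stabilizer_eq_bot_iff]

theorem isFree_perm (σ : Equiv.Perm (Fin (d + 1))) {y : Conf d (d + 1)} (hy : IsFree y) :
    IsFree (σ • y) := by
  rw [← stabilizer_eq_bot_iff, X0.mk_perm, stabilizer_eq_bot_iff]
  exact hy

theorem isFree_smul (φ : BallAut d) {y : Conf d (d + 1)} (hy : IsFree y) : IsFree (φ • y) := by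
  refine ⟨isGeneral_smul φ hy.1, fun σ hσ h => hy.2 σ hσ ?_⟩
  rwa [← smul_perm_comm, normalForm_smul φ (isGeneral_perm σ hy.1), normalForm_smul φ hy.1] at h

theorem isFree_normalForm {y : Conf d (d + 1)} (hy : IsFree y) : IsFree (normalForm y) := by
  rw [normalForm]
  exact isFree_smul _ hy

end
end PickSpace

/-! ### Gram matrices and the independence of the Drury-Arveson kernel functions. -/

namespace PickSpace
noncomputable section
open scoped Manifold ContDiff Topology ComplexConjugate ComplexOrder
open InnerProductSpace

variable {d : ℕ}

/-! ### Gram matrices -/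

section Gram

variable {ι E F : Type*} [Fintype ι] [NormedAddCommGroup E] [InnerProductSpace ℂ E]
  [NormedAddCommGroup F] [InnerProductSpace ℂ F]

theorem posSemidef_gram_sub_iff (u : ι → E) (h : ι → F) :
    (Matrix.gram ℂ u - Matrix.gram ℂ h).PosSemidef ↔
      ∀ c : ι → ℂ, ‖∑ i, c i • h i‖ ≤ ‖∑ i, c i • u i‖ := by
  rw [Matrix.posSemidef_iff_dotProduct_mulVec, and_iff_right
    ((Matrix.isHermitian_gram ℂ u).sub (Matrix.isHermitian_gram ℂ h))]
  refine forall_congr' fun c => ?_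
  rw [Matrix.sub_mulVec, dotProduct_sub, Matrix.star_dotProduct_gram_mulVec,
    Matrix.star_dotProduct_gram_mulVec, sub_nonneg, inner_self_eq_norm_sq_to_K,
    inner_self_eq_norm_sq_to_K]
  simp only [Complex.coe_algebraMap, ← Complex.ofReal_pow, Complex.real_le_real]
  exact pow_le_pow_iff_left₀ (norm_nonneg _) (norm_nonneg _) two_ne_zero

theorem exists_eq_gram {M : Matrix ι ι ℂ} (hM : M.PosSemidef) :
    ∃ (m : ℕ) (v : ι → EuclideanSpace ℂ (Fin m)), M = Matrix.gram ℂ v := by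
  obtain ⟨m, v, rfl⟩ := Matrix.posSemidef_iff_eq_sum_vecMulVec.1 hM
  refine ⟨m, fun i => WithLp.toLp 2 fun j => conj (v j i), ?_⟩
  ext i j
  simp [Matrix.sum_apply, Matrix.vecMulVec_apply, PiLp.inner_apply, mul_comm]

theorem exists_linearIsometry_span (u : ι → E) (v : ι → F)
    (h : ∀ i j, inner ℂ (u i) (u j) = inner ℂ (v i) (v j)) :
    ∃ T : Submodule.span ℂ (Set.range u) →ₗᵢ[ℂ] F,
      ∀ i (hi : u i ∈ Submodule.span ℂ (Set.range u)), T ⟨u i, hi⟩ = v i := by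
  let Lu : (ι → ℂ) →ₗ[ℂ] E := Fintype.linearCombination ℂ u
  let Lv : (ι → ℂ) →ₗ[ℂ] F := Fintype.linearCombination ℂ v
  have hnorm : ∀ c, ‖Lv c‖ = ‖Lu c‖ := by
    intro c
    have h1 : inner ℂ (Lv c) (Lv c) = inner ℂ (Lu c) (Lu c) := by
      simp only [Lu, Lv, Fintype.linearCombination_apply, sum_inner, inner_sum, inner_smul_left,
        inner_smul_right, h]
    rw [inner_self_eq_norm_sq_to_K, inner_self_eq_norm_sq_to_K] at h1
    have h2 : ‖Lv c‖ ^ 2 = ‖Lu c‖ ^ 2 := Complex.ofReal_injective (by push_cast; exact h1)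
    exact (pow_left_inj₀ (norm_nonneg _) (norm_nonneg _) two_ne_zero).1 h2
  have hrange : LinearMap.range Lu = Submodule.span ℂ (Set.range u) :=
    Fintype.range_linearCombination ℂ u
  rw [← hrange]
  -- A linear choice of coefficients. Since `Lu` and `Lv` have equal norms on coefficients, they
  -- have the same kernel, and `Lv ∘ g` does not depend on the choice.
  obtain ⟨g, hg⟩ := Lu.rangeRestrict.exists_rightInverse_of_surjective
    (LinearMap.range_rangeRestrict _)
  have hg' : ∀ x, Lu (g x) = x := fun x => congrArg Subtype.val (LinearMap.congr_fun hg x)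
  refine ⟨⟨Lv ∘ₗ g, fun x => ?_⟩, fun i hi => ?_⟩
  · rw [LinearMap.comp_apply, hnorm, hg']
    rfl
  · change Lv (g ⟨u i, _⟩) = v i
    classical
    have h1 : Lu (Pi.single i 1) = u i := by simp [Lu]
    have h2 : Lv (Pi.single i 1) = v i := by simp [Lv]
    rw [← h2, ← sub_eq_zero, ← map_sub, ← norm_eq_zero, hnorm, map_sub, hg', h1]
    simp

theorem exists_contraction [FiniteDimensional ℂ E] (u : ι → E) (v : ι → F)
    (h : ∀ i j, inner ℂ (u i) (u j) = inner ℂ (v i) (v j)) :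
    ∃ V : E →ₗ[ℂ] F, (∀ x, ‖V x‖ ≤ ‖x‖) ∧ ∀ i, V (u i) = v i := by
  set S := Submodule.span ℂ (Set.range u) with hS
  obtain ⟨T, hT⟩ : ∃ T : S →ₗᵢ[ℂ] F, ∀ i (hi : u i ∈ S), T ⟨u i, hi⟩ = v i :=
    exists_linearIsometry_span u v h
  refine ⟨T.toLinearMap ∘ₗ S.orthogonalProjectionOnto.toLinearMap, fun x => ?_, fun i => ?_⟩
  · change ‖T (S.orthogonalProjectionOnto x)‖ ≤ ‖x‖
    rw [T.norm_map]
    exact S.norm_orthogonalProjectionOnto_apply_le x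
  · change T (S.orthogonalProjectionOnto (u i)) = v i
    rw [← hT i (Submodule.subset_span ⟨i, rfl⟩)]
    refine congrArg T ?_
    exact Submodule.orthogonalProjectionOnto_mem_subspace_eq_self
      (⟨u i, Submodule.subset_span ⟨i, rfl⟩⟩ : S)

theorem exists_unitary (u v : ι → Cn d)
    (h : ∀ i j, inner ℂ (u i) (u j) = inner ℂ (v i) (v j)) :
    ∃ V : Cn d ≃ₗᵢ[ℂ] Cn d, ∀ i, V (u i) = v i := by
  obtain ⟨T, hT⟩ := exists_linearIsometry_span u v h
  refine ⟨T.extend.toLinearIsometryEquiv rfl, fun i => ?_⟩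
  rw [← hT i (Submodule.subset_span ⟨i, rfl⟩)]
  exact LinearIsometry.extend_apply T ⟨u i, Submodule.subset_span ⟨i, rfl⟩⟩

end Gram

/-! ### The kernel functions of the Drury-Arveson space -/

theorem inner_kfun {X H : Type*} [NormedAddCommGroup H] [InnerProductSpace ℂ H] [CompleteSpace H]
    [RKHS ℂ H X ℂ] (x : X) (f : H) : inner ℂ (kfun H x) f = f x := by
  simp [kfun]

theorem inner_daFun {z w : Ball d} : inner ℂ (daFun z) (daFun w) = daKer z w := by
  rw [daFun, daFun, ← RKHS.kernel_inner, RKHS.OfKernel.kernel_ofKernel]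
  simp [daMatrix, conj_daKer]

/-- These sums are the Taylor coefficients at `0` of the vanishing function. They are extracted one
by one: subtract the value at `0`, divide by `ζ`, and recover the value at `ζ = 0` by continuity. -/
theorem sum_mul_pow_eq_zero {n : ℕ} {c β : Fin n → ℂ} (hβ : ∀ i, ‖β i‖ < 1)
    (h : ∀ ζ : ℂ, ‖ζ‖ < 1 → ∑ i, c i / (1 - ζ * β i) = 0) (m : ℕ) : ∑ i, c i * β i ^ m = 0 := by
  have hne : ∀ ζ : ℂ, ‖ζ‖ < 1 → ∀ i, 1 - ζ * β i ≠ 0 := by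
    intro ζ hζ i h0
    have h1 : ‖ζ * β i‖ = 1 := by rw [← sub_eq_zero.1 h0, norm_one]
    rw [norm_mul] at h1
    nlinarith [norm_nonneg ζ, norm_nonneg (β i), hβ i]
  have key : ∀ m : ℕ, ∀ ζ : ℂ, ‖ζ‖ < 1 → ∑ i, c i * β i ^ m / (1 - ζ * β i) = 0 := by
    intro m
    induction m with
    | zero => simpa using h
    | succ m ih =>
      have h0 : ∑ i, c i * β i ^ m = 0 := by simpa using ih 0 (by simp)
      have h1 : ∀ ζ : ℂ, ‖ζ‖ < 1 → ζ ≠ 0 →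
          ∑ i, c i * β i ^ (m + 1) / (1 - ζ * β i) = 0 := by
        intro ζ hζ hζ0
        have h2 : ζ * ∑ i, c i * β i ^ (m + 1) / (1 - ζ * β i) =
            ∑ i, c i * β i ^ m / (1 - ζ * β i) - ∑ i, c i * β i ^ m := by
          rw [Finset.mul_sum, ← Finset.sum_sub_distrib]
          refine Finset.sum_congr rfl fun i _ => ?_
          have := hne ζ hζ i
          field_simp
          ring
        rw [ih ζ hζ, h0, sub_zero] at h2
        exact (mul_eq_zero.1 h2).resolve_left hζ0
      intro ζ hζ
      by_cases hζ0 : ζ = 0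
      · subst hζ0
        have hcont : ContinuousAt (fun ζ : ℂ => ∑ i, c i * β i ^ (m + 1) / (1 - ζ * β i)) 0 := by
          refine tendsto_finsetSum _ fun i _ => ?_
          refine ContinuousAt.div (by fun_prop) (by fun_prop) (by simp)
        have h3 : Filter.Tendsto (fun ζ : ℂ => ∑ i, c i * β i ^ (m + 1) / (1 - ζ * β i)) (𝓝[≠] 0)
            (𝓝 0) := by
          refine tendsto_const_nhds.congr' ?_
          filter_upwards [self_mem_nhdsWithin,
            nhdsWithin_le_nhds (Metric.ball_mem_nhds (0 : ℂ) one_pos)] with ζ hζ hζ'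
          exact (h1 ζ (by simpa using hζ') hζ).symm
        exact tendsto_nhds_unique (hcont.tendsto.mono_left nhdsWithin_le_nhds) h3
      · exact h1 ζ hζ hζ0
  simpa using key m 0 (by simp)

/-- Restricting a relation to a disc `ζ • u` whose direction `u` separates the points makes the
power sums vanish, and the Vandermonde determinant finishes. -/
theorem linearIndependent_daFun {n : ℕ} {z : Fin n → Ball d} (hz : Function.Injective z) :
    LinearIndependent ℂ fun i => daFun (z i) := by
  rw [Fintype.linearIndependent_iff]
  intro c hc
  -- A linear functional that vanishes on none of the finitely many differences of the points.
  obtain ⟨f, hf⟩ := Module.exists_dual_forall_apply_ne_zero (K := ℂ)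
    (fun q : {q : Fin n × Fin n // q.1 ≠ q.2} => (z q.1.1 : Cn d) - z q.1.2)
    fun q h => q.2 (hz (Subtype.ext (sub_eq_zero.1 h)))
  set u₀ : Cn d := (InnerProductSpace.toDual ℂ (Cn d)).symm (LinearMap.toContinuousLinearMap f)
  have hu₀ : ∀ w, inner ℂ u₀ w = f w := fun w => by
    simp [u₀, InnerProductSpace.toDual_symm_apply]
  set u : Cn d := ((1 + ‖u₀‖ : ℝ) : ℂ)⁻¹ • u₀ with hu
  have hpos : (0 : ℝ) < 1 + ‖u₀‖ := by positivity
  have hu1 : ‖u‖ < 1 := by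
    rw [hu, norm_smul, norm_inv, Complex.norm_real, Real.norm_of_nonneg hpos.le,
      inv_mul_lt_iff₀ hpos]
    linarith
  have hinj : Function.Injective fun i => inner ℂ (z i : Cn d) u := by
    intro i j hij
    by_contra hne
    refine hf ⟨(i, j), hne⟩ ?_
    have h1 : inner ℂ u ((z i : Cn d) - z j) = 0 := by
      rw [inner_sub_right, sub_eq_zero, ← inner_conj_symm, ← inner_conj_symm u (z j : Cn d)]
      exact congrArg conj hij
    rw [hu, inner_smul_left, hu₀] at h1
    refine (mul_eq_zero.1 h1).resolve_left ?_
    rw [← ne_eq, map_ne_zero]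
    exact inv_ne_zero (Complex.ofReal_ne_zero.2 hpos.ne')
  have hsum : ∀ ζ : ℂ, ‖ζ‖ < 1 → ∑ i, c i / (1 - ζ * inner ℂ (z i : Cn d) u) = 0 := by
    intro ζ hζ
    have hmem : ζ • u ∈ Ball d := by
      rw [mem_Ball_iff, norm_smul]
      nlinarith [norm_nonneg ζ, norm_nonneg u]
    have h1 : inner ℂ (daFun (⟨_, hmem⟩ : Ball d)) (∑ i, c i • daFun (z i)) = 0 := by
      rw [hc, inner_zero_right]
    rw [inner_sum] at h1
    rw [← h1]
    refine Finset.sum_congr rfl fun i _ => ?_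
    rw [inner_smul_right (daFun _), inner_daFun, daKer, inner_smul_right _ u, mul_one_div]
  have hβ : ∀ i, ‖inner ℂ (z i : Cn d) u‖ < 1 := by
    intro i
    refine (norm_inner_le_norm _ _).trans_lt ?_
    nlinarith [norm_nonneg (z i : Cn d), norm_nonneg u, ball_norm_lt (z i)]
  have h := Matrix.eq_zero_of_forall_pow_sum_mul_pow_eq_zero hinj
    fun m => sum_mul_pow_eq_zero hβ hsum m
  exact fun i => congrFun h i

end
end PickSpace

/-! ### Contractive multipliers, Pick matrices and interpolation on finite sets. -/

namespace PickSpace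
noncomputable section
open scoped Manifold ContDiff Topology ComplexConjugate ComplexOrder
open InnerProductSpace

variable {d : ℕ}

/-! ### Multipliers and Pick matrices -/

section Multiplier

variable {X H : Type*} [NormedAddCommGroup H] [InnerProductSpace ℂ H] [CompleteSpace H]
  [RKHS ℂ H X ℂ] {p q : ℕ}

/-- The kernel function `k_x ⊗ e_a` of `H ⊗ ℂ^p`. -/
def pickVec (H : Type*) [NormedAddCommGroup H] [InnerProductSpace ℂ H] [CompleteSpace H]
    [RKHS ℂ H X ℂ] {p : ℕ} (x : X) (a : Fin p) : PiLp 2 fun _ : Fin p => H :=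
  WithLp.toLp 2 (Pi.single a (kfun H x))

/-- The vector `k_x ⊗ A^* e_a` of `H ⊗ ℂ^q`. -/
def pickAdj (H : Type*) [NormedAddCommGroup H] [InnerProductSpace ℂ H] [CompleteSpace H]
    [RKHS ℂ H X ℂ] {p q : ℕ} (x : X) (A : Matrix (Fin p) (Fin q) ℂ) (a : Fin p) :
    PiLp 2 fun _ : Fin q => H :=
  WithLp.toLp 2 fun j => conj (A a j) • kfun H x

theorem inner_pickVec (x : X) (a : Fin p) (g : PiLp 2 fun _ : Fin p => H) :
    inner ℂ (pickVec H x a) g = g a x := by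
  rw [pickVec, PiLp.inner_apply, Finset.sum_eq_single a]
  · simp [inner_kfun]
  · intro b _ hb
    simp [Pi.single_eq_of_ne hb]
  · simp

theorem inner_pickAdj (x : X) (A : Matrix (Fin p) (Fin q) ℂ) (a : Fin p)
    (f : PiLp 2 fun _ : Fin q => H) : inner ℂ (pickAdj H x A a) f = ∑ j, A a j * f j x := by
  rw [pickAdj, PiLp.inner_apply]
  refine Finset.sum_congr rfl fun j _ => ?_
  simp [inner_smul_left, inner_kfun]

/-- The adjoint of multiplication by `F` sends `k_x ⊗ e_a` to `k_x ⊗ F(x)^* e_a`. Written as a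
difference of Gram matrices, positivity of the Pick matrix says that this adjoint is contractive. -/
theorem pickMatrix_eq {m : ℕ} (x : Fin m → X) (W : Fin m → Matrix (Fin p) (Fin q) ℂ) :
    (Matrix.of fun a b : Fin m × Fin p =>
        (1 - W a.1 * (W b.1).conjTranspose : Matrix (Fin p) (Fin p) ℂ) a.2 b.2 *
          kfun H (x b.1) (x a.1)) =
      Matrix.gram ℂ (fun a : Fin m × Fin p => pickVec H (x a.1) a.2) -
        Matrix.gram ℂ fun a : Fin m × Fin p => pickAdj H (x a.1) (W a.1) a.2 := by
  ext a b
  rw [Matrix.of_apply, Matrix.sub_apply, Matrix.sub_apply, Matrix.gram_apply, Matrix.gram_apply,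
    inner_pickVec, inner_pickAdj, sub_mul]
  congr 1
  · by_cases h : a.2 = b.2
    · rw [Matrix.one_apply, if_pos h]
      simp [pickVec, h]
    · simp [pickVec, h]
  · rw [Matrix.mul_apply, Finset.sum_mul]
    refine Finset.sum_congr rfl fun j _ => ?_
    simp [pickAdj, mul_assoc]

/-- The Pick matrix of a contractive multiplier is positive. -/
theorem IsContractiveMultiplier.posSemidef {F : X → Matrix (Fin p) (Fin q) ℂ}
    (hF : IsContractiveMultiplier H F) {m : ℕ} (x : Fin m → X) :
    (Matrix.of fun a b : Fin m × Fin p =>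
        (1 - F (x a.1) * (F (x b.1)).conjTranspose : Matrix (Fin p) (Fin p) ℂ) a.2 b.2 *
          kfun H (x b.1) (x a.1)).PosSemidef := by
  rw [pickMatrix_eq x fun i => F (x i), posSemidef_gram_sub_iff]
  intro c
  obtain ⟨g, hg, hgf⟩ := hF (∑ a : Fin m × Fin p, c a • pickAdj H (x a.1) (F (x a.1)) a.2)
  set f := ∑ a : Fin m × Fin p, c a • pickAdj H (x a.1) (F (x a.1)) a.2
  -- Here `f` is the adjoint applied to the combination of the `pickVec` and `g = F f`, so
  -- Cauchy-Schwarz with `‖g‖ ≤ ‖f‖` bounds `‖f‖`.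
  have h1 : inner ℂ (∑ a : Fin m × Fin p, c a • pickVec H (x a.1) a.2) g = inner ℂ f f := by
    conv_rhs => enter [2]; rw [show f = ∑ a : Fin m × Fin p, c a •
      pickAdj H (x a.1) (F (x a.1)) a.2 from rfl]
    rw [sum_inner, sum_inner]
    refine Finset.sum_congr rfl fun a _ => ?_
    rw [inner_smul_left, inner_smul_left, inner_pickVec, inner_pickAdj, hg]
  have h2 := norm_inner_le_norm (𝕜 := ℂ) (∑ a : Fin m × Fin p, c a • pickVec H (x a.1) a.2) g
  rw [h1, inner_self_eq_norm_sq_to_K, norm_pow, RCLike.norm_ofReal, abs_norm] at h2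
  rcases (norm_nonneg f).eq_or_lt with h0 | h0
  · rw [← h0]
    exact norm_nonneg _
  · have h3 := h2.trans (mul_le_mul_of_nonneg_left hgf (norm_nonneg _))
    nlinarith

end Multiplier

theorem span_pickVec {n p : ℕ} {H : Type*} [NormedAddCommGroup H] [InnerProductSpace ℂ H]
    [CompleteSpace H] [RKHS ℂ H (Fin n) ℂ] (hspan : Submodule.span ℂ (Set.range (kfun H)) = ⊤)
    (g : PiLp 2 fun _ : Fin p => H) :
    ∃ c : Fin n × Fin p → ℂ, g = ∑ a, c a • pickVec H a.1 a.2 := by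
  have h1 : ∀ v : H, ∃ c : Fin n → ℂ, ∑ i, c i • kfun H i = v := fun v =>
    (Submodule.mem_span_range_iff_exists_fun ℂ).1 (hspan ▸ Submodule.mem_top)
  choose c hc using h1
  refine ⟨fun a => c (g a.2) a.1, ?_⟩
  ext b : 1
  rw [Fintype.sum_prod_type]
  simp only [WithLp.ofLp_sum, WithLp.ofLp_smul, Finset.sum_apply, pickVec, Pi.smul_apply]
  conv_lhs => rw [← hc (g b)]
  refine Finset.sum_congr rfl fun i _ => ?_
  rw [Finset.sum_eq_single b]
  · rw [Pi.single_eq_same]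
  · intro a _ hab
    rw [Pi.single_eq_of_ne hab.symm, smul_zero]
  · simp

/-- A function on a finite set whose Pick matrix is positive is a contractive multiplier. -/
theorem isContractiveMultiplier_of_posSemidef {n p q : ℕ} {H : Type*} [NormedAddCommGroup H]
    [InnerProductSpace ℂ H] [CompleteSpace H] [RKHS ℂ H (Fin n) ℂ]
    (hli : LinearIndependent ℂ (kfun H)) (hfin : Module.finrank ℂ H = n)
    {F : Fin n → Matrix (Fin p) (Fin q) ℂ}
    (hF : (Matrix.of fun a b : Fin n × Fin p =>
        (1 - F a.1 * (F b.1).conjTranspose : Matrix (Fin p) (Fin p) ℂ) a.2 b.2 *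
          kfun H b.1 a.1).PosSemidef) : IsContractiveMultiplier H F := by
  have hfd : FiniteDimensional ℂ H := by
    -- A `finrank` of zero does not exclude infinite dimension; over the empty set the space
    -- vanishes because its elements are functions.
    rcases Nat.eq_zero_or_pos n with rfl | hn
    · have h0 : Subsingleton H := ⟨fun f g => RKHS.ext fun x => x.elim0⟩
      infer_instance
    · exact FiniteDimensional.of_finrank_pos (hfin ▸ hn)
  have hspan : Submodule.span ℂ (Set.range (kfun H)) = ⊤ :=
    hli.span_eq_top_of_card_eq_finrank' (by rw [hfin, Fintype.card_fin])
  -- By dimension every function on the points belongs to `H`, so the product `F f` exists and only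
  -- its norm is in question.
  have hsurj : Function.Surjective fun f : H => (f : Fin n → ℂ) :=
    ((LinearMap.injective_iff_surjective_of_finrank_eq_finrank
      (f := (RKHS.coeCLM ℂ : H →L[ℂ] Fin n → ℂ).toLinearMap) (by simp [hfin])).1
        RKHS.coeCLM_injective)
  have hmat := pickMatrix_eq (H := H) (id : Fin n → Fin n) F
  simp only [id] at hmat
  rw [hmat, posSemidef_gram_sub_iff] at hF
  intro f
  choose G hG using fun i : Fin p => hsurj fun x => ∑ j, F x i j * f j x
  refine ⟨WithLp.toLp 2 G, fun x i => congrFun (hG i) x, ?_⟩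
  set g : PiLp 2 fun _ : Fin p => H := WithLp.toLp 2 G with hg
  obtain ⟨c, hc⟩ := span_pickVec hspan g
  have h1 : inner ℂ g g = inner ℂ (∑ a : Fin n × Fin p, c a • pickAdj H a.1 (F a.1) a.2) f := by
    conv_lhs => enter [2]; rw [hc]
    rw [sum_inner, sum_inner]
    refine Finset.sum_congr rfl fun a _ => ?_
    rw [inner_smul_left, inner_smul_left, inner_pickVec, inner_pickAdj]
    exact congrArg _ (congrFun (hG a.2) a.1)
  have h2 := norm_inner_le_norm (𝕜 := ℂ) (∑ a : Fin n × Fin p, c a • pickAdj H a.1 (F a.1) a.2) f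
  rw [← h1, inner_self_eq_norm_sq_to_K, norm_pow, RCLike.norm_ofReal, abs_norm] at h2
  have h3 := hF c
  rw [← hc] at h3
  rcases (norm_nonneg g).eq_or_lt with h0 | h0
  · rw [← h0]
    exact norm_nonneg _
  · have h4 := h2.trans (mul_le_mul_of_nonneg_right h3 (norm_nonneg _))
    nlinarith

/-! ### The complete Pick property of the Drury-Arveson kernel -/

section Lurking

variable {E : Type*} [NormedAddCommGroup E] [InnerProductSpace ℂ E]

/-- The vector `conj z ⊗ g`. -/
def conjTens (z : Cn d) (g : E) : PiLp 2 fun _ : Fin d => E := WithLp.toLp 2 fun l => conj (z l) • g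

theorem inner_conjTens (z w : Cn d) (g h : E) :
    inner ℂ (conjTens z g) (conjTens w h) = inner ℂ w z * inner ℂ g h := by
  simp only [conjTens, PiLp.inner_apply, inner_smul_left, inner_smul_right, Finset.sum_mul]
  refine Finset.sum_congr rfl fun l _ => ?_
  simp
  ring

theorem norm_conjTens (z : Cn d) (g : E) : ‖conjTens z g‖ = ‖z‖ * ‖g‖ := by
  have h := inner_conjTens z z g g
  simp only [inner_self_eq_norm_sq_to_K] at h
  have h2 : ‖conjTens z g‖ ^ 2 = (‖z‖ * ‖g‖) ^ 2 :=
    Complex.ofReal_injective (by push_cast; rw [mul_pow]; exact h)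
  exact (pow_left_inj₀ (norm_nonneg _) (by positivity) two_ne_zero).1 h2

theorem conjTens_add (z : Cn d) (g h : E) : conjTens z (g + h) = conjTens z g + conjTens z h := by
  ext l
  simp [conjTens]

theorem conjTens_smul (z : Cn d) (c : ℂ) (g : E) : conjTens z (c • g) = c • conjTens z g := by
  ext l
  simp [conjTens, smul_smul, mul_comm]

variable {p q : ℕ} [FiniteDimensional ℂ E]
  {V : WithLp 2 (EuclideanSpace ℂ (Fin p) × PiLp 2 fun _ : Fin d => E) →ₗ[ℂ]
    WithLp 2 (EuclideanSpace ℂ (Fin q) × E)}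

/-- The state equation of the transfer function of `V`. Its linear part is injective because `V` is
a contraction and `‖z‖ < 1`, hence bijective in finite dimension. -/
theorem existsUnique_colligation (hV : ∀ x, ‖V x‖ ≤ ‖x‖) (z : Ball d)
    (e : EuclideanSpace ℂ (Fin p)) :
    ∃! g : E, (V (WithLp.toLp 2 (e, conjTens (z : Cn d) g))).snd = g := by
  let T : E →ₗ[ℂ] E :=
    { toFun := fun g => g - (V (WithLp.toLp 2 (0, conjTens (z : Cn d) g))).snd
      map_add' := fun g h => by
        have : WithLp.toLp 2 ((0 : EuclideanSpace ℂ (Fin p)), conjTens (z : Cn d) (g + h)) =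
            WithLp.toLp 2 (0, conjTens (z : Cn d) g) + WithLp.toLp 2 (0, conjTens (z : Cn d) h) := by
          rw [← WithLp.toLp_add, Prod.mk_add_mk, add_zero, conjTens_add]
        rw [this, map_add, WithLp.add_snd]
        abel
      map_smul' := fun c g => by
        have : WithLp.toLp 2 ((0 : EuclideanSpace ℂ (Fin p)), conjTens (z : Cn d) (c • g)) =
            c • WithLp.toLp 2 (0, conjTens (z : Cn d) g) := by
          rw [← WithLp.toLp_smul, Prod.smul_mk, smul_zero, conjTens_smul]
        rw [this, map_smul, WithLp.smul_snd, RingHom.id_apply, smul_sub] }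
  have hTdef : ∀ g, T g = g - (V (WithLp.toLp 2 (0, conjTens (z : Cn d) g))).snd := fun _ => rfl
  have hT : Function.Injective T := by
    rw [injective_iff_map_eq_zero]
    intro g hg
    rw [hTdef, sub_eq_zero] at hg
    have h1 : ‖g‖ ≤ ‖(z : Cn d)‖ * ‖g‖ := by
      conv_lhs => rw [hg]
      refine (WithLp.norm_snd_le _ _).trans ((hV _).trans ?_)
      rw [WithLp.prod_norm_eq_of_L2]
      change √(‖(0 : EuclideanSpace ℂ (Fin p))‖ ^ 2 + ‖conjTens (z : Cn d) g‖ ^ 2) ≤ _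
      rw [norm_zero, norm_conjTens, zero_pow two_ne_zero, zero_add, Real.sqrt_sq (by positivity)]
    by_contra hne
    have h2 := norm_pos_iff.2 hne
    nlinarith [ball_norm_lt z]
  have hiff : ∀ g, (V (WithLp.toLp 2 (e, conjTens (z : Cn d) g))).snd = g ↔
      T g = (V (WithLp.toLp 2 (e, 0))).snd := by
    intro g
    have : WithLp.toLp 2 (e, conjTens (z : Cn d) g) =
        WithLp.toLp 2 (e, 0) + WithLp.toLp 2 (0, conjTens (z : Cn d) g) := by
      rw [← WithLp.toLp_add, Prod.mk_add_mk, add_zero, zero_add]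
    rw [this, map_add, WithLp.add_snd, hTdef, sub_eq_iff_eq_add, eq_comm]
  simp only [hiff]
  exact (Function.bijective_iff_existsUnique T).1 ⟨hT, LinearMap.injective_iff_surjective.1 hT⟩ _

end Lurking

/-- Interpolation on finitely many points of the ball: a lurking isometry argument. -/
theorem exists_interpolation {N m p q : ℕ} (y : Fin N → Ball d) (x : Fin m → Fin N)
    (W : Fin m → Matrix (Fin p) (Fin q) ℂ)
    (hW : (Matrix.of fun a b : Fin m × Fin p =>
        (1 - W a.1 * (W b.1).conjTranspose : Matrix (Fin p) (Fin p) ℂ) a.2 b.2 *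
          daKer (y (x a.1)) (y (x b.1))).PosSemidef) :
    ∃ F : Fin N → Matrix (Fin p) (Fin q) ℂ, (∀ i, F (x i) = W i) ∧
      (Matrix.of fun a b : Fin N × Fin p =>
        (1 - F a.1 * (F b.1).conjTranspose : Matrix (Fin p) (Fin p) ℂ) a.2 b.2 *
          daKer (y a.1) (y b.1)).PosSemidef := by
  obtain ⟨r, γ, hγ⟩ := exists_eq_gram hW
  have hk : ∀ z w : Ball d, (1 - inner ℂ (w : Cn d) (z : Cn d)) * daKer z w = 1 := fun z w =>
    mul_one_div_cancel (one_sub_inner_ne_zero (ball_norm_lt w) (ball_norm_lt z))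
  have hγ' : ∀ a b : Fin m × Fin p,
      (1 - W a.1 * (W b.1).conjTranspose : Matrix (Fin p) (Fin p) ℂ) a.2 b.2 =
      (1 - inner ℂ (y (x b.1) : Cn d) (y (x a.1) : Cn d)) * inner ℂ (γ a) (γ b) := by
    intro a b
    have h1 := congrFun (congrFun hγ a) b
    rw [Matrix.of_apply, Matrix.gram_apply] at h1
    rw [← h1, mul_left_comm, hk, mul_one]
  have hmul : ∀ (A B : Matrix (Fin p) (Fin q) ℂ) (a b : Fin p), (A * B.conjTranspose) a b =
      inner ℂ (WithLp.toLp 2 fun j => conj (A a j) : EuclideanSpace ℂ (Fin q))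
        (WithLp.toLp 2 fun j => conj (B b j)) := by
    intro A B a b
    simp [Matrix.mul_apply, PiLp.inner_apply, mul_comm]
  have hone : ∀ a b : Fin p, (1 : Matrix (Fin p) (Fin p) ℂ) a b =
      inner ℂ (EuclideanSpace.single a (1 : ℂ)) (EuclideanSpace.single b (1 : ℂ)) := by
    intro a b
    rw [EuclideanSpace.inner_single_left]
    simp [Matrix.one_apply]
  -- Factoring the Pick matrix through `γ` and clearing the denominator of the kernel turns the
  -- hypothesis into an equality of Gram matrices of the vectors `(e_a, conj z ⊗ γ)` and `(W^* e_a,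
  -- γ)`. The lurking isometry between them is extended by zero.
  obtain ⟨V, hV, hVγ⟩ := exists_contraction
    (fun a : Fin m × Fin p => (WithLp.toLp 2 (EuclideanSpace.single a.2 (1 : ℂ),
      conjTens (y (x a.1) : Cn d) (γ a)) :
        WithLp 2 (EuclideanSpace ℂ (Fin p) × PiLp 2 fun _ : Fin d => EuclideanSpace ℂ (Fin r))))
    (fun a : Fin m × Fin p => (WithLp.toLp 2 (WithLp.toLp 2 fun j => conj (W a.1 a.2 j), γ a) :
        WithLp 2 (EuclideanSpace ℂ (Fin q) × EuclideanSpace ℂ (Fin r)))) (by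
      intro a b
      rw [WithLp.prod_inner_apply, WithLp.prod_inner_apply]
      have h1 := hγ' a b
      rw [Matrix.sub_apply, hone, hmul] at h1
      simp only [inner_conjTens]
      linear_combination h1)
  -- The state equation is solved at all points `y`; the first component of the output of `V`
  -- defines `F^*`.
  have hex := fun a : Fin N × Fin p =>
    existsUnique_colligation hV (y a.1) (EuclideanSpace.single a.2 (1 : ℂ))
  choose g hg hguniq using hex
  simp only at hg hguniq
  set L : Fin N × Fin p → WithLp 2 (EuclideanSpace ℂ (Fin p) × PiLp 2 fun _ : Fin d =>
    EuclideanSpace ℂ (Fin r)) := fun a => WithLp.toLp 2 (EuclideanSpace.single a.2 (1 : ℂ),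
      conjTens (y a.1 : Cn d) (g a)) with hL
  refine ⟨fun k => Matrix.of fun a j => conj ((V (L (k, a))).fst j), fun i => ?_, ?_⟩
  · ext a j
    -- At the interpolation nodes `γ` already solves the state equation, so uniqueness gives `F (x
    -- i) = W i`.
    have h1 : γ (i, a) = g (x i, a) := by
      refine hguniq (x i, a) _ ?_
      rw [hVγ (i, a)]
      rfl
    have h2 : V (L (x i, a)) = WithLp.toLp 2 (WithLp.toLp 2 fun j => conj (W i a j), γ (i, a)) := by
      rw [hL]
      simp only
      rw [← h1]
      exact hVγ (i, a)
    change conj ((V (L (x i, a))).fst j) = W i a j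
    rw [h2]
    simp
  -- The defect `Δ` of the contraction equals `(1 - F F^*) - ⟨g, g⟩ / k`, so the Pick matrix is the
  -- entrywise product of `Δ` with the kernel plus the Gram matrix of `g`.
  · have hΔ : (Matrix.gram ℂ L - Matrix.gram ℂ fun a => V (L a)).PosSemidef := by
      rw [posSemidef_gram_sub_iff]
      intro c
      simp only [← map_smul, ← map_sum]
      exact hV _
    have hK := Matrix.posSemidef_gram ℂ fun a : Fin N × Fin p => daFun (y a.1)
    have h := (hΔ.hadamard hK).add (Matrix.posSemidef_gram ℂ g)
    refine (congrArg Matrix.PosSemidef ?_).mpr h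
    ext a b
    rw [Matrix.of_apply, Matrix.add_apply, Matrix.hadamard_apply, Matrix.sub_apply,
      Matrix.sub_apply, Matrix.gram_apply, Matrix.gram_apply, Matrix.gram_apply, Matrix.gram_apply,
      inner_daFun, hone, hmul, WithLp.prod_inner_apply, WithLp.prod_inner_apply]
    have h3 : ∀ a, (V (L a)).ofLp.2 = g a := hg
    have h4 : ∀ a : Fin N × Fin p, (WithLp.toLp 2 fun j => conj ((Matrix.of fun (a' : Fin p) j =>
        conj ((V (L (a.1, a'))).fst j)) a.2 j) : EuclideanSpace ℂ (Fin q)) = (V (L a)).ofLp.1 := by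
      intro a
      ext j
      simp
    rw [h3, h3, h4, h4, hL]
    simp only [inner_conjTens]
    linear_combination (inner ℂ (g a) (g b)) * hk (y a.1) (y b.1)

end
end PickSpace

/-! ### Complete Pick spaces are exactly the spans over configurations, unique up to automorphisms
and reorderings. -/

namespace PickSpace
noncomputable section
open scoped Manifold ContDiff Topology ComplexConjugate ComplexOrder
open InnerProductSpace

variable {d : ℕ}

/-! ### Kernel functions of finite-dimensional spaces -/

section FiniteKernel

variable {n : ℕ} {H : Type*} [NormedAddCommGroup H] [InnerProductSpace ℂ H]
  [RKHS ℂ H (Fin n) ℂ]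

theorem finiteDimensional_of_finrank (hfin : Module.finrank ℂ H = n) : FiniteDimensional ℂ H := by
  rcases Nat.eq_zero_or_pos n with rfl | hn
  · have h0 : Subsingleton H := ⟨fun f g => RKHS.ext fun x => x.elim0⟩
    infer_instance
  · exact FiniteDimensional.of_finrank_pos (hfin ▸ hn)

variable [CompleteSpace H]

theorem span_kfun (hfin : Module.finrank ℂ H = n) :
    Submodule.span ℂ (Set.range (kfun H)) = ⊤ := by
  have := finiteDimensional_of_finrank hfin
  rw [← Submodule.orthogonal_eq_bot_iff, eq_bot_iff]
  intro f hf
  rw [Submodule.mem_orthogonal] at hf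
  refine (Submodule.mem_bot ℂ).2 (RKHS.ext fun i => ?_)
  rw [← inner_kfun, hf _ (Submodule.subset_span ⟨i, rfl⟩)]
  simp

theorem linearIndependent_kfun (hfin : Module.finrank ℂ H = n) : LinearIndependent ℂ (kfun H) := by
  rw [linearIndependent_iff_card_eq_finrank_span, Set.finrank, span_kfun hfin, finrank_top, hfin,
    Fintype.card_fin]

end FiniteKernel

theorem CPSpace.finiteDimensional {n : ℕ} (S : CPSpace n) : FiniteDimensional ℂ S.H :=
  finiteDimensional_of_finrank S.finrank_eq

theorem CPSpace.linearIndependent_kfun {n : ℕ} (S : CPSpace n) :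
    LinearIndependent ℂ (kfun S.H) := PickSpace.linearIndependent_kfun S.finrank_eq

/-- The Gram matrix of the kernel functions. -/
def CPSpace.gram {n : ℕ} (S : CPSpace n) : Matrix (Fin n) (Fin n) ℂ := Matrix.gram ℂ (kfun S.H)

theorem CPSpace.gram_apply {n : ℕ} (S : CPSpace n) (i j : Fin n) :
    S.gram i j = ⟪kfun S.H i, kfun S.H j⟫_ℂ := rfl

theorem CPSpace.gram_ne_zero {n : ℕ} (S : CPSpace n) (i j : Fin n) : S.gram i j ≠ 0 := by
  by_cases h : i = j
  · subst h
    exact inner_self_ne_zero.2 (S.linearIndependent_kfun.ne_zero i)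
  · exact (S.irreducible i j h).2

theorem CPSpace.conj_gram {n : ℕ} (S : CPSpace n) (i j : Fin n) :
    conj (S.gram i j) = S.gram j i := inner_conj_symm _ _

/-- Two complete Pick spaces are equivalent exactly when their Gram matrices agree up to a
permutation and a rescaling. -/
theorem CPSpace.equiv_iff {n : ℕ} (S S' : CPSpace n) : S ≈ S' ↔
    ∃ (φ : Equiv.Perm (Fin n)) (f : Fin n → ℂ), (∀ i, f i ≠ 0) ∧
      ∀ i j, S.gram i j = conj (f i) * f j * S'.gram (φ i) (φ j) := by
  have hfd := S.finiteDimensional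
  have hfd' := S'.finiteDimensional
  constructor
  · rintro ⟨T, ⟨φ, f, hf, h⟩, hT⟩
    refine ⟨φ, f, hf, fun i j => ?_⟩
    let T' : S.H →ₗᵢ[ℂ] S'.H := ⟨T.toLinearEquiv.toLinearMap, hT⟩
    have h1 : ⟪T (kfun S.H i), T (kfun S.H j)⟫_ℂ = S.gram i j :=
      T'.inner_map_map (kfun S.H i) (kfun S.H j)
    rw [← h1, h, h, inner_smul_left, inner_smul_right, S'.gram_apply, mul_assoc]
  · rintro ⟨φ, f, hf, h⟩
    obtain ⟨T, hT⟩ := exists_linearIsometry_span (kfun S.H) (fun i => f i • kfun S'.H (φ i))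
      fun i j => by
        rw [inner_smul_left, inner_smul_right, ← mul_assoc]
        exact h i j
    let T' : S.H →ₗᵢ[ℂ] S'.H :=
      T.comp (LinearIsometryEquiv.ofTop S.H _ (span_kfun S.finrank_eq)).symm.toLinearIsometry
    have hT' : ∀ i, T' (kfun S.H i) = f i • kfun S'.H (φ i) := fun i =>
      hT i (Submodule.subset_span ⟨i, rfl⟩)
    let e := T'.toLinearIsometryEquiv (by rw [S.finrank_eq, S'.finrank_eq])
    exact ⟨e.toContinuousLinearEquiv, ⟨φ, f, hf, hT'⟩, e.norm_map⟩

/-! ### The complete Pick space of a configuration -/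

section Span

variable {n : ℕ} (y : Conf d n)

/-- The span of the kernel functions at the points of an ordered configuration. -/
abbrev confSpan (y : Conf d n) : Submodule ℂ (DA d) :=
  Submodule.span ℂ (Set.range fun i => daFun (confPt y i))

/-- The kernel functions at the points of a configuration as elements of their span. -/
def spanFun (y : Conf d n) (i : Fin n) : confSpan y :=
  ⟨daFun (confPt y i), Submodule.subset_span ⟨i, rfl⟩⟩

instance : FiniteDimensional ℂ (confSpan y) := FiniteDimensional.span_of_finite ℂ (Set.finite_range _)

instance : CompleteSpace (confSpan y) := FiniteDimensional.complete ℂ _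

theorem confPt_injective : Function.Injective (confPt y) := fun _ _ h =>
  y.2.2 (congrArg Subtype.val h)

instance : RKHS ℂ (confSpan y) (Fin n) ℂ where
  coeCLM := ContinuousLinearMap.pi fun i => innerSL ℂ (spanFun y i)
  coeCLM_injective := by
    intro f g hfg
    have h1 : ∀ i, inner ℂ (daFun (confPt y i)) ((f : DA d) - g) = 0 := fun i => by
      rw [inner_sub_right, sub_eq_zero]
      exact congrFun hfg i
    have h2 : (f : DA d) - g ∈ (confSpan y)ᗮ := by
      rw [Submodule.mem_orthogonal]
      intro u hu
      induction hu using Submodule.span_induction with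
      | mem u hu =>
        obtain ⟨i, rfl⟩ := hu
        exact h1 i
      | zero => exact inner_zero_left _
      | add u v _ _ hu hv => rw [inner_add_left, hu, hv, add_zero]
      | smul c u _ hu => rw [inner_smul_left, hu, mul_zero]
    have h3 : (f : DA d) - g ∈ confSpan y ⊓ (confSpan y)ᗮ := ⟨sub_mem f.2 g.2, h2⟩
    rw [Submodule.inf_orthogonal_eq_bot, Submodule.mem_bot, sub_eq_zero] at h3
    exact Subtype.ext h3

theorem kfun_confSpan (i : Fin n) : kfun (confSpan y) i = spanFun y i := by
  refine ext_inner_right ℂ fun f => ?_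
  rw [inner_kfun]
  rfl

theorem inner_spanFun (i j : Fin n) :
    inner ℂ (spanFun y i) (spanFun y j) = daKer (confPt y i) (confPt y j) := inner_daFun

theorem finrank_confSpan : Module.finrank ℂ (confSpan y) = n :=
  (finrank_span_eq_card (linearIndependent_daFun (confPt_injective y))).trans (Fintype.card_fin n)

theorem isIrreducible_confSpan : IsIrreducible (confSpan y) := by
  intro i j hij
  refine ⟨?_, ?_⟩
  · have h := (linearIndependent_kfun (finrank_confSpan y)).comp ![i, j] (by
      intro a b hab
      fin_cases a <;> fin_cases b <;> simp_all)
    convert h using 1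
    ext a : 1
    fin_cases a <;> rfl
  · rw [kfun_confSpan, kfun_confSpan, inner_spanFun]
    exact daKer_ne_zero _ _

theorem kfun_confSpan_apply (i j : Fin n) :
    kfun (confSpan y) j i = daKer (confPt y i) (confPt y j) := by
  rw [← inner_kfun, kfun_confSpan, kfun_confSpan, inner_spanFun]

/-- Necessity of positivity holds in any reproducing kernel space; sufficiency is the interpolation
theorem on the finite set of points. -/
theorem isCompletePick_confSpan : IsCompletePick (confSpan y) := by
  intro p q m x W hx
  constructor
  · rintro ⟨F, hF, hFW⟩
    simpa only [hFW] using hF.posSemidef x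
  · intro h
    simp only [kfun_confSpan_apply] at h
    obtain ⟨F, hFW, hF⟩ := exists_interpolation (confPt y) x W h
    refine ⟨F, ?_, hFW⟩
    refine isContractiveMultiplier_of_posSemidef (linearIndependent_kfun (finrank_confSpan y))
      (finrank_confSpan y) ?_
    simpa only [kfun_confSpan_apply] using hF

/-- The span of the kernel functions at the points of a configuration as a complete Pick space. -/
def spanSpace : CPSpace n where
  H := confSpan y
  finrank_eq := finrank_confSpan y
  irreducible := isIrreducible_confSpan y
  completePick := isCompletePick_confSpan y

theorem spanSpace_gram (i j : Fin n) :
    (spanSpace y).gram i j = daKer (confPt y i) (confPt y j) := by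
  rw [CPSpace.gram_apply]
  change inner ℂ (kfun (confSpan y) i) (kfun (confSpan y) j) = _
  rw [kfun_confSpan, kfun_confSpan, inner_spanFun]

theorem isSpanOf_spanSpace : IsSpanOf (spanSpace y) y :=
  ⟨(confSpan y).subtypeₗᵢ, fun i => congrArg Subtype.val (kfun_confSpan y i)⟩

/-- The class of the span of the kernel functions at the points of a configuration. -/
def pickMk : Pick n := ⟦spanSpace y⟧

variable {y}

theorem IsSpanOf.gram {S : CPSpace n} (h : IsSpanOf S y) (i j : Fin n) :
    S.gram i j = daKer (confPt y i) (confPt y j) := by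
  obtain ⟨J, hJ⟩ := h
  rw [CPSpace.gram_apply, ← J.inner_map_map, hJ, hJ, inner_daFun]

theorem IsSpanOf.mk_eq {S : CPSpace n} (h : IsSpanOf S y) : (⟦S⟧ : Pick n) = pickMk y := by
  refine Quotient.sound ((CPSpace.equiv_iff _ _).2 ⟨1, fun _ => 1, fun _ => one_ne_zero, ?_⟩)
  intro i j
  simp [h.gram, spanSpace_gram]

theorem pickMk_eq_pickMk_iff_gram {y y' : Conf d n} : pickMk y = pickMk y' ↔
    ∃ (σ : Equiv.Perm (Fin n)) (f : Fin n → ℂ), (∀ i, f i ≠ 0) ∧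
      ∀ i j, daKer (confPt y i) (confPt y j) =
        conj (f i) * f j * daKer (confPt y' (σ i)) (confPt y' (σ j)) := by
  rw [pickMk, pickMk, Quotient.eq]
  refine (CPSpace.equiv_iff _ _).trans ?_
  simp only [spanSpace_gram]

theorem pickMk_perm (σ : Equiv.Perm (Fin n)) (y : Conf d n) : pickMk (σ • y) = pickMk y :=
  pickMk_eq_pickMk_iff_gram.2 ⟨σ⁻¹, fun _ => 1, fun _ => one_ne_zero, fun i j => by
    simp [confPt_perm]⟩

theorem pickMk_smul (φ : BallAut d) (y : Conf d n) : pickMk (φ • y) = pickMk y :=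
  Eq.symm <| pickMk_eq_pickMk_iff_gram.2 ⟨1, fun i => autWeight φ (confPt y i),
    fun _ => autWeight_ne_zero _ _, fun i j => by
      rw [daKer_smul φ]
      rfl⟩

theorem isClassOf_mk_iff {P : Pick n} : IsClassOf P (X0.mk y) ↔ P = pickMk y := by
  constructor
  · rintro ⟨y', hy', S, hS, rfl⟩
    obtain ⟨σ, rfl⟩ := X0.mk_eq_mk_iff.1 hy'
    rw [hS.mk_eq, pickMk_perm]
  · rintro rfl
    exact ⟨y, rfl, spanSpace y, isSpanOf_spanSpace y, rfl⟩

end Span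

/-- After a reordering and Möbius maps that put the zeroth points at the origin, the normalization
of the kernel there kills the rescaling. The inner products of the points then agree, and a unitary
map matches them. -/
theorem pickMk_eq_pickMk_iff {y y' : Conf d (d + 1)} : pickMk y = pickMk y' ↔
    ∃ (φ : BallAut d) (σ : Equiv.Perm (Fin (d + 1))), y' = φ • σ • y := by
  constructor
  · intro h
    have key : ∀ z z' : Conf d (d + 1), confPt z 0 = Ball.origin d → confPt z' 0 = Ball.origin d →
        ∀ f : Fin (d + 1) → ℂ, (∀ i j, daKer (confPt z i) (confPt z j) =
          conj (f i) * f j * daKer (confPt z' i) (confPt z' j)) →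
        ∃ U : Cn d ≃ₗᵢ[ℂ] Cn d, linAut U • z = z' := by
      intro z z' hz hz' f hf
      have hone : ∀ w : Ball d, daKer (Ball.origin d) w = 1 := fun w => by
        simp [daKer, Ball.origin]
      have h0 : ∀ j, conj (f 0) * f j = 1 := fun j => by
        have := hf 0 j
        rw [hz, hz', hone, hone, mul_one] at this
        exact this.symm
      have hf0 : conj (f 0) ≠ 0 := left_ne_zero_of_mul_eq_one (h0 0)
      -- Against the origin the kernel is 1, so the scaling factors are one and the same number of
      -- modulus one.
      have hfj : ∀ j, f j = f 0 := fun j => mul_left_cancel₀ hf0 ((h0 j).trans (h0 0).symm)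
      have hin : ∀ i j, inner ℂ (z.1 i) (z.1 j) = inner ℂ (z'.1 i) (z'.1 j) := by
        intro i j
        have h1 := hf j i
        rw [hfj i, hfj j, h0 0, one_mul, daKer, daKer, one_div, one_div, inv_inj] at h1
        exact sub_right_injective h1
      obtain ⟨U, hU⟩ := exists_unitary z.1 z'.1 hin
      refine ⟨U, Subtype.ext (funext fun i => ?_)⟩
      rw [← hU]
      rfl
    obtain ⟨σ, f, -, hf⟩ := pickMk_eq_pickMk_iff_gram.1 h
    set x' := σ⁻¹ • y' with hx'
    have hf' : ∀ i j, daKer (confPt y i) (confPt y j) =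
        conj (f i) * f j * daKer (confPt x' i) (confPt x' j) := fun i j => by
      rw [hf, hx', confPt_perm, confPt_perm, inv_inv]
    obtain ⟨U, hU⟩ := key (mob (confPt y 0) • y) (mob (confPt x' 0) • x')
      (by rw [confPt_smul, mob_smul_self]) (by rw [confPt_smul, mob_smul_self])
      (fun i => (autWeight (mob (confPt y 0)) (confPt y i))⁻¹ * f i *
        autWeight (mob (confPt x' 0)) (confPt x' i)) (by
        intro i j
        have h1 := hf' i j
        rw [daKer_smul (mob (confPt y 0)), daKer_smul (mob (confPt x' 0)) (confPt x' i)] at h1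
        simp only [confPt_smul]
        have h2 := autWeight_ne_zero (mob (confPt y 0)) (confPt y j)
        have h3 := (map_ne_zero (starRingEnd ℂ)).2
          (autWeight_ne_zero (mob (confPt y 0)) (confPt y i))
        simp only [map_mul, map_inv₀]
        field_simp
        linear_combination h1)
    refine ⟨(mob (confPt x' 0))⁻¹ * linAut U * mob (confPt y 0), σ, ?_⟩
    rw [smul_perm_comm, mul_smul, mul_smul, hU, inv_smul_smul, hx', smul_inv_smul]
  · rintro ⟨φ, σ, rfl⟩
    rw [pickMk_smul, pickMk_perm]

/-! ### The theorem of McCullough and Quiggin -/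

section Necessity

variable {ι : Type*} [Fintype ι]

theorem posSemidef_of_eq_inner {E : Type*} [NormedAddCommGroup E] [InnerProductSpace ℂ E]
    {M : Matrix ι ι ℂ} (v : ι → E) (h : ∀ i j, M i j = inner ℂ (v i) (v j)) : M.PosSemidef := by
  rw [show M = Matrix.gram ℂ v from Matrix.ext h]
  exact Matrix.posSemidef_gram ℂ v

theorem inner_sub_proj {E : Type*} [NormedAddCommGroup E] [InnerProductSpace ℂ E] (u v w : E) :
    inner ℂ (v - (inner ℂ u v / inner ℂ u u) • u) (w - (inner ℂ u w / inner ℂ u u) • u) =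
      inner ℂ v w - inner ℂ v u * inner ℂ u w / inner ℂ u u := by
  rcases eq_or_ne u 0 with rfl | hu
  · simp
  have hu' : inner ℂ u u ≠ 0 := inner_self_ne_zero.2 hu
  simp only [inner_sub_left, inner_sub_right, inner_smul_left, inner_smul_right, map_div₀,
    inner_conj_symm]
  field_simp
  ring

theorem inner_proj {E : Type*} [NormedAddCommGroup E] [InnerProductSpace ℂ E] (u v w : E) :
    inner ℂ ((inner ℂ u v / inner ℂ u u) • u) ((inner ℂ u w / inner ℂ u u) • u) =
      inner ℂ v u * inner ℂ u w / inner ℂ u u := by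
  rcases eq_or_ne u 0 with rfl | hu
  · simp
  have hu' : inner ℂ u u ≠ 0 := inner_self_ne_zero.2 hu
  simp only [inner_smul_left, inner_smul_right, map_div₀, inner_conj_symm]
  field_simp

/-- A Schur complement is the Gram matrix of the components orthogonal to one vector. A vanishing
pivot means a zero vector, for which the quotient is zero. -/
theorem posSemidef_schur {N : Matrix ι ι ℂ} (hN : N.PosSemidef) (a : ι) :
    (Matrix.of fun i j => N i j - N i a * N a j / N a a).PosSemidef := by
  obtain ⟨m, v, rfl⟩ := exists_eq_gram hN
  refine posSemidef_of_eq_inner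
    (fun i => v i - (inner ℂ (v a) (v i) / inner ℂ (v a) (v a)) • v a) fun i j => ?_
  rw [inner_sub_proj]
  rfl

theorem posSemidef_rankOne {N : Matrix ι ι ℂ} (hN : N.PosSemidef) (a : ι) :
    (Matrix.of fun i j => N i a * N a j / N a a).PosSemidef := by
  obtain ⟨m, v, rfl⟩ := exists_eq_gram hN
  refine posSemidef_of_eq_inner
    (fun i => (inner ℂ (v a) (v i) / inner ℂ (v a) (v a)) • v a) fun i j => ?_
  rw [inner_proj]
  rfl

theorem posSemidef_inv_rankOne {N : Matrix ι ι ℂ} (hN : N.PosSemidef) (a : ι) :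
    (Matrix.of fun i j => N a a / (N i a * N a j)).PosSemidef := by
  obtain ⟨m, v, rfl⟩ := exists_eq_gram hN
  refine posSemidef_of_eq_inner (fun i => (inner ℂ (v a) (v i))⁻¹ • v a) fun i j => ?_
  rw [inner_smul_left, inner_smul_right, map_inv₀, inner_conj_symm,
    Matrix.of_apply, Matrix.gram_apply, Matrix.gram_apply, Matrix.gram_apply, div_eq_mul_inv,
    mul_inv]
  ring

variable {X H : Type*} [NormedAddCommGroup H] [InnerProductSpace ℂ H] [CompleteSpace H]
  [RKHS ℂ H X ℂ]

/-- If the kernel of a complete Pick space vanishes nowhere, then the matrices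
`1 - k(x_i, x_a) k(x_a, x_j) / (k(x_i, x_j) k(x_a, x_a))` are positive. -/
theorem IsCompletePick.posSemidef (hH : IsCompletePick H)
    (hne : ∀ x y : X, inner ℂ (kfun H x) (kfun H y) ≠ 0) (m : ℕ) :
    ∀ (x : Fin m → X) (_ : Function.Injective x) (a : Fin m),
      (Matrix.of fun i j => 1 - Matrix.gram ℂ (fun i => kfun H (x i)) i a *
        Matrix.gram ℂ (fun i => kfun H (x i)) a j / (Matrix.gram ℂ (fun i => kfun H (x i)) i j *
          Matrix.gram ℂ (fun i => kfun H (x i)) a a)).PosSemidef := by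
  induction m with
  | zero => exact fun _ _ a => a.elim0
  | succ m ih =>
    intro x hx a
    set K := Matrix.gram ℂ fun i => kfun H (x i) with hKdef
    have hK : K.PosSemidef := Matrix.posSemidef_gram ℂ _
    have hK0 : ∀ i j, K i j ≠ 0 := fun i j => hne _ _
    -- Row and column `a` of the matrix vanish, so only the other indices matter.
    have hsub : (Matrix.of fun i j : Fin m => 1 - K (a.succAbove i) a * K a (a.succAbove j) /
        (K (a.succAbove i) (a.succAbove j) * K a a)).PosSemidef := by
      cases m with
      | zero =>
        exact posSemidef_of_eq_inner (fun i => (i.elim0 : ℂ)) fun i => i.elim0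
      | succ k =>
        set b := a.succAbove 0
        obtain ⟨q, w, hw⟩ := exists_eq_gram
          (ih (x ∘ a.succAbove) (hx.comp Fin.succAbove_right_injective) 0)
        have hw' : ∀ i j, inner ℂ (w i) (w j) = 1 - K (a.succAbove i) b * K b (a.succAbove j) /
            (K (a.succAbove i) (a.succAbove j) * K b b) := fun i j =>
          (congrFun (congrFun hw i) j).symm
        let W : Fin (k + 1) → Matrix (Fin 1) (Fin q) ℂ := fun i => Matrix.of fun _ l => conj (w i l)
        have hWW : ∀ i j r s, (W i * (W j).conjTranspose) r s = inner ℂ (w i) (w j) := by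
          intro i j r s
          simp [W, Matrix.mul_apply, PiLp.inner_apply, mul_comm]
        -- By induction the matrix with base point `b` on the points other than `x a` is `W W^*` for
        -- row vectors `W`. Then `(1 - W W^*) k` is the rank one matrix `k(·, b) k(b, ·) / k(b, b)`,
        -- and the Pick property extends `W` to a multiplier `F` defined also at `x a`.
        obtain ⟨F, hF, hFW⟩ := (hH 1 q (k + 1) (x ∘ a.succAbove) W
          (hx.comp Fin.succAbove_right_injective)).2 (by
            have h1 := ((posSemidef_rankOne hK b).submatrix
              fun r : Fin (k + 1) × Fin 1 => a.succAbove r.1)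
            refine (congrArg Matrix.PosSemidef ?_).mpr h1
            ext r s
            rw [Matrix.of_apply, Matrix.sub_apply, hWW, hw', Subsingleton.elim r.2 s.2,
              Matrix.one_apply_eq, ← inner_kfun]
            change (1 - (1 - _)) * K (a.succAbove r.1) (a.succAbove s.1) =
              K (a.succAbove r.1) b * K b (a.succAbove s.1) / K b b
            have h2 := hK0 (a.succAbove r.1) (a.succAbove s.1)
            have h3 := hK0 b b
            field_simp
            ring)
        have hFF : (Matrix.of fun i j => (F (x i) * (F (x j)).conjTranspose) 0 0).PosSemidef := by
          refine posSemidef_of_eq_inner (fun i =>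
            (WithLp.toLp 2 fun l => conj (F (x i) 0 l) : EuclideanSpace ℂ (Fin q))) fun i j => ?_
          simp [Matrix.mul_apply, PiLp.inner_apply, mul_comm]
        have hM := (hF.posSemidef x).submatrix fun i => (i, (0 : Fin 1))
        -- The sum is `K - F F^* ∘ S` with `S` the Schur complement of `K` at `a`. Row and column
        -- `a` of `S` vanish, so the Schur complement of the sum is `(1 - F F^*) ∘ S`, whatever `F`
        -- is at `x a`. Dividing off the rank one part of `1 - F F^*` leaves `S / K`, the desired
        -- matrix.
        have hN := hM.add ((posSemidef_rankOne hK a).hadamard hFF)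
        have hfin := ((posSemidef_schur hN a).submatrix a.succAbove).hadamard
          ((posSemidef_inv_rankOne hK b).submatrix a.succAbove)
        refine (congrArg Matrix.PosSemidef ?_).mpr hfin
        have hval : ∀ i j, kfun H (x j) (x i) = K i j := fun i j => (inner_kfun _ _).symm
        ext i j
        have hFx : ∀ i, F (x (a.succAbove i)) = W i := hFW
        simp only [Matrix.hadamard_apply, Matrix.submatrix_apply, Matrix.of_apply,
          Matrix.add_apply, Matrix.sub_apply, Matrix.one_apply_eq, hval, hFx, hWW, hw']
        have h1 := hK0 (a.succAbove i) (a.succAbove j)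
        have h2 := hK0 a a
        have h3 := hK0 b b
        have h4 := hK0 b (a.succAbove j)
        have h5 := hK0 (a.succAbove i) b
        field_simp
        ring
    obtain ⟨q, w, hw⟩ := exists_eq_gram hsub
    refine posSemidef_of_eq_inner
      (Fin.insertNth (α := fun _ => EuclideanSpace ℂ (Fin q)) a 0 w) fun i j => ?_
    have h2 := hK0 a a
    rw [Matrix.of_apply]
    induction i using Fin.succAboveCases a with
    | x =>
      rw [Fin.insertNth_apply_same, inner_zero_left]
      have h1 := hK0 a j
      field_simp
      ring
    | p i =>
      induction j using Fin.succAboveCases a with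
      | x =>
        rw [Fin.insertNth_apply_same, inner_zero_right]
        have h1 := hK0 (a.succAbove i) a
        field_simp
        ring
      | p j =>
        rw [Fin.insertNth_apply_succAbove, Fin.insertNth_apply_succAbove]
        exact congrFun (congrFun hw i) j

end Necessity

/-- The number of coordinates equals the size of the matrix, which is what places the points in
`ℂ^d`. -/
theorem exists_eq_gram_fin {n : ℕ} {M : Matrix (Fin n) (Fin n) ℂ} (hM : M.PosSemidef) :
    ∃ v : Fin n → Cn n, ∀ i j, M i j = inner ℂ (v i) (v j) := by
  open scoped MatrixOrder in
  obtain ⟨B, rfl⟩ := CStarAlgebra.nonneg_iff_eq_star_mul_self.1 hM.nonneg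
  refine ⟨fun i => WithLp.toLp 2 fun k => B k i, fun i j => ?_⟩
  simp [Matrix.star_eq_conjTranspose, Matrix.mul_apply, PiLp.inner_apply, mul_comm]

/-- Every complete Pick space of dimension `d + 1` comes from a configuration in `𝔹_d`. -/
theorem CPSpace.exists_conf (S : CPSpace (d + 1)) : ∃ y : Conf d (d + 1), (⟦S⟧ : Pick (d + 1)) =
    pickMk y := by
  have hA := S.completePick.posSemidef S.gram_ne_zero (d + 1) id Function.injective_id 0
  have hK0 := S.gram_ne_zero
  have hA' : (Matrix.of fun i j => 1 - S.gram i 0 * S.gram 0 j / (S.gram i j * S.gram 0 0) :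
      Matrix (Fin (d + 1)) (Fin (d + 1)) ℂ).PosSemidef := hA
  obtain ⟨v, hv⟩ := exists_eq_gram_fin (hA'.submatrix Fin.succ)
  -- Row and column 0 vanish, so a `d × d` block is factored. The conjugate accounts for the kernel
  -- being linear in its first variable.
  let w : Fin (d + 1) → Cn d := Fin.cons 0 fun i => WithLp.toLp 2 fun k => conj (v i k)
  have hw : ∀ i j, 1 - S.gram i 0 * S.gram 0 j / (S.gram i j * S.gram 0 0) = ⟪w j, w i⟫_ℂ := by
    have h00 := hK0 0 0
    intro i j
    induction i using Fin.cases with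
    | zero =>
      have h1 := hK0 0 j
      have h2 : w 0 = 0 := rfl
      rw [h2, inner_zero_right]
      field_simp
      ring
    | succ i =>
      induction j using Fin.cases with
      | zero =>
        have h1 := hK0 i.succ 0
        have h2 : w 0 = 0 := rfl
        rw [h2, inner_zero_left]
        field_simp
        ring
      | succ j =>
        have h1 := hv i j
        rw [Matrix.submatrix_apply, Matrix.of_apply] at h1
        rw [h1]
        simp [w, PiLp.inner_apply, mul_comm]
  -- Thus the Gram matrix is a rescaled Drury-Arveson kernel at the points `w`, with scaling factors
  -- `S.gram 0 i / √(S.gram 0 0)`.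
  have hker : ∀ i j, S.gram i j * (1 - ⟪w j, w i⟫_ℂ) = S.gram i 0 * S.gram 0 j / S.gram 0 0 := by
    intro i j
    rw [← hw]
    have h1 := hK0 i j
    have h2 := hK0 0 0
    field_simp
    ring
  have hne : ∀ i j, 1 - ⟪w j, w i⟫_ℂ ≠ 0 := fun i j h0 => by
    have := hker i j
    rw [h0, mul_zero, eq_comm, div_eq_zero_iff, mul_eq_zero] at this
    have h1 := hK0 i 0
    have h2 := hK0 0 j
    have h3 := hK0 0 0
    tauto
  have hself : ∀ i, ∃ r : ℝ, 0 < r ∧ S.gram i i = r := fun i =>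
    ⟨‖kfun S.H i‖ ^ 2, pow_pos (norm_pos_iff.2 (S.linearIndependent_kfun.ne_zero i)) 2, by
      rw [S.gram_apply, inner_self_eq_norm_sq_to_K]
      simp⟩
  obtain ⟨r0, hr0, hr0'⟩ := hself 0
  have hnorm : ∀ i, w i ∈ Ball d := by
    intro i
    rw [mem_Ball_iff]
    obtain ⟨r, hr, hr'⟩ := hself i
    have h1 := hker i i
    rw [hr', hr0', ← S.conj_gram 0 i, mul_comm (conj _), Complex.mul_conj,
      inner_self_eq_norm_sq_to_K] at h1
    have h2 : r * (1 - ‖w i‖ ^ 2) = Complex.normSq (S.gram 0 i) / r0 :=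
      Complex.ofReal_injective (by push_cast; exact h1)
    have h3 : 0 < Complex.normSq (S.gram 0 i) / r0 := div_pos (Complex.normSq_pos.2 (hK0 0 i)) hr0
    rw [← h2] at h3
    have h4 := (mul_pos_iff_of_pos_left hr).1 h3
    nlinarith [norm_nonneg (w i)]
  have hinj : Function.Injective w := by
    intro i j hij
    by_contra hne'
    set c := 1 - ⟪w i, w i⟫_ℂ with hc
    have hc0 : c ≠ 0 := hne i i
    have hg : ∀ a b, w a = w i → w b = w i → S.gram a b = S.gram a 0 * S.gram 0 b /
        (S.gram 0 0 * c) := by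
      intro a b ha hb
      have h1 := hker a b
      rw [ha, hb, ← hc] at h1
      have := hK0 0 0
      field_simp at h1 ⊢
      linear_combination h1
    -- Coinciding points would make two kernel functions proportional, against irreducibility.
    have hz : S.gram 0 j • kfun S.H i - S.gram 0 i • kfun S.H j = 0 := by
      rw [← inner_self_eq_zero (𝕜 := ℂ)]
      simp only [inner_sub_left, inner_sub_right, inner_smul_left, inner_smul_right,
        ← S.gram_apply, S.conj_gram]
      rw [hg i i rfl rfl, hg i j rfl hij.symm, hg j i hij.symm rfl, hg j j hij.symm hij.symm]
      ring
    have hli := LinearIndependent.pair_iff.1 (S.irreducible i j hne').1 (S.gram 0 j) (-S.gram 0 i)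
      (by rw [neg_smul, ← sub_eq_add_neg]; exact hz)
    exact hK0 0 j hli.1
  refine ⟨⟨w, hnorm, hinj⟩, Quotient.sound ((CPSpace.equiv_iff _ _).2 ⟨1, fun i =>
    S.gram 0 i / (√r0 : ℝ), fun i => div_ne_zero (hK0 0 i)
      (Complex.ofReal_ne_zero.2 (Real.sqrt_pos.2 hr0).ne'), fun i j => ?_⟩)⟩
  rw [spanSpace_gram]
  have h1 := hker i j
  have h2 : ((√r0 : ℝ) : ℂ) * (√r0 : ℝ) = r0 := by
    rw [← Complex.ofReal_mul, Real.mul_self_sqrt hr0.le]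
  change _ = _ * (1 / (1 - ⟪w j, w i⟫_ℂ))
  rw [map_div₀, S.conj_gram, Complex.conj_ofReal, div_mul_div_comm, h2, ← hr0', ← h1]
  have h3 := hne i j
  field_simp

theorem pickMk_surjective : Function.Surjective (pickMk : Conf d (d + 1) → Pick (d + 1)) := fun P =>
  Quotient.inductionOn P fun S => (CPSpace.exists_conf S).imp fun _ h => h.symm

end
end PickSpace

/-! ### The topology of `Pick` is the quotient topology of the configuration space. -/

namespace PickSpace
noncomputable section
open scoped Manifold ContDiff Topology ComplexConjugate
open InnerProductSpace

variable {d : ℕ}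

/-! ### The distance of complete Pick spaces -/

section Rho

variable {n : ℕ}

/-- The kernel functions as a basis. -/
def CPSpace.basis (S : CPSpace n) : Module.Basis (Fin n) ℂ S.H :=
  .mk S.linearIndependent_kfun (span_kfun S.finrank_eq).ge

theorem CPSpace.basis_apply (S : CPSpace n) (i : Fin n) : S.basis i = kfun S.H i :=
  Module.Basis.mk_apply _ _ _

/-- The isomorphism that matches the kernel functions. -/
def CPSpace.iso (S S' : CPSpace n) : S.H ≃L[ℂ] S'.H :=
  haveI := S.finiteDimensional
  haveI := S'.finiteDimensional
  (S.basis.equiv S'.basis (Equiv.refl _)).toContinuousLinearEquiv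

theorem CPSpace.iso_kfun (S S' : CPSpace n) (i : Fin n) : S.iso S' (kfun S.H i) = kfun S'.H i := by
  rw [← S.basis_apply, ← S'.basis_apply]
  exact S.basis.equiv_apply i S'.basis (Equiv.refl _)

theorem CPSpace.isRKHSIso_iso (S S' : CPSpace n) : IsRKHSIso (S.iso S') :=
  ⟨1, fun _ => 1, fun _ => one_ne_zero, fun i => by simp [CPSpace.iso_kfun]⟩

variable {S S' : CPSpace (n + 1)}

/-- The space is nonzero because there is at least one point. The bound keeps the infimum in `rhoRK`
positive, so that the logarithm can be inverted. -/
theorem CPSpace.one_le_norm_mul_norm (T : S.H ≃L[ℂ] S'.H) :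
    1 ≤ ‖(T : S.H →L[ℂ] S'.H)‖ * ‖(T.symm : S'.H →L[ℂ] S.H)‖ := by
  have h0 : 0 < ‖kfun S.H 0‖ := norm_pos_iff.2 (S.linearIndependent_kfun.ne_zero 0)
  have h1 := (T.symm : S'.H →L[ℂ] S.H).le_opNorm (T (kfun S.H 0))
  have h2 := (T : S.H →L[ℂ] S'.H).le_opNorm (kfun S.H 0)
  simp only [ContinuousLinearEquiv.coe_coe, ContinuousLinearEquiv.symm_apply_apply] at h1 h2
  have h3 := h1.trans (mul_le_mul_of_nonneg_left h2 (norm_nonneg _))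
  rw [← mul_assoc, mul_comm ‖(T.symm : S'.H →L[ℂ] S.H)‖] at h3
  exact le_of_mul_le_mul_right (by rwa [one_mul]) h0

theorem exists_of_rhoRK_lt {ε : ℝ} (h : rhoRK S S' < ε) : ∃ T : S.H ≃L[ℂ] S'.H, IsRKHSIso T ∧
    ‖(T : S.H →L[ℂ] S'.H)‖ * ‖(T.symm : S'.H →L[ℂ] S.H)‖ < Real.exp ε := by
  have hne : {r | ∃ T : S.H ≃L[ℂ] S'.H, IsRKHSIso T ∧
      r = ‖(T : S.H →L[ℂ] S'.H)‖ * ‖(T.symm : S'.H →L[ℂ] S.H)‖}.Nonempty :=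
    ⟨_, S.iso S', S.isRKHSIso_iso S', rfl⟩
  have h1 : 1 ≤ sInf {r | ∃ T : S.H ≃L[ℂ] S'.H, IsRKHSIso T ∧
      r = ‖(T : S.H →L[ℂ] S'.H)‖ * ‖(T.symm : S'.H →L[ℂ] S.H)‖} := by
    refine le_csInf hne ?_
    rintro r ⟨T, -, rfl⟩
    exact CPSpace.one_le_norm_mul_norm T
  rw [rhoRK, Real.log_lt_iff_lt_exp (by linarith)] at h
  obtain ⟨r, ⟨T, hT, rfl⟩, hr⟩ := exists_lt_of_csInf_lt hne h
  exact ⟨T, hT, hr⟩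

theorem rhoRK_le_log {T : S.H ≃L[ℂ] S'.H} (hT : IsRKHSIso T) {A B : ℝ} (hA : 0 ≤ A)
    (hTA : ∀ v, ‖T v‖ ≤ A * ‖v‖) (hB : 0 ≤ B) (hTB : ∀ v, ‖v‖ ≤ B * ‖T v‖) :
    rhoRK S S' ≤ Real.log (A * B) := by
  have h1 : ‖(T : S.H →L[ℂ] S'.H)‖ ≤ A := ContinuousLinearMap.opNorm_le_bound _ hA hTA
  have h2 : ‖(T.symm : S'.H →L[ℂ] S.H)‖ ≤ B := ContinuousLinearMap.opNorm_le_bound _ hB fun v => by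
    simpa using hTB (T.symm v)
  have h3 : 1 ≤ sInf {r | ∃ T : S.H ≃L[ℂ] S'.H, IsRKHSIso T ∧
      r = ‖(T : S.H →L[ℂ] S'.H)‖ * ‖(T.symm : S'.H →L[ℂ] S.H)‖} := by
    refine le_csInf ⟨_, T, hT, rfl⟩ ?_
    rintro r ⟨T, -, rfl⟩
    exact CPSpace.one_le_norm_mul_norm T
  have h4 : BddBelow {r | ∃ T : S.H ≃L[ℂ] S'.H, IsRKHSIso T ∧
      r = ‖(T : S.H →L[ℂ] S'.H)‖ * ‖(T.symm : S'.H →L[ℂ] S.H)‖} := by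
    refine ⟨0, ?_⟩
    rintro r ⟨T, -, rfl⟩
    positivity
  exact Real.log_le_log (by linarith) ((csInf_le h4 ⟨T, hT, rfl⟩).trans
    (mul_le_mul h1 h2 (norm_nonneg _) hA))

/-- Complete Pick spaces that are close have Gram matrices that are close, up to a permutation
and a rescaling. -/
theorem exists_gram_close {ε : ℝ} (h : rhoRK S S' < ε) :
    ∃ (φ : Equiv.Perm (Fin (n + 1))) (f : Fin (n + 1) → ℂ), ∀ i j,
      ‖S.gram i j - conj (f i) * f j * S'.gram (φ i) (φ j)‖ ≤
        (1 - Real.exp (-2 * ε)) * (‖kfun S.H i‖ + ‖kfun S.H j‖) ^ 2 := by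
  obtain ⟨T, ⟨φ, f, hf, hTf⟩, hT⟩ := exists_of_rhoRK_lt h
  set t := ‖(T : S.H →L[ℂ] S'.H)‖
  set s := ‖(T.symm : S'.H →L[ℂ] S.H)‖
  have hts := CPSpace.one_le_norm_mul_norm T
  have ht : 0 < t := by
    rcases (norm_nonneg (T : S.H →L[ℂ] S'.H)).eq_or_lt with h0 | h0
    · rw [← h0, zero_mul] at hts
      linarith
    · exact h0
  -- Normalized to be a contraction, the isomorphism still satisfies `‖x‖ ≤ exp ε * ‖T' x‖`, so
  -- squared norms change at most by the factor `exp (-2 * ε)`; polarization carries this over to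
  -- inner products.
  let T' : S.H →L[ℂ] S'.H := ((t : ℂ)⁻¹) • (T : S.H →L[ℂ] S'.H)
  have hT' : ∀ x, ‖T' x‖ = t⁻¹ * ‖T x‖ := fun x => by
    simp [T', norm_smul, abs_of_pos ht]
  have hup : ∀ x, ‖T' x‖ ≤ ‖x‖ := fun x => by
    rw [hT', inv_mul_le_iff₀ ht]
    exact (T : S.H →L[ℂ] S'.H).le_opNorm x
  have hlow : ∀ x, ‖x‖ ≤ Real.exp ε * ‖T' x‖ := fun x => by
    have h1 := (T.symm : S'.H →L[ℂ] S.H).le_opNorm (T x)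
    simp only [ContinuousLinearEquiv.coe_coe, ContinuousLinearEquiv.symm_apply_apply] at h1
    have h2 : ‖T x‖ = t * ‖T' x‖ := by rw [hT', mul_inv_cancel_left₀ ht.ne']
    rw [h2, ← mul_assoc, mul_comm s] at h1
    exact h1.trans (mul_le_mul_of_nonneg_right hT.le (norm_nonneg _))
  have hq : ∀ x, |‖x‖ ^ 2 - ‖T' x‖ ^ 2| ≤ (1 - Real.exp (-2 * ε)) * ‖x‖ ^ 2 := fun x => by
    have h1 := pow_le_pow_left₀ (norm_nonneg _) (hup x) 2
    have h2 := pow_le_pow_left₀ (norm_nonneg _) (hlow x) 2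
    rw [mul_pow, ← Real.exp_nat_mul] at h2
    rw [abs_of_nonneg (by linarith)]
    have h3 : Real.exp (-2 * ε) * ‖x‖ ^ 2 ≤ ‖T' x‖ ^ 2 := by
      rw [neg_mul, Real.exp_neg, inv_mul_le_iff₀ (Real.exp_pos _)]
      exact_mod_cast h2
    linarith
  have hη : 0 ≤ 1 - Real.exp (-2 * ε) := by
    have h1 := (abs_nonneg _).trans (hq (kfun S.H 0))
    have h0 : 0 < ‖kfun S.H 0‖ := norm_pos_iff.2 (S.linearIndependent_kfun.ne_zero 0)
    exact nonneg_of_mul_nonneg_left h1 (by positivity)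
  have hbound : ∀ x (r : ℝ), ‖x‖ ≤ r → |‖x‖ ^ 2 - ‖T' x‖ ^ 2| ≤ (1 - Real.exp (-2 * ε)) * r ^ 2 :=
    fun x r hx => (hq x).trans
      (mul_le_mul_of_nonneg_left (pow_le_pow_left₀ (norm_nonneg _) hx 2) hη)
  refine ⟨φ, fun i => (t : ℂ)⁻¹ * f i, fun i j => ?_⟩
  have hg : conj ((t : ℂ)⁻¹ * f i) * ((t : ℂ)⁻¹ * f j) * S'.gram (φ i) (φ j) =
      ⟪T' (kfun S.H i), T' (kfun S.H j)⟫_ℂ := by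
    have h1 : ∀ i, T' (kfun S.H i) = ((t : ℂ)⁻¹ * f i) • kfun S'.H (φ i) := fun i => by
      simp [T', hTf, smul_smul]
    rw [h1, h1, inner_smul_left, inner_smul_right, S'.gram_apply, mul_assoc]
  rw [hg, S.gram_apply, inner_eq_sum_norm_sq_div_four (𝕜 := ℂ) (kfun S.H i),
    inner_eq_sum_norm_sq_div_four (𝕜 := ℂ) (T' (kfun S.H i))]
  set u := kfun S.H i
  set v := kfun S.H j
  have e1 : T' u + T' v = T' (u + v) := (map_add _ _ _).symm
  have e2 : T' u - T' v = T' (u - v) := (map_sub _ _ _).symm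
  have e3 : T' u - (RCLike.I : ℂ) • T' v = T' (u - (RCLike.I : ℂ) • v) := by
    rw [map_sub, map_smul]
  have e4 : T' u + (RCLike.I : ℂ) • T' v = T' (u + (RCLike.I : ℂ) • v) := by
    rw [map_add, map_smul]
  rw [e1, e2, e3, e4]
  have hI : ‖(RCLike.I : ℂ) • v‖ = ‖v‖ := by simp [norm_smul]
  have b1 := hbound (u + v) _ (norm_add_le u v)
  have b2 := hbound (u - v) _ (norm_sub_le u v)
  have b3 := hbound (u - (RCLike.I : ℂ) • v) (‖u‖ + ‖v‖) ((norm_sub_le _ _).trans_eq (by rw [hI]))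
  have b4 := hbound (u + (RCLike.I : ℂ) • v) (‖u‖ + ‖v‖) ((norm_add_le _ _).trans_eq (by rw [hI]))
  set B := (1 - Real.exp (-2 * ε)) * (‖u‖ + ‖v‖) ^ 2
  have hsplit : ∀ a b c e a' b' c' e' : ℝ,
      ((a : ℂ) ^ 2 - (b : ℂ) ^ 2 + ((c : ℂ) ^ 2 - (e : ℂ) ^ 2) * RCLike.I) / 4 -
      ((a' : ℂ) ^ 2 - (b' : ℂ) ^ 2 + ((c' : ℂ) ^ 2 - (e' : ℂ) ^ 2) * RCLike.I) / 4 =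
      (((a ^ 2 - a' ^ 2 : ℝ) : ℂ) - ((b ^ 2 - b' ^ 2 : ℝ) : ℂ) +
        (((c ^ 2 - c' ^ 2 : ℝ) : ℂ) - ((e ^ 2 - e' ^ 2 : ℝ) : ℂ)) * RCLike.I) / 4 := by
    intros
    push_cast
    ring
  simp only [Complex.coe_algebraMap]
  rw [hsplit, norm_div, Complex.norm_ofNat, div_le_iff₀ (by norm_num)]
  refine (norm_add_le _ _).trans ?_
  rw [norm_mul, RCLike.norm_I_of_ne_zero (by simp), mul_one]
  refine (add_le_add (norm_sub_le _ _) (norm_sub_le _ _)).trans ?_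
  simp only [Complex.norm_real, Real.norm_eq_abs]
  linarith

end Rho

theorem continuous_confPt {n : ℕ} (i : Fin n) : Continuous fun y : Conf d n => confPt y i :=
  ((continuous_apply i).comp continuous_subtype_val).subtype_mk _

theorem continuous_daKer : Continuous fun q : Ball d × Ball d => daKer q.1 q.2 := by
  refine continuous_const.div ?_ fun q =>
    one_sub_inner_ne_zero (ball_norm_lt q.2) (ball_norm_lt q.1)
  exact continuous_const.sub ((continuous_subtype_val.comp continuous_snd).inner
    (continuous_subtype_val.comp continuous_fst))

theorem isOpen_pick_iff {n : ℕ} {V : Set (Pick n)} : IsOpen V ↔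
    ∀ S : CPSpace n, (⟦S⟧ : Pick n) ∈ V → ∃ ε > 0, ∀ S' : CPSpace n, rhoRK S S' < ε →
      (⟦S'⟧ : Pick n) ∈ V := Iff.rfl

/-- For nearby configurations the Gram matrices are close, so matching the kernel functions is an
isomorphism that changes squared norms by factors between `1 - δ` and `1 + δ`. -/
theorem continuous_pickMk {n : ℕ} : Continuous (pickMk : Conf d (n + 1) → Pick (n + 1)) := by
  rw [continuous_def]
  intro V hV
  rw [isOpen_iff_mem_nhds]
  intro y hy
  obtain ⟨ε, hε, hεV⟩ := isOpen_pick_iff.1 hV _ hy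
  set S := spanSpace y with hS
  have := S.finiteDimensional
  obtain ⟨C, hC, hCa⟩ := (S.basis.equivFun.symm : (Fin (n + 1) → ℂ) →ₗ[ℂ] S.H).exists_antilipschitzWith
    (LinearMap.ker_eq_bot.2 S.basis.equivFun.symm.injective)
  have hlow : ∀ c : Fin (n + 1) → ℂ, ‖c‖ ≤ C * ‖∑ i, c i • kfun S.H i‖ := fun c => by
    have h1 := hCa.le_mul_dist c 0
    simp only [dist_zero_right, map_zero, LinearEquiv.coe_coe] at h1
    rw [Module.Basis.equivFun_symm_apply] at h1
    simpa only [S.basis_apply] using h1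
  obtain ⟨δ, hδ, hδ1, hδε⟩ : ∃ δ : ℝ, 0 < δ ∧ δ < 1 ∧
      Real.log (√(1 + δ) * (√(1 - δ))⁻¹) < ε := by
    have hcont : ContinuousAt (fun δ : ℝ => Real.log (√(1 + δ) * (√(1 - δ))⁻¹)) 0 := by
      refine ContinuousAt.log (ContinuousAt.mul (by fun_prop) (ContinuousAt.inv₀ (by fun_prop) ?_)) ?_
      · simp
      · simp
    have h1 : ∀ᶠ δ in 𝓝 (0 : ℝ), Real.log (√(1 + δ) * (√(1 - δ))⁻¹) < ε :=
      hcont.eventually_lt continuousAt_const (by simpa using hε)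
    obtain ⟨δ, h2, h3, h4⟩ := ((h1.filter_mono nhdsWithin_le_nhds).and
      (Ioo_mem_nhdsGT (zero_lt_one' ℝ))).exists
    exact ⟨δ, h3, h4, h2⟩
  -- There are `(n + 1) ^ 2` entries, each weighted by at most `‖c‖ ^ 2`, which `C ^ 2` compares
  -- with the norm in `S`.
  set η : ℝ := δ / (((n : ℝ) + 1) ^ 2 * (C ^ 2 + 1)) with hη
  have hηpos : 0 < η := by positivity
  have hev : ∀ᶠ y' in 𝓝 y, ∀ i j, ‖daKer (confPt y' i) (confPt y' j) -
      daKer (confPt y i) (confPt y j)‖ < η := by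
    refine Filter.eventually_all.2 fun i => Filter.eventually_all.2 fun j => ?_
    have h1 : Continuous fun y' : Conf d (n + 1) => ‖daKer (confPt y' i) (confPt y' j) -
      daKer (confPt y i) (confPt y j)‖ :=
      ((continuous_daKer.comp ((continuous_confPt i).prodMk (continuous_confPt j))).sub
        continuous_const).norm
    exact h1.continuousAt.eventually_lt continuousAt_const (by simpa using hηpos)
  filter_upwards [hev] with y' hy'
  refine hεV (spanSpace y') ((rhoRK_le_log (S.isRKHSIso_iso (spanSpace y')) (A := √(1 + δ))
    (B := (√(1 - δ))⁻¹) (by positivity) ?_ (by positivity) ?_).trans_lt hδε)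
  all_goals
    intro v
    obtain ⟨c, rfl⟩ := (Submodule.mem_span_range_iff_exists_fun ℂ).1
      (show v ∈ Submodule.span ℂ (Set.range (kfun S.H)) from
        span_kfun S.finrank_eq ▸ Submodule.mem_top)
    have hkey : |‖∑ i, c i • kfun (spanSpace y').H i‖ ^ 2 - ‖∑ i, c i • kfun S.H i‖ ^ 2| ≤
        δ * ‖∑ i, c i • kfun S.H i‖ ^ 2 := by
      have hexp : ∀ S : CPSpace (n + 1), ((‖∑ i, c i • kfun S.H i‖ ^ 2 : ℝ) : ℂ) =
          ∑ i, ∑ j, conj (c i) * c j * S.gram i j := by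
        intro S
        have h1 := inner_self_eq_norm_sq_to_K (𝕜 := ℂ) (∑ i, c i • kfun S.H i)
        push_cast
        refine h1.symm.trans ?_
        rw [sum_inner]
        refine Finset.sum_congr rfl fun i _ => ?_
        rw [inner_smul_left, inner_sum, Finset.mul_sum]
        refine Finset.sum_congr rfl fun j _ => ?_
        rw [inner_smul_right, S.gram_apply, mul_assoc]
      rw [← Real.norm_eq_abs, ← Complex.norm_real, Complex.ofReal_sub, hexp, hexp,
        ← Finset.sum_sub_distrib]
      simp only [← Finset.sum_sub_distrib, ← mul_sub, spanSpace_gram, hS]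
      have hle : ∀ i j, ‖conj (c i) * c j * (daKer (confPt y' i) (confPt y' j) -
          daKer (confPt y i) (confPt y j))‖ ≤ ‖c‖ * ‖c‖ * η := by
        intro i j
        rw [norm_mul, norm_mul, RCLike.norm_conj]
        exact mul_le_mul (mul_le_mul (norm_le_pi_norm c i) (norm_le_pi_norm c j) (norm_nonneg _)
          (norm_nonneg _)) (hy' i j).le (norm_nonneg _) (by positivity)
      refine (norm_sum_le_of_le _ fun i _ => norm_sum_le_of_le _ fun j _ => hle i j).trans ?_
      simp only [Finset.sum_const, Finset.card_univ, Fintype.card_fin, nsmul_eq_mul]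
      have h1 := hlow c
      have h2 : ‖c‖ * ‖c‖ ≤ C ^ 2 * ‖∑ i, c i • kfun S.H i‖ ^ 2 := by
        rw [← mul_pow, ← sq]
        exact pow_le_pow_left₀ (norm_nonneg _) h1 2
      have h3 : ((n : ℝ) + 1) ^ 2 * η * C ^ 2 ≤ δ := by
        rw [hη]
        have : ((n : ℝ) + 1) ^ 2 * (δ / (((n : ℝ) + 1) ^ 2 * ((C : ℝ) ^ 2 + 1))) * (C : ℝ) ^ 2 =
            δ * ((C : ℝ) ^ 2 / ((C : ℝ) ^ 2 + 1)) := by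
          field_simp
        rw [this]
        refine mul_le_of_le_one_right hδ.le ((div_le_one (by positivity)).2 (by linarith))
      push_cast
      calc ((n : ℝ) + 1) * (((n : ℝ) + 1) * (‖c‖ * ‖c‖ * η))
          = ((n : ℝ) + 1) ^ 2 * η * (‖c‖ * ‖c‖) := by ring
        _ ≤ ((n : ℝ) + 1) ^ 2 * η * (C ^ 2 * ‖∑ i, c i • kfun S.H i‖ ^ 2) :=
            mul_le_mul_of_nonneg_left h2 (by positivity)
        _ = (((n : ℝ) + 1) ^ 2 * η * C ^ 2) * ‖∑ i, c i • kfun S.H i‖ ^ 2 := by ring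
        _ ≤ _ := mul_le_mul_of_nonneg_right h3 (by positivity)
    rw [abs_le] at hkey
    have hT : S.iso (spanSpace y') (∑ i, c i • kfun S.H i) =
        ∑ i, c i • kfun (spanSpace y').H i := by
      simp only [map_sum, map_smul, CPSpace.iso_kfun]
    rw [hT]
  · refine (pow_le_pow_iff_left₀ (norm_nonneg _) (by positivity) two_ne_zero).1 ?_
    rw [mul_pow, Real.sq_sqrt (by linarith)]
    linarith
  · rw [← div_eq_inv_mul, le_div_iff₀ (Real.sqrt_pos.2 (by linarith))]
    refine (pow_le_pow_iff_left₀ (by positivity) (norm_nonneg _) two_ne_zero).1 ?_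
    rw [mul_pow, Real.sq_sqrt (by linarith)]
    linarith

/-! ### Openness of the quotient map -/

/-- A nearby class is represented by a configuration through the origin whose kernel is close to
that of `y`, up to rescaling. The constant depends only on `S` and `y`. -/
theorem exists_conf_close {S : CPSpace (d + 1)} {y : Conf d (d + 1)}
    (hS : (⟦S⟧ : Pick (d + 1)) = pickMk y) : ∃ C : ℝ, ∀ (ε : ℝ) (S' : CPSpace (d + 1)),
      rhoRK S S' < ε → ∃ z : Conf d (d + 1), z.1 0 = 0 ∧ (⟦S'⟧ : Pick (d + 1)) = pickMk z ∧
        ∃ f : Fin (d + 1) → ℂ, ∀ i j, ‖daKer (confPt y i) (confPt y j) -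
          conj (f i) * f j * daKer (confPt z i) (confPt z j)‖ ≤ |1 - Real.exp (-2 * ε)| * C := by
  obtain ⟨ψ, g, hg, hgy⟩ := (CPSpace.equiv_iff _ _).1 (Quotient.exact hS)
  refine ⟨∑ i, ∑ j, ‖(conj (g i) * g j)⁻¹‖ * (‖kfun S.H i‖ + ‖kfun S.H j‖) ^ 2,
    fun ε S' hε => ?_⟩
  obtain ⟨φ, f, hf⟩ := exists_gram_close hε
  obtain ⟨z₁, hz₁⟩ := S'.exists_conf
  obtain ⟨φ', f', hf', hz₁'⟩ := (CPSpace.equiv_iff _ _).1 (Quotient.exact hz₁)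
  -- The reordering that undoes the three bijections of points.
  set z₂ : Conf d (d + 1) := (ψ * φ⁻¹ * φ'⁻¹) • z₁ with hz₂
  have hperm : ∀ i, confPt z₂ (ψ i) = confPt z₁ (φ' (φ i)) := fun i => by
    rw [hz₂, confPt_perm]
    simp
  set a := confPt z₂ 0
  refine ⟨mob a • z₂, ?_, ?_, fun i => (g (ψ.symm i))⁻¹ * f (ψ.symm i) * f' (φ (ψ.symm i)) *
    autWeight (mob a) (confPt z₂ i), fun i j => ?_⟩
  · exact congrArg Subtype.val (mob_smul_self a)
  · rw [pickMk_smul, hz₂, pickMk_perm, hz₁]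
  · obtain ⟨i, rfl⟩ := ψ.surjective i
    obtain ⟨j, rfl⟩ := ψ.surjective j
    simp only [Equiv.symm_apply_apply, confPt_smul]
    have h1 := hf i j
    rw [hz₁', hgy, spanSpace_gram, spanSpace_gram, ← hperm, ← hperm, daKer_smul (mob a) (confPt z₂ (ψ i))] at h1
    have hgne : conj (g i) * g j ≠ 0 := mul_ne_zero ((map_ne_zero _).2 (hg i)) (hg j)
    have h2 : daKer (confPt y (ψ i)) (confPt y (ψ j)) -
        conj ((g i)⁻¹ * f i * f' (φ i) * autWeight (mob a) (confPt z₂ (ψ i))) *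
          ((g j)⁻¹ * f j * f' (φ j) * autWeight (mob a) (confPt z₂ (ψ j))) *
            daKer (mob a • confPt z₂ (ψ i)) (mob a • confPt z₂ (ψ j)) =
        (conj (g i) * g j)⁻¹ * (conj (g i) * g j * daKer (confPt y (ψ i)) (confPt y (ψ j)) -
          conj (f i) * f j * (conj (f' (φ i)) * f' (φ j) *
            (conj (autWeight (mob a) (confPt z₂ (ψ i))) * autWeight (mob a) (confPt z₂ (ψ j)) *
              daKer (mob a • confPt z₂ (ψ i)) (mob a • confPt z₂ (ψ j))))) := by
      rw [mul_sub, inv_mul_cancel_left₀ hgne]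
      simp only [map_mul, map_inv₀, mul_inv]
      ring
    rw [h2, norm_mul]
    refine (mul_le_mul_of_nonneg_left h1 (norm_nonneg (conj (g i) * g j)⁻¹)).trans ?_
    rw [mul_left_comm]
    refine mul_le_mul (le_abs_self _) ?_ (mul_nonneg (norm_nonneg _) (sq_nonneg _)) (abs_nonneg _)
    have hF : ∀ i j, 0 ≤ ‖(conj (g i) * g j)⁻¹‖ * (‖kfun S.H i‖ + ‖kfun S.H j‖) ^ 2 :=
      fun i j => mul_nonneg (norm_nonneg _) (sq_nonneg _)
    exact (Finset.single_le_sum (fun j _ => hF i j) (Finset.mem_univ j)).trans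
      (Finset.single_le_sum (f := fun i : Fin (d + 1) => ∑ j : Fin (d + 1),
        ‖(conj (g i) * g j)⁻¹‖ * (‖kfun S.H i‖ + ‖kfun S.H j‖) ^ 2)
          (fun i _ => Finset.sum_nonneg fun j _ => hF i j) (Finset.mem_univ i))

/-- The normalization at the origin forces the rescalings to be asymptotically trivial, so the inner
products converge. By compactness of the closed ball a subsequence of the points converges, and its
limit has the Gram matrix of `y`. -/
theorem exists_tendsto_unitary {y : Conf d (d + 1)} (h0 : y.1 0 = 0) {z : ℕ → Conf d (d + 1)}
    (hz0 : ∀ m, (z m).1 0 = 0) {f : ℕ → Fin (d + 1) → ℂ}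
    (hf : ∀ i j, Filter.Tendsto (fun m => conj (f m i) * f m j *
      daKer (confPt (z m) i) (confPt (z m) j)) Filter.atTop
        (𝓝 (daKer (confPt y i) (confPt y j)))) :
    ∃ (κ : ℕ → ℕ) (V : Cn d ≃ₗᵢ[ℂ] Cn d), StrictMono κ ∧
      Filter.Tendsto (fun m => linAut V • z (κ m)) Filter.atTop (𝓝 y) := by
  have hone : ∀ (x : Conf d (d + 1)) (_ : x.1 0 = 0) j, daKer (confPt x 0) (confPt x j) = 1 := by
    intro x hx j
    rw [daKer]
    change 1 / (1 - inner ℂ (x.1 j) (x.1 0)) = 1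
    rw [hx, inner_zero_right]
    simp
  have hf0 : ∀ j, Filter.Tendsto (fun m => conj (f m 0) * f m j) Filter.atTop (𝓝 1) := fun j => by
    have := hf 0 j
    rw [hone y h0 j] at this
    exact this.congr fun m => by rw [hone _ (hz0 m), mul_one]
  -- The unknown phase of `f m 0` cancels in this product of three quantities that tend to 1.
  have hff : ∀ i j, Filter.Tendsto (fun m => conj (f m i) * f m j) Filter.atTop (𝓝 1) := by
    intro i j
    have h1 : Filter.Tendsto (fun m => conj (conj (f m 0) * f m i) * (conj (f m 0) * f m j) *
        (conj (f m 0) * f m 0)⁻¹) Filter.atTop (𝓝 (conj 1 * 1 * 1⁻¹)) :=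
      (((Complex.continuous_conj.tendsto 1).comp (hf0 i)).mul (hf0 j)).mul
        ((hf0 0).inv₀ one_ne_zero)
    simp only [map_one, mul_one, inv_one] at h1
    refine h1.congr' ?_
    filter_upwards [(hf0 0).eventually_ne one_ne_zero] with m hm
    have h2 := left_ne_zero_of_mul hm
    have h3 := right_ne_zero_of_mul hm
    simp only [map_mul, Complex.conj_conj]
    field_simp
  have hK : ∀ i j, Filter.Tendsto (fun m => inner ℂ ((z m).1 j) ((z m).1 i)) Filter.atTop
      (𝓝 (inner ℂ (y.1 j) (y.1 i))) := by
    intro i j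
    have h1 := (hff i j).mul ((hf i j).inv₀ (daKer_ne_zero _ _))
    have h2 : Filter.Tendsto (fun m => 1 - (daKer (confPt (z m) i) (confPt (z m) j))⁻¹) Filter.atTop
        (𝓝 (1 - 1 * (daKer (confPt y i) (confPt y j))⁻¹)) := by
      refine tendsto_const_nhds.sub (h1.congr' ?_)
      filter_upwards [(hff i j).eventually_ne one_ne_zero] with m hm
      rw [mul_inv, mul_inv_cancel_left₀ hm]
    have h3 : ∀ x : Conf d (d + 1), 1 - (daKer (confPt x i) (confPt x j))⁻¹ =
        inner ℂ (x.1 j) (x.1 i) := fun x => by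
      rw [daKer, one_div, inv_inv, sub_sub_cancel]
      rfl
    rw [one_mul] at h2
    simpa only [h3] using h2
  have : ProperSpace (Cn d) := FiniteDimensional.proper_rclike ℂ _
  obtain ⟨v, -, κ, hκ, hv⟩ := (isCompact_univ_pi (s := fun _ : Fin (d + 1) =>
    Metric.closedBall (0 : Cn d) 1) fun _ => isCompact_closedBall 0 1).tendsto_subseq
      (x := fun m => (z m).1) fun m i _ => by
        rw [mem_closedBall_zero_iff]
        exact (Conf.norm_lt (z m) i).le
  have hvi : ∀ i, Filter.Tendsto (fun m => (z (κ m)).1 i) Filter.atTop (𝓝 (v i)) := fun i =>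
    ((continuous_apply i).tendsto v).comp hv
  obtain ⟨V, hV⟩ := exists_unitary v y.1 fun i j => tendsto_nhds_unique
    ((hvi i).inner (hvi j)) ((hK j i).comp hκ.tendsto_atTop)
  refine ⟨κ, V, hκ, tendsto_subtype_rng.2 (tendsto_pi_nhds.2 fun i => ?_)⟩
  rw [← hV]
  exact (V.continuous.tendsto (v i)).comp (hvi i)

/-- Were classes arbitrarily close to that of `y` missed by `U`, representatives through the origin
would accumulate, up to a unitary map, at `y` itself. A Möbius map reduces to the case that `y`
passes through the origin. -/
theorem isOpenMap_pickMk : IsOpenMap (pickMk : Conf d (d + 1) → Pick (d + 1)) := by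
  have key : ∀ (U : Set (Conf d (d + 1))) (_ : IsOpen U) (y : Conf d (d + 1)) (_ : y ∈ U)
      (_ : y.1 0 = 0) (S : CPSpace (d + 1)), (⟦S⟧ : Pick (d + 1)) = pickMk y →
      ∃ ε > 0, ∀ S' : CPSpace (d + 1), rhoRK S S' < ε → (⟦S'⟧ : Pick (d + 1)) ∈ pickMk '' U := by
    intro U hU y hy h0 S hS
    by_contra! hcon
    obtain ⟨C, hC⟩ := exists_conf_close hS
    choose S' hS' hnot using fun m : ℕ => hcon (1 / ((m : ℝ) + 1)) (by positivity)
    choose z hz0 hz f hf using fun m => hC _ (S' m) (hS' m)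
    obtain ⟨κ, V, -, hV⟩ := exists_tendsto_unitary h0 hz0 (f := f) fun i j => by
      rw [tendsto_iff_norm_sub_tendsto_zero]
      have h1 : Filter.Tendsto (fun m : ℕ => |1 - Real.exp (-2 * (1 / ((m : ℝ) + 1)))| * C)
          Filter.atTop (𝓝 (|1 - Real.exp (-2 * 0)| * C)) :=
        ((tendsto_const_nhds.sub ((Real.continuous_exp.tendsto _).comp
          (tendsto_one_div_add_atTop_nhds_zero_nat.const_mul (-2)))).abs).mul_const C
      simp only [mul_zero, Real.exp_zero, sub_self, abs_zero, zero_mul] at h1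
      exact squeeze_zero (fun _ => norm_nonneg _) (fun m => by
        rw [norm_sub_rev]
        exact hf m i j) h1
    obtain ⟨m, hm⟩ := (hV.eventually (hU.mem_nhds hy)).exists
    exact hnot (κ m) ⟨_, hm, by rw [pickMk_smul, hz]⟩
  intro U hU
  rw [isOpen_pick_iff]
  rintro S ⟨y, hy, hyS⟩
  obtain ⟨ε, hε, h⟩ := key ((fun x => mob (confPt y 0) • x) '' U)
    ((Homeomorph.smul (mob (confPt y 0))).isOpenMap U hU) (mob (confPt y 0) • y) ⟨y, hy, rfl⟩
    (congrArg Subtype.val (mob_smul_self (confPt y 0))) S (by rw [pickMk_smul, hyS])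
  refine ⟨ε, hε, fun S' hS' => ?_⟩
  obtain ⟨_, ⟨x, hx, rfl⟩, hxS⟩ := h S' hS'
  exact ⟨x, hx, by rw [← hxS, pickMk_smul]⟩

end
end PickSpace

namespace PickSpace
noncomputable section
open scoped Manifold ContDiff Topology ComplexConjugate
open InnerProductSpace

variable {d : ℕ}

/-! ### The image of the regular points -/

theorem mem_pickReg_iff (hd : d ≠ 1) {P : Pick (d + 1)} :
    P ∈ PickReg (d + 1) ↔ ∃ y : Conf d (d + 1), IsFree y ∧ pickMk y = P := by
  constructor
  · rintro ⟨x, hx, hP⟩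
    obtain ⟨y, rfl⟩ := X0.mk_surjective (d := d) x
    exact ⟨y, (mk_mem_X0reg_iff hd y).1 hx, (isClassOf_mk_iff.1 hP).symm⟩
  · rintro ⟨y, hy, rfl⟩
    exact ⟨X0.mk y, (mk_mem_X0reg_iff hd y).2 hy, isClassOf_mk_iff.2 rfl⟩

theorem pickReg_eq_image (hd : d ≠ 1) :
    PickReg (d + 1) = pickMk '' {y : Conf d (d + 1) | IsFree y} :=
  Set.ext fun _ => mem_pickReg_iff hd

theorem isOpen_pickReg (hd : d ≠ 1) : IsOpen (PickReg (d + 1)) := by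
  rw [pickReg_eq_image hd]
  exact isOpenMap_pickMk _ isOpen_isFree

theorem dense_pickReg (hd : d ≠ 1) : Dense (PickReg (d + 1)) := by
  rw [pickReg_eq_image hd]
  exact pickMk_surjective.denseRange.dense_image continuous_pickMk (dense_isFree hd)

theorem pickMk_eq_pickMk_iff_normalForm {y y' : Conf d (d + 1)} (hy : IsGeneral y.1) :
    pickMk y = pickMk y' ↔ ∃ σ : Equiv.Perm (Fin (d + 1)), normalForm (σ • y) = normalForm y' := by
  rw [pickMk_eq_pickMk_iff]
  constructor
  · rintro ⟨φ, σ, rfl⟩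
    exact ⟨σ, (normalForm_smul φ (isGeneral_perm σ hy)).symm⟩
  · rintro ⟨σ, h⟩
    exact ⟨_, σ, exists_smul_of_normalForm_eq h⟩

/-- The class of a free configuration. -/
def freeMk (hd : d ≠ 1) (y : {y : Conf d (d + 1) // IsFree y}) : PickReg (d + 1) :=
  ⟨pickMk y.1, (mem_pickReg_iff hd).2 ⟨y.1, y.2, rfl⟩⟩

theorem isOpenQuotientMap_freeMk (hd : d ≠ 1) : IsOpenQuotientMap (freeMk hd) where
  surjective := fun ⟨P, hP⟩ => by
    obtain ⟨y, hy, rfl⟩ := (mem_pickReg_iff hd).1 hP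
    exact ⟨⟨y, hy⟩, rfl⟩
  continuous := (continuous_pickMk.comp continuous_subtype_val).subtype_mk _
  isOpenMap := by
    intro U hU
    rw [(isOpen_pickReg hd).isOpenEmbedding_subtypeVal.isOpen_iff_image_isOpen]
    have h1 := isOpenMap_pickMk _ (isOpen_isFree.isOpenEmbedding_subtypeVal.isOpenMap U hU)
    rw [Set.image_image] at h1 ⊢
    exact h1

theorem continuous_normalForm_perm (σ : Equiv.Perm (Fin (d + 1))) :
    Continuous fun y : {y : Conf d (d + 1) // IsFree y} => normalForm (σ • y.1) := by
  rw [continuous_iff_continuousAt]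
  intro y
  exact ContinuousAt.comp (g := normalForm) (f := fun y : {y : Conf d (d + 1) // IsFree y} => σ • y.1)
    (continuousAt_normalForm (isGeneral_perm σ y.2.1))
    ((continuous_const_smul σ).comp continuous_subtype_val).continuousAt

/-- The equivalence relation is closed: it is a finite union, over reorderings, of coincidence sets
of continuous normal forms. -/
theorem t2Space_pickReg (hd : d ≠ 1) : T2Space (PickReg (d + 1)) := by
  rw [t2Space_iff_of_isOpenQuotientMap (isOpenQuotientMap_freeMk hd)]
  have h1 : {q : {y : Conf d (d + 1) // IsFree y} × {y : Conf d (d + 1) // IsFree y} |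
      freeMk hd q.1 = freeMk hd q.2} = ⋃ σ : Equiv.Perm (Fin (d + 1)),
        {q | normalForm (σ • q.1.1) = normalForm ((1 : Equiv.Perm (Fin (d + 1))) • q.2.1)} := by
    ext q
    rw [Set.mem_iUnion]
    exact Subtype.ext_iff.trans (pickMk_eq_pickMk_iff_normalForm q.1.2.1)
  rw [h1]
  exact isClosed_iUnion_of_finite fun σ =>
    isClosed_eq ((continuous_normalForm_perm σ).comp continuous_fst)
      ((continuous_normalForm_perm 1).comp continuous_snd)

theorem secondCountableTopology_pickReg (hd : d ≠ 1) :
    SecondCountableTopology (PickReg (d + 1)) :=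
  (isOpenQuotientMap_freeMk hd).isQuotientMap.secondCountableTopology
    (isOpenQuotientMap_freeMk hd).isOpenMap

end
end PickSpace

/-! ### Smooth structures on quotients by local homeomorphisms with smooth deck germs. -/

namespace PickSpace
noncomputable section
open scoped Manifold ContDiff Topology ComplexConjugate

/-! ### Manifold structures on quotients -/

section LocalHomeomorph

variable {E : Type*} [NormedAddCommGroup E] [NormedSpace ℝ E] {M M' : Type*} [TopologicalSpace M]
  [TopologicalSpace M'] [ChartedSpace E M]

/-- The fibres of `f` are permuted by germs of smooth maps over the base. -/
def HasSmoothDecks (E : Type*) [NormedAddCommGroup E] [NormedSpace ℝ E] {M M' : Type*}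
    [TopologicalSpace M] [ChartedSpace E M] (f : M → M') : Prop :=
  ∀ x y, f x = f y → ∃ δ : M → M, ContMDiffAt 𝓘(ℝ, E) 𝓘(ℝ, E) ∞ δ x ∧ δ x = y ∧
    ∀ᶠ z in 𝓝 x, f (δ z) = f z

/-- The charts of `M'` are obtained from those of `M` by local inverses of `f`. -/
def IsQuotientAtlas {f : M → M'} (hf : IsLocalHomeomorph f) [ChartedSpace E M'] : Prop :=
  ∀ e ∈ atlas E M', ∃ x, e = (hf.localInverseAt x).trans (chartAt E x)

theorem localInverseAt_apply_of_mem {f : M → M'} (hf : IsLocalHomeomorph f) {x z : M}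
    (hz : z ∈ (hf.localInverseAt x).target) : hf.localInverseAt x (f z) = z := by
  simpa using (hf.localInverseAt x).right_inv hz

/-- Locally this composite is a deck germ: both lift `f` and agree at one point. -/
theorem contMDiffAt_localInverseAt_comp {f : M → M'} (hf : IsLocalHomeomorph f)
    (hδ : HasSmoothDecks E f) {x z : M} (hz : f z ∈ (hf.localInverseAt x).source) :
    ContMDiffAt 𝓘(ℝ, E) 𝓘(ℝ, E) ∞ (fun z => hf.localInverseAt x (f z)) z := by
  obtain ⟨δ, h1, h2, h3⟩ := hδ z (hf.localInverseAt x (f z)) (hf.apply_localInverseAt_of_mem hz).symm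
  refine h1.congr_of_eventuallyEq ?_
  have h4 : (hf.localInverseAt x).target ∈ 𝓝 (δ z) := by
    rw [h2]
    exact (hf.localInverseAt x).open_target.mem_nhds ((hf.localInverseAt x).map_source hz)
  filter_upwards [h3, h1.continuousAt.preimage_mem_nhds h4] with w hw hw'
  rw [← hw, localInverseAt_apply_of_mem hf hw']

variable {f : M → M'} {hf : IsLocalHomeomorph f} [IsManifold 𝓘(ℝ, E) ∞ M]

theorem contMDiffAt_chart_comp_of_hasSmoothDecks (hδ : HasSmoothDecks E f) {x z : M}
    (hz : f z ∈ ((hf.localInverseAt x).trans (chartAt E x)).source) :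
    ContMDiffAt 𝓘(ℝ, E) 𝓘(ℝ, E) ∞
      (fun z => ((hf.localInverseAt x).trans (chartAt E x)) (f z)) z := by
  rw [OpenPartialHomeomorph.trans_source] at hz
  exact ContMDiffAt.comp (g := chartAt E x) z
    ((contMDiffOn_chart (I := 𝓘(ℝ, E)) (H := E)).contMDiffAt
      ((chartAt E x).open_source.mem_nhds hz.2))
    (contMDiffAt_localInverseAt_comp hf hδ hz.1)

variable [ChartedSpace E M']

theorem IsQuotientAtlas.isManifold (hA : IsQuotientAtlas (E := E) hf) (hδ : HasSmoothDecks E f) :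
    IsManifold 𝓘(ℝ, E) ∞ M' := by
  refine isManifold_of_contDiffOn 𝓘(ℝ, E) ∞ M' ?_
  intro e e' he he'
  obtain ⟨x, rfl⟩ := hA e he
  obtain ⟨x', rfl⟩ := hA e' he'
  intro u hu
  refine ContDiffAt.contDiffWithinAt ?_
  simp only [mfld_simps] at hu
  rw [← contMDiffAt_iff_contDiffAt]
  have h1 : ContMDiffAt 𝓘(ℝ, E) 𝓘(ℝ, E) ∞ (chartAt E x).symm u :=
    (contMDiffOn_chart_symm (I := 𝓘(ℝ, E)) (H := E)).contMDiffAt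
      ((chartAt E x).open_target.mem_nhds hu.1.1)
  refine (ContMDiffAt.comp (x := u) (f := (chartAt E x).symm)
    (g := fun z => ((hf.localInverseAt x').trans (chartAt E x')) (f z))
    (contMDiffAt_chart_comp_of_hasSmoothDecks hδ (by
      rw [OpenPartialHomeomorph.trans_source]
      simpa using hu.2)) h1).congr_of_eventuallyEq (.of_forall fun w => ?_)
  simp only [mfld_simps, hf.localInverseAt_symm]

theorem IsQuotientAtlas.contMDiff (hA : IsQuotientAtlas (E := E) hf) (hδ : HasSmoothDecks E f) :
    ContMDiff 𝓘(ℝ, E) 𝓘(ℝ, E) ∞ f := by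
  intro x
  rw [contMDiffAt_iff_target]
  refine ⟨hf.continuous.continuousAt, ?_⟩
  obtain ⟨x', hx'⟩ := hA _ (chart_mem_atlas E (f x))
  have hz := mem_chart_source E (f x)
  rw [hx'] at hz
  have h := contMDiffAt_chart_comp_of_hasSmoothDecks hδ hz
  simpa only [mfld_simps, Function.comp_def, hx'] using h

/-- The local inverse underlying the chart may pass through another point of the fibre; a deck germ
moves it to the prescribed one. -/
theorem IsQuotientAtlas.exists_section (hA : IsQuotientAtlas (E := E) hf)
    (hδ : HasSmoothDecks E f) (x : M) : ∃ s : M' → M,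
      ContMDiffAt 𝓘(ℝ, E) 𝓘(ℝ, E) ∞ s (f x) ∧ s (f x) = x ∧ ∀ᶠ q in 𝓝 (f x), f (s q) = q := by
  have := hA.isManifold hδ
  obtain ⟨x', hx'⟩ := hA _ (chart_mem_atlas E (f x))
  have hz := mem_chart_source E (f x)
  have hchart : ContMDiffAt 𝓘(ℝ, E) 𝓘(ℝ, E) ∞ (chartAt E (f x)) (f x) :=
    (contMDiffOn_chart (I := 𝓘(ℝ, E)) (H := E)).contMDiffAt
      ((chartAt E (f x)).open_source.mem_nhds hz)
  rw [hx'] at hz hchart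
  rw [OpenPartialHomeomorph.trans_source] at hz
  have hsymm : ContMDiffAt 𝓘(ℝ, E) 𝓘(ℝ, E) ∞ (chartAt E x').symm
      (chartAt E x' (hf.localInverseAt x' (f x))) :=
    (contMDiffOn_chart_symm (I := 𝓘(ℝ, E)) (H := E)).contMDiffAt
      ((chartAt E x').open_target.mem_nhds ((chartAt E x').map_source hz.2))
  have hsrc : ∀ᶠ q in 𝓝 (f x), q ∈ (hf.localInverseAt x').source ∧
      hf.localInverseAt x' q ∈ (chartAt E x').source :=
    ((hf.localInverseAt x').trans (chartAt E x')).open_source.mem_nhds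
      (by rw [OpenPartialHomeomorph.trans_source]; exact hz)
  have hℓ : ContMDiffAt 𝓘(ℝ, E) 𝓘(ℝ, E) ∞ (hf.localInverseAt x') (f x) := by
    refine (ContMDiffAt.comp (f x) hsymm hchart).congr_of_eventuallyEq ?_
    filter_upwards [hsrc] with q hq
    exact ((chartAt E x').left_inv hq.2).symm
  obtain ⟨δ, h1, h2, h3⟩ := hδ (hf.localInverseAt x' (f x)) x (hf.apply_localInverseAt_of_mem hz.1)
  refine ⟨fun q => δ (hf.localInverseAt x' q), ContMDiffAt.comp (f x) h1 hℓ, h2, ?_⟩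
  filter_upwards [hsrc, hℓ.continuousAt.eventually h3] with q hq hq'
  rw [hq', hf.apply_localInverseAt_of_mem hq.1]

theorem IsQuotientAtlas.contMDiffAt_of_comp {E' N : Type*} [NormedAddCommGroup E']
    [NormedSpace ℝ E'] [TopologicalSpace N] [ChartedSpace E' N] (hA : IsQuotientAtlas (E := E) hf)
    (hδ : HasSmoothDecks E f) {h : M' → N} {x : M}
    (hx : ContMDiffAt 𝓘(ℝ, E) 𝓘(ℝ, E') ∞ (fun z => h (f z)) x) :
    ContMDiffAt 𝓘(ℝ, E) 𝓘(ℝ, E') ∞ h (f x) := by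
  obtain ⟨s, hs, hsx, hfs⟩ := hA.exists_section hδ x
  have h1 : ContMDiffAt 𝓘(ℝ, E) 𝓘(ℝ, E') ∞ (fun z => h (f z)) (s (f x)) := by rwa [hsx]
  refine (ContMDiffAt.comp (f x) h1 hs).congr_of_eventuallyEq ?_
  filter_upwards [hfs] with q hq
  exact (congrArg h hq).symm

end LocalHomeomorph

/-! ### The manifold of unordered configurations -/

variable {d : ℕ}

theorem X0.isLocalHomeomorph_mk {n : ℕ} : IsLocalHomeomorph (X0.mk : Conf d n → X0 d n) :=
  isQuotientCoveringMap_quotientMk_of_properlyDiscontinuousSMul.isCoveringMap.isLocalHomeomorph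

theorem X0.isQuotientAtlas {n : ℕ} :
    IsQuotientAtlas (E := Fin n → Cn d) (X0.isLocalHomeomorph_mk : IsLocalHomeomorph
      (X0.mk : Conf d n → X0 d n)) := by
  rintro e ⟨q, rfl⟩
  exact ⟨_, rfl⟩

theorem contMDiff_perm {n : ℕ} (σ : Equiv.Perm (Fin n)) :
    ContMDiff 𝓘(ℝ, Fin n → Cn d) 𝓘(ℝ, Fin n → Cn d) ∞ fun y : Conf d n => σ • y := by
  intro y
  rw [← ContMDiffAt.subtypeVal_comp_iff]
  have h : ContDiff ℝ ∞ fun x : Fin n → Cn d => fun i => x (σ⁻¹ i) := by fun_prop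
  exact (h.contMDiff.comp contMDiff_subtype_val).contMDiffAt

theorem X0.hasSmoothDecks {n : ℕ} :
    HasSmoothDecks (Fin n → Cn d) (X0.mk : Conf d n → X0 d n) := by
  intro x y hxy
  obtain ⟨σ, rfl⟩ := X0.mk_eq_mk_iff.1 hxy.symm
  exact ⟨fun y => σ • y, (contMDiff_perm σ).contMDiffAt, rfl, .of_forall fun z => X0.mk_perm σ z⟩

instance {n : ℕ} : IsManifold 𝓘(ℝ, Fin n → Cn d) ∞ (X0 d n) :=
  X0.isQuotientAtlas.isManifold X0.hasSmoothDecks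

theorem isManifold_X0reg {n : ℕ} : IsManifold 𝓘(ℝ, Fin n → Cn d) ∞ (X0reg d n) := inferInstance

end
end PickSpace

namespace PickSpace
noncomputable section
open scoped Manifold ContDiff Topology ComplexConjugate

variable {d : ℕ}

/-! ### The slice of free configurations in normal form -/

/-- The real vector space of triangular arrays with real diagonal. -/
def triSpace (d : ℕ) : Submodule ℝ (Fin (d + 1) → Cn d) where
  carrier := {x | x 0 = 0 ∧ (∀ i j : Fin d, i < j → x i.succ j = 0) ∧ ∀ i : Fin d, (x i.succ i).im = 0}
  add_mem' := by
    rintro x y ⟨hx0, hx, hx'⟩ ⟨hy0, hy, hy'⟩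
    exact ⟨by simp [hx0, hy0], fun i j hij => by simp [hx i j hij, hy i j hij],
      fun i => by simp [hx', hy']⟩
  zero_mem' := ⟨rfl, fun _ _ _ => rfl, fun _ => rfl⟩
  smul_mem' := by
    rintro c x ⟨hx0, hx, hx'⟩
    exact ⟨by simp [hx0], fun i j hij => by simp [hx i j hij], fun i => by simp [hx']⟩

theorem mem_slice_iff {x : Fin (d + 1) → Cn d} :
    x ∈ slice d ↔ x ∈ triSpace d ∧ ∀ i : Fin d, 0 < (x i.succ i).re := by
  constructor
  · rintro ⟨h0, h1, h2⟩
    refine ⟨⟨h0, h1, fun i => ?_⟩, fun i => ?_⟩ <;> obtain ⟨r, hr, hr'⟩ := h2 i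
    · rw [hr', Complex.ofReal_im]
    · rw [hr', Complex.ofReal_re]
      exact hr
  · rintro ⟨⟨h0, h1, h2⟩, h3⟩
    exact ⟨h0, h1, fun i => ⟨_, h3 i, Complex.ext rfl (h2 i)⟩⟩

/-- The model space of the slice. -/
abbrev SliceModel (d : ℕ) : Type := EuclideanSpace ℝ (Fin (Module.finrank ℝ (triSpace d)))

/-- The coordinates of the slice. -/
def sliceIncl (d : ℕ) : SliceModel d →L[ℝ] (Fin (d + 1) → Cn d) :=
  (triSpace d).subtypeL.comp (toEuclidean (E := triSpace d)).symm.toContinuousLinearMap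

theorem sliceIncl_mem (t : SliceModel d) : sliceIncl d t ∈ triSpace d :=
  ((toEuclidean (E := triSpace d)).symm t).2

theorem sliceIncl_injective : Function.Injective (sliceIncl d) :=
  Subtype.val_injective.comp (toEuclidean (E := triSpace d)).symm.injective

theorem exists_sliceProj (d : ℕ) : ∃ P : (Fin (d + 1) → Cn d) →L[ℝ] SliceModel d,
    ∀ t, P (sliceIncl d t) = t := by
  obtain ⟨g, hg⟩ := (sliceIncl d).toLinearMap.exists_leftInverse_of_injective
    (LinearMap.ker_eq_bot.2 sliceIncl_injective)
  exact ⟨LinearMap.toContinuousLinearMap g, fun t => LinearMap.congr_fun hg t⟩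

/-- A projection to the model space of the slice. -/
def sliceProj (d : ℕ) : (Fin (d + 1) → Cn d) →L[ℝ] SliceModel d := (exists_sliceProj d).choose

theorem sliceProj_sliceIncl (t : SliceModel d) : sliceProj d (sliceIncl d t) = t :=
  (exists_sliceProj d).choose_spec t

theorem sliceIncl_sliceProj {x : Fin (d + 1) → Cn d} (hx : x ∈ triSpace d) :
    sliceIncl d (sliceProj d x) = x := by
  have h : sliceIncl d (toEuclidean (E := triSpace d) ⟨x, hx⟩) = x := by
    change ((toEuclidean (E := triSpace d)).symm (toEuclidean (E := triSpace d) ⟨x, hx⟩)).1 = x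
    rw [ContinuousLinearEquiv.symm_apply_apply]
  conv_lhs => rw [← h, sliceProj_sliceIncl]
  exact h

/-- The coordinates of the free configurations in normal form. -/
def freeSlice (d : ℕ) : TopologicalSpace.Opens (SliceModel d) :=
  ⟨{t | sliceIncl d t ∈ Subtype.val '' {y : Conf d (d + 1) | IsFree y} ∧
    ∀ i : Fin d, 0 < (sliceIncl d t i.succ i).re}, by
    have h1 : IsOpen {t : SliceModel d | ∀ i : Fin d, 0 < (sliceIncl d t i.succ i).re} := by
      simp only [Set.ofPred_forall]
      refine isOpen_iInter_of_finite fun i => ?_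
      have h2 : Continuous fun x : Fin (d + 1) → Cn d => (x i.succ i).re := by fun_prop
      exact isOpen_lt continuous_const (h2.comp (sliceIncl d).continuous)
    exact (((Conf d (d + 1)).isOpen.isOpenMap_subtype_val _ isOpen_isFree).preimage
      (sliceIncl d).continuous).inter h1⟩

/-- The configuration with given coordinates. -/
def sliceConf (t : freeSlice d) : Conf d (d + 1) :=
  ⟨sliceIncl d t, by
    obtain ⟨y, -, hy⟩ := t.2.1
    exact hy ▸ y.2⟩

theorem isFree_sliceConf (t : freeSlice d) : IsFree (sliceConf t) := by
  obtain ⟨y, hy, hyt⟩ := t.2.1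
  rwa [show sliceConf t = y from Subtype.ext hyt.symm]

theorem sliceConf_mem_slice (t : freeSlice d) : (sliceConf t).1 ∈ slice d :=
  mem_slice_iff.2 ⟨sliceIncl_mem _, t.2.2⟩

theorem normalForm_sliceConf (t : freeSlice d) : normalForm (sliceConf t) = sliceConf t :=
  normalForm_of_mem_slice (sliceConf_mem_slice t)

theorem frame_sliceConf (t : freeSlice d) : frame (sliceConf t) = 1 :=
  frame_eq_one_of_mem_slice (sliceConf_mem_slice t)

theorem sliceConf_injective : Function.Injective (sliceConf : freeSlice d → Conf d (d + 1)) :=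
  fun t t' h => Subtype.ext (sliceIncl_injective
    (show (sliceConf t).1 = (sliceConf t').1 from congrArg Subtype.val h))

theorem contMDiff_sliceConf : ContMDiff 𝓘(ℝ, SliceModel d) 𝓘(ℝ, Fin (d + 1) → Cn d) ∞
    (sliceConf : freeSlice d → Conf d (d + 1)) := by
  intro t
  rw [← ContMDiffAt.subtypeVal_comp_iff]
  exact ((sliceIncl d).contDiff.contMDiff.comp contMDiff_subtype_val).contMDiffAt

/-- The coordinates of the normal form of a free configuration. -/
def toSlice (y : Conf d (d + 1)) (hy : IsFree y) : freeSlice d :=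
  ⟨sliceProj d (normalForm y).1, by
    have h := mem_slice_iff.1 (normalForm_mem_slice hy.1)
    refine ⟨?_, fun i => ?_⟩
    · rw [sliceIncl_sliceProj h.1]
      exact ⟨_, isFree_normalForm hy, rfl⟩
    · rw [sliceIncl_sliceProj h.1]
      exact h.2 i⟩

theorem sliceConf_toSlice (y : Conf d (d + 1)) (hy : IsFree y) :
    sliceConf (toSlice y hy) = normalForm y :=
  Subtype.ext (sliceIncl_sliceProj (mem_slice_iff.1 (normalForm_mem_slice hy.1)).1)

theorem contMDiffAt_sliceProj_normalForm {y : Conf d (d + 1)} (hy : IsGeneral y.1) :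
    ContMDiffAt 𝓘(ℝ, Fin (d + 1) → Cn d) 𝓘(ℝ, SliceModel d) ∞
      (fun y : Conf d (d + 1) => sliceProj d (normalForm y).1) y := by
  have h1 : ContMDiffAt 𝓘(ℝ, Fin (d + 1) → Cn d) 𝓘(ℝ, SliceModel d) ∞
      (fun x : Fin (d + 1) → Cn d => sliceProj d (normalFun x)) y.1 :=
    ((sliceProj d).contDiff.contDiffAt.comp (f := fun x : Fin (d + 1) → Cn d => normalFun x) y.1
      (contDiffAt_normalFun (Conf.norm_lt y) hy)).contMDiffAt
  have h2 := ContMDiffAt.comp (f := (Subtype.val : Conf d (d + 1) → Fin (d + 1) → Cn d)) y h1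
    contMDiff_subtype_val.contMDiffAt
  refine h2.congr_of_eventuallyEq ?_
  filter_upwards [isOpen_isGeneral.mem_nhds hy] with y' hy'
  rw [coe_normalForm hy']
  rfl

/-- The class of a free configuration in normal form. -/
def sliceMk (hd : d ≠ 1) (t : freeSlice d) : PickReg (d + 1) :=
  freeMk hd ⟨sliceConf t, isFree_sliceConf t⟩

variable {hd : d ≠ 1}

theorem sliceMk_eq_freeMk_iff {t : freeSlice d} {y : {y : Conf d (d + 1) // IsFree y}} :
    sliceMk hd t = freeMk hd y ↔
      ∃ σ : Equiv.Perm (Fin (d + 1)), normalForm (σ • y.1) = sliceConf t := by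
  rw [eq_comm, ← normalForm_sliceConf]
  exact Subtype.ext_iff.trans (pickMk_eq_pickMk_iff_normalForm y.2.1)

theorem sliceMk_toSlice (y : {y : Conf d (d + 1) // IsFree y}) :
    sliceMk hd (toSlice y.1 y.2) = freeMk hd y :=
  sliceMk_eq_freeMk_iff.2 ⟨1, by rw [one_smul, sliceConf_toSlice]⟩

/-- The action of a permutation in the coordinates of the slice. -/
def slicePerm (σ : Equiv.Perm (Fin (d + 1))) (t : freeSlice d) : freeSlice d :=
  toSlice (σ • sliceConf t) (isFree_perm σ (isFree_sliceConf t))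

theorem sliceConf_slicePerm (σ : Equiv.Perm (Fin (d + 1))) (t : freeSlice d) :
    sliceConf (slicePerm σ t) = normalForm (σ • sliceConf t) := sliceConf_toSlice _ _

theorem contMDiff_slicePerm (σ : Equiv.Perm (Fin (d + 1))) :
    ContMDiff 𝓘(ℝ, SliceModel d) 𝓘(ℝ, SliceModel d) ∞
      (slicePerm σ : freeSlice d → freeSlice d) := by
  intro t
  rw [← ContMDiffAt.subtypeVal_comp_iff]
  exact ContMDiffAt.comp (g := fun y : Conf d (d + 1) => sliceProj d (normalForm y).1) t
    (contMDiffAt_sliceProj_normalForm (isGeneral_perm σ (isFree_sliceConf t).1))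
    ((contMDiff_perm σ).comp contMDiff_sliceConf).contMDiffAt

/-- Together with `slicePerm_ne`, this presents `PickReg` as the quotient of the slice by a free
action of the symmetric group. -/
theorem sliceMk_eq_sliceMk_iff {t t' : freeSlice d} :
    sliceMk hd t = sliceMk hd t' ↔ ∃ σ, t' = slicePerm σ t := by
  rw [eq_comm]
  refine (sliceMk_eq_freeMk_iff (y := ⟨sliceConf t, isFree_sliceConf t⟩)).trans ?_
  refine exists_congr fun σ => ?_
  rw [← sliceConf_slicePerm, sliceConf_injective.eq_iff, eq_comm]

theorem slicePerm_one (t : freeSlice d) : slicePerm 1 t = t :=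
  sliceConf_injective (by rw [sliceConf_slicePerm, one_smul, normalForm_sliceConf])

theorem slicePerm_ne {σ : Equiv.Perm (Fin (d + 1))} (hσ : σ ≠ 1) (t : freeSlice d) :
    slicePerm σ t ≠ t := fun h => (isFree_sliceConf t).2 σ hσ (by
  rw [← sliceConf_slicePerm, h, normalForm_sliceConf])

theorem sliceMk_surjective : Function.Surjective (sliceMk hd) := fun b => by
  obtain ⟨y, rfl⟩ := (isOpenQuotientMap_freeMk hd).surjective b
  exact ⟨_, sliceMk_toSlice y⟩

theorem continuous_sliceMk : Continuous (sliceMk hd) :=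
  (isOpenQuotientMap_freeMk hd).continuous.comp (contMDiff_sliceConf.continuous.subtype_mk _)

theorem isOpenMap_sliceMk : IsOpenMap (sliceMk hd) := by
  intro W hW
  have h1 : sliceMk hd '' W = freeMk hd '' {y | toSlice y.1 y.2 ∈ W} := by
    ext b
    constructor
    · rintro ⟨t, ht, rfl⟩
      refine ⟨⟨sliceConf t, isFree_sliceConf t⟩, ?_, rfl⟩
      have : toSlice (sliceConf t) (isFree_sliceConf t) = t :=
        sliceConf_injective (by rw [sliceConf_toSlice, normalForm_sliceConf])
      rwa [Set.mem_ofPred_eq, this]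
    · rintro ⟨y, hy, rfl⟩
      exact ⟨_, hy, sliceMk_toSlice y⟩
  rw [h1]
  refine (isOpenQuotientMap_freeMk hd).isOpenMap _ (hW.preimage ?_)
  refine Continuous.subtype_mk ?_ _
  have h2 := continuous_normalForm_perm (d := d) 1
  simp only [one_smul] at h2
  exact (sliceProj d).continuous.comp (continuous_subtype_val.comp h2)

/-- The finitely many nontrivial permutations move `t₀`, so they move a small neighbourhood off
itself, and there the map is injective. -/
theorem isLocalHomeomorph_sliceMk (hd : d ≠ 1) : IsLocalHomeomorph (sliceMk hd) := by
  rw [isLocalHomeomorph_iff_isOpenEmbedding_restrict]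
  intro t₀
  have h1 : ∀ᶠ q : freeSlice d × freeSlice d in 𝓝 t₀ ×ˢ 𝓝 t₀,
      ∀ σ : Equiv.Perm (Fin (d + 1)), σ ≠ 1 → slicePerm σ q.1 ≠ q.2 := by
    rw [← nhds_prod_eq]
    refine Filter.eventually_all.2 fun σ => ?_
    by_cases hσ : σ = 1
    · simp [hσ]
    · have h2 : Continuous fun q : freeSlice d × freeSlice d => (slicePerm σ q.1, q.2) :=
        ((contMDiff_slicePerm σ).continuous.comp continuous_fst).prodMk continuous_snd
      filter_upwards [h2.continuousAt.preimage_mem_nhds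
        (isClosed_diagonal.isOpen_compl.mem_nhds (slicePerm_ne hσ t₀))] with q hq _
      exact hq
  obtain ⟨U, hU, hUq⟩ := Filter.mem_prod_self_iff.1 h1
  obtain ⟨W, hWU, hW, htW⟩ := mem_nhds_iff.1 hU
  refine ⟨W, hW.mem_nhds htW, ?_⟩
  refine Topology.IsOpenEmbedding.of_continuous_injective_isOpenMap
    (continuous_sliceMk.comp continuous_subtype_val) ?_
    (isOpenMap_sliceMk.comp hW.isOpenMap_subtype_val)
  intro t t' htt'
  obtain ⟨σ, hσ⟩ := sliceMk_eq_sliceMk_iff.1 htt'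
  by_cases h : σ = 1
  · rw [h, slicePerm_one] at hσ
    exact Subtype.ext hσ.symm
  · exact absurd hσ.symm (hUq (Set.mk_mem_prod (hWU t.2) (hWU t'.2)) σ h)

theorem hasSmoothDecks_sliceMk : HasSmoothDecks (SliceModel d) (sliceMk hd) := by
  intro t t' h
  obtain ⟨σ, rfl⟩ := sliceMk_eq_sliceMk_iff.1 h
  exact ⟨slicePerm σ, (contMDiff_slicePerm σ).contMDiffAt, rfl, .of_forall fun t =>
    (sliceMk_eq_sliceMk_iff.2 ⟨σ, rfl⟩).symm⟩

end
end PickSpace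

/-! ### The projection as a smooth principal bundle. -/

namespace PickSpace
noncomputable section
open scoped Manifold ContDiff Topology ComplexConjugate

variable {d : ℕ}

/-! ### The quotient map -/

instance {n : ℕ} : ContinuousSMul (BallAut d) (Conf d n) := ⟨by
  have h : Continuous fun q : BallAut d × Conf d n => fun i => ((q.1 • confPt q.2 i : Ball d) : Cn d) :=
    continuous_pi fun i => continuous_subtype_val.comp
      (continuous_fst.smul ((continuous_confPt i).comp continuous_snd))
  exact h.subtype_mk _⟩

theorem X0.isOpenQuotientMap_mk {n : ℕ} : IsOpenQuotientMap (X0.mk : Conf d n → X0 d n) :=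
  ⟨X0.mk_surjective, X0.continuous_mk, X0.isOpenMap_mk⟩

instance {n : ℕ} : ContinuousSMul (BallAut d) (X0 d n) := ⟨by
  have h := (IsOpenQuotientMap.id (X := BallAut d)).prodMap (X0.isOpenQuotientMap_mk (d := d) (n := n))
  rw [h.isQuotientMap.continuous_iff]
  exact X0.continuous_mk.comp continuous_smul⟩

instance {n : ℕ} : ContinuousSMul (BallAut d) (X0reg d n) := ⟨by
  have h : Continuous fun q : BallAut d × X0reg d n => q.1 • q.2.1 :=
    continuous_fst.smul (continuous_subtype_val.comp continuous_snd)
  exact h.subtype_mk _⟩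

/-- The unordered configuration underlying a free ordered one. -/
def regMk (hd : d ≠ 1) (y : {y : Conf d (d + 1) // IsFree y}) : X0reg d (d + 1) :=
  ⟨X0.mk y.1, (mk_mem_X0reg_iff hd y.1).2 y.2⟩

theorem isOpenQuotientMap_regMk (hd : d ≠ 1) : IsOpenQuotientMap (regMk hd) where
  surjective := fun ⟨x, hx⟩ => by
    obtain ⟨y, rfl⟩ := X0.mk_surjective x
    exact ⟨⟨y, (mk_mem_X0reg_iff hd y).1 hx⟩, rfl⟩
  continuous := (X0.continuous_mk.comp continuous_subtype_val).subtype_mk _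
  isOpenMap := by
    intro U hU
    rw [(X0reg d (d + 1)).isOpen.isOpenEmbedding_subtypeVal.isOpen_iff_image_isOpen]
    have h1 := X0.isOpenMap_mk _ (isOpen_isFree.isOpenEmbedding_subtypeVal.isOpenMap U hU)
    rw [Set.image_image] at h1 ⊢
    exact h1

/-- The map `x ↦ [ℰ_x]`. -/
def pickMap (hd : d ≠ 1) (x : X0reg d (d + 1)) : PickReg (d + 1) :=
  freeMk hd ((isOpenQuotientMap_regMk hd).surjective x).choose

variable {hd : d ≠ 1}

theorem pickMap_regMk (y : {y : Conf d (d + 1) // IsFree y}) :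
    pickMap hd (regMk hd y) = freeMk hd y := by
  have h := ((isOpenQuotientMap_regMk hd).surjective (regMk hd y)).choose_spec
  obtain ⟨σ, hσ⟩ := X0.mk_eq_mk_iff.1 (congrArg Subtype.val h)
  refine Subtype.ext ?_
  change pickMk _ = pickMk _
  rw [← hσ, pickMk_perm]

theorem isClassOf_pickMap (x : X0reg d (d + 1)) : IsClassOf (pickMap hd x).1 x.1 := by
  obtain ⟨y, rfl⟩ := (isOpenQuotientMap_regMk hd).surjective x
  rw [pickMap_regMk]
  exact isClassOf_mk_iff.2 rfl

theorem continuous_pickMap : Continuous (pickMap hd) := by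
  rw [(isOpenQuotientMap_regMk hd).isQuotientMap.continuous_iff]
  exact (isOpenQuotientMap_freeMk hd).continuous.congr fun y => (pickMap_regMk y).symm

theorem pickMap_smul (φ : BallAut d) (x : X0reg d (d + 1)) :
    pickMap hd (φ • x) = pickMap hd x := by
  obtain ⟨y, rfl⟩ := (isOpenQuotientMap_regMk hd).surjective x
  have h1 : φ • regMk hd y = regMk hd ⟨φ • y.1, isFree_smul φ y.2⟩ := rfl
  rw [h1, pickMap_regMk, pickMap_regMk]
  exact Subtype.ext (pickMk_smul φ y.1)

/-! ### The order of the points of a configuration that is determined by the slice -/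

theorem isFree_of_normalForm_eq {y : Conf d (d + 1)} {t : freeSlice d}
    (h : normalForm y = sliceConf t) : IsFree y := by
  rw [← frame_smul_normalForm y, h]
  exact isFree_smul _ (isFree_sliceConf t)

/-- The orderings of a free configuration have distinct normal forms, so a point of the slice over
its class selects one ordering. -/
theorem eq_of_mk_eq_of_normalForm_eq {y y' : Conf d (d + 1)} (hy : IsFree y)
    (h : X0.mk y = X0.mk y') (h' : normalForm y = normalForm y') : y = y' := by
  obtain ⟨σ, rfl⟩ := X0.mk_eq_mk_iff.1 h.symm
  by_cases hσ : σ = 1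
  · rw [hσ, one_smul]
  · exact absurd h'.symm (hy.2 σ hσ)

/-- The ordering of the configuration `x` whose normal form has coordinates `t`. -/
def ord (t : freeSlice d) (x : X0 d (d + 1)) : Conf d (d + 1) :=
  open scoped Classical in
  if h : ∃ y, X0.mk y = x ∧ normalForm y = sliceConf t then h.choose else sliceConf t

theorem ord_mk {t : freeSlice d} {y : Conf d (d + 1)} (h : normalForm y = sliceConf t) :
    ord t (X0.mk y) = y := by
  have h' : ∃ y', X0.mk y' = X0.mk y ∧ normalForm y' = sliceConf t := ⟨y, rfl, h⟩
  rw [ord, dif_pos h']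
  exact (eq_of_mk_eq_of_normalForm_eq (isFree_of_normalForm_eq h) h'.choose_spec.1.symm
    (h.trans h'.choose_spec.2.symm)).symm

theorem ord_spec {t : freeSlice d} {x : X0reg d (d + 1)} (h : pickMap hd x = sliceMk hd t) :
    X0.mk (ord t x.1) = x.1 ∧ normalForm (ord t x.1) = sliceConf t := by
  obtain ⟨y, rfl⟩ := (isOpenQuotientMap_regMk hd).surjective x
  rw [pickMap_regMk, eq_comm, sliceMk_eq_freeMk_iff] at h
  obtain ⟨σ, hσ⟩ := h
  have h1 : (regMk hd y).1 = X0.mk (σ • y.1) := (X0.mk_perm σ y.1).symm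
  rw [h1, ord_mk hσ]
  exact ⟨rfl, hσ⟩

theorem ord_smul {t : freeSlice d} {x : X0reg d (d + 1)} (h : pickMap hd x = sliceMk hd t)
    (φ : BallAut d) : ord t (φ • x).1 = φ • ord t x.1 := by
  have h1 := ord_spec h
  have h2 : (φ • x).1 = X0.mk (φ • ord t x.1) := by
    change φ • x.1 = _
    rw [← X0.smul_mk, h1.1]
  rw [h2, ord_mk]
  rw [normalForm_smul φ (isFree_of_normalForm_eq h1.2).1, h1.2]

variable (hd) in
/-- The local inverses of `sliceMk`. -/
abbrev pickLift (t : freeSlice d) : OpenPartialHomeomorph (PickReg (d + 1)) (freeSlice d) :=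
  (isLocalHomeomorph_sliceMk hd).localInverseAt t

theorem sliceMk_pickLift {t : freeSlice d} {b : PickReg (d + 1)} (hb : b ∈ (pickLift hd t).source) :
    sliceMk hd (pickLift hd t b) = b :=
  (isLocalHomeomorph_sliceMk hd).apply_localInverseAt_of_mem hb

/-- Near `x`, a smooth local ordering through the selected one has normal form in the target of
`pickLift`, so it is the selected ordering throughout. -/
theorem contMDiffAt_ord {t : freeSlice d} {x : X0reg d (d + 1)}
    (hx : pickMap hd x ∈ (pickLift hd t).source) :
    ContMDiffAt 𝓘(ℝ, Fin (d + 1) → Cn d) 𝓘(ℝ, Fin (d + 1) → Cn d) ∞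
      (fun x : X0reg d (d + 1) => ord (pickLift hd t (pickMap hd x)) x.1) x := by
  have hspec := ord_spec (sliceMk_pickLift hx).symm
  set y := ord (pickLift hd t (pickMap hd x)) x.1
  have hfree := isFree_of_normalForm_eq hspec.2
  obtain ⟨s, hs, hsy, hmk⟩ := X0.isQuotientAtlas.exists_section X0.hasSmoothDecks y
  rw [hspec.1] at hs hsy hmk
  have hs' : ContMDiffAt 𝓘(ℝ, Fin (d + 1) → Cn d) 𝓘(ℝ, Fin (d + 1) → Cn d) ∞
      (fun x : X0reg d (d + 1) => s x.1) x :=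
    ContMDiffAt.comp (g := s) x hs contMDiff_subtype_val.contMDiffAt
  refine hs'.congr_of_eventuallyEq ?_
  have hs'' : Filter.Tendsto (fun x : X0reg d (d + 1) => s x.1) (𝓝 x) (𝓝 y) := by
    have := hs'.continuousAt.tendsto
    rwa [hsy] at this
  have hmk' : ∀ᶠ x' : X0reg d (d + 1) in 𝓝 x, X0.mk (s x'.1) = x'.1 :=
    continuous_subtype_val.continuousAt.eventually hmk
  have hopen : IsOpen {y : {y : Conf d (d + 1) // IsFree y} |
      toSlice y.1 y.2 ∈ (pickLift hd t).target} := by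
    refine (pickLift hd t).open_target.preimage (Continuous.subtype_mk ?_ _)
    have h2 := continuous_normalForm_perm (d := d) 1
    simp only [one_smul] at h2
    exact (sliceProj d).continuous.comp (continuous_subtype_val.comp h2)
  have hy_slice : toSlice y hfree = pickLift hd t (pickMap hd x) :=
    sliceConf_injective (by rw [sliceConf_toSlice, hspec.2])
  have hnear := (isOpen_isFree.isOpenMap_subtype_val _ hopen).mem_nhds
    ⟨⟨y, hfree⟩, by
      change toSlice y hfree ∈ (pickLift hd t).target
      rw [hy_slice]
      exact (pickLift hd t).map_source hx, rfl⟩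
  filter_upwards [hs''.eventually hnear, hmk'] with x' hx' hmkx
  obtain ⟨⟨y', hy'⟩, hy't, hy's⟩ := hx'
  simp only at hy's
  subst hy's
  have h1 : x' = regMk hd ⟨_, hy'⟩ := Subtype.ext hmkx.symm
  have h2 : pickLift hd t (pickMap hd x') = toSlice _ hy' := by
    conv_lhs => rw [h1, pickMap_regMk, ← sliceMk_toSlice]
    exact localInverseAt_apply_of_mem (isLocalHomeomorph_sliceMk hd) hy't
  rw [h2]
  have h3 := ord_mk (sliceConf_toSlice _ hy').symm
  rwa [hmkx] at h3

/-! ### The principal bundle -/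

variable [ChartedSpace (SliceModel d) (PickReg (d + 1))]

theorem contMDiffAt_pickLift (hA : IsQuotientAtlas (E := SliceModel d) (isLocalHomeomorph_sliceMk hd))
    {t : freeSlice d} {b : PickReg (d + 1)} (hb : b ∈ (pickLift hd t).source) :
    ContMDiffAt 𝓘(ℝ, SliceModel d) 𝓘(ℝ, SliceModel d) ∞ (pickLift hd t) b := by
  obtain ⟨t', rfl⟩ := sliceMk_surjective (hd := hd) b
  exact hA.contMDiffAt_of_comp hasSmoothDecks_sliceMk
    (contMDiffAt_localInverseAt_comp _ hasSmoothDecks_sliceMk hb)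

theorem contMDiff_pickMap
    (hA : IsQuotientAtlas (E := SliceModel d) (isLocalHomeomorph_sliceMk hd)) :
    ContMDiff 𝓘(ℝ, Fin (d + 1) → Cn d) 𝓘(ℝ, SliceModel d) ∞ (pickMap hd) := by
  intro x
  obtain ⟨t, ht⟩ := sliceMk_surjective (hd := hd) (pickMap hd x)
  have hx : pickMap hd x ∈ (pickLift hd t).source := by
    rw [← ht]
    exact (isLocalHomeomorph_sliceMk hd).apply_self_mem_localInverseAt_source
  have hev : ∀ᶠ x' in 𝓝 x, pickMap hd x' ∈ (pickLift hd t).source :=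
    continuous_pickMap.continuousAt.preimage_mem_nhds ((pickLift hd t).open_source.mem_nhds hx)
  have h1 : ContMDiffAt 𝓘(ℝ, Fin (d + 1) → Cn d) 𝓘(ℝ, SliceModel d) ∞
      (fun x' => pickLift hd t (pickMap hd x')) x := by
    rw [← ContMDiffAt.subtypeVal_comp_iff]
    have h2 := ContMDiffAt.comp (g := fun y : Conf d (d + 1) => sliceProj d (normalForm y).1)
      (f := fun x : X0reg d (d + 1) => ord (pickLift hd t (pickMap hd x)) x.1) x
      (contMDiffAt_sliceProj_normalForm
        (isFree_of_normalForm_eq (ord_spec (sliceMk_pickLift hx).symm).2).1) (contMDiffAt_ord hx)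
    refine h2.congr_of_eventuallyEq ?_
    filter_upwards [hev] with x' hx'
    simp only [Function.comp_apply]
    rw [(ord_spec (sliceMk_pickLift hx').symm).2]
    exact (sliceProj_sliceIncl _).symm
  refine (ContMDiffAt.comp x (hA.contMDiff hasSmoothDecks_sliceMk).contMDiffAt h1).congr_of_eventuallyEq
    ?_
  filter_upwards [hev] with x' hx'
  exact (sliceMk_pickLift hx').symm

/-- The trivialization over the domain of a local inverse of `sliceMk`. -/
def pickTriv (hd : d ≠ 1) (t : freeSlice d) : Bundle.Trivialization (BallAut d) (pickMap hd) where
  -- The group component is the moving frame of the selected ordering. It is the identity on the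
  -- slice, which therefore serves as the unit section.
  toFun x := (pickMap hd x, frame (ord (pickLift hd t (pickMap hd x)) x.1))
  invFun q := q.2 • regMk hd ⟨sliceConf (pickLift hd t q.1), isFree_sliceConf _⟩
  source := pickMap hd ⁻¹' (pickLift hd t).source
  target := (pickLift hd t).source ×ˢ Set.univ
  map_source' x hx := ⟨hx, trivial⟩
  map_target' q hq := by
    rw [Set.mem_preimage, pickMap_smul, pickMap_regMk]
    change sliceMk hd _ ∈ _
    rw [sliceMk_pickLift hq.1]
    exact hq.1
  left_inv' x hx := by
    have h1 := ord_spec (sliceMk_pickLift hx).symm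
    refine Subtype.ext ?_
    change frame _ • X0.mk (sliceConf _) = x.1
    rw [← h1.2, X0.smul_mk, frame_smul_normalForm, h1.1]
  right_inv' q hq := by
    have h1 : pickMap hd (q.2 • regMk hd ⟨sliceConf (pickLift hd t q.1), isFree_sliceConf _⟩) =
        q.1 := by
      rw [pickMap_smul, pickMap_regMk]
      exact sliceMk_pickLift hq.1
    rw [h1]
    refine Prod.ext rfl ?_
    change frame (ord _ (q.2 • X0.mk (sliceConf _))) = q.2
    rw [X0.smul_mk, ord_mk, frame_smul, frame_sliceConf, mul_one]
    · exact (isFree_sliceConf _).1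
    · rw [normalForm_smul _ (isFree_sliceConf _).1, normalForm_sliceConf]
  open_source := (pickLift hd t).open_source.preimage continuous_pickMap
  open_target := (pickLift hd t).open_source.prod isOpen_univ
  continuousOn_toFun := by
    intro x hx
    refine ContinuousAt.continuousWithinAt (continuous_pickMap.continuousAt.prodMk ?_)
    have h1 := ord_spec (sliceMk_pickLift hx).symm
    exact ContinuousAt.comp (g := frame) (continuousOn_frame.continuousAt
      (isOpen_isGeneral.mem_nhds (isFree_of_normalForm_eq h1.2).1)) (contMDiffAt_ord hx).continuousAt
  continuousOn_invFun := by
    have h1 : ContinuousOn (fun q : PickReg (d + 1) × BallAut d => pickLift hd t q.1)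
        ((pickLift hd t).source ×ˢ Set.univ) :=
      (pickLift hd t).continuousOn.comp continuousOn_fst fun q hq => hq.1
    have h2 : Continuous fun s : freeSlice d => regMk hd ⟨sliceConf s, isFree_sliceConf s⟩ :=
      (isOpenQuotientMap_regMk hd).continuous.comp (contMDiff_sliceConf.continuous.subtype_mk _)
    exact continuousOn_snd.smul (h2.comp_continuousOn h1)
  baseSet := (pickLift hd t).source
  open_baseSet := (pickLift hd t).open_source
  source_eq := rfl
  target_eq := rfl
  proj_toFun x hx := rfl

theorem isSmoothPrincipalBundle_pickMap
    (hA : IsQuotientAtlas (E := SliceModel d) (isLocalHomeomorph_sliceMk hd)) :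
    IsSmoothPrincipalBundle d (Fin (d + 1) → Cn d) (SliceModel d) (pickMap hd) where
  topologicalGroup := inferInstance
  continuousSMul := inferInstance
  smooth := contMDiff_pickMap hA
  locallyTrivial b := by
    obtain ⟨t, ht⟩ := sliceMk_surjective (hd := hd) b
    refine ⟨pickTriv hd t, ?_, ?_, ?_, ?_⟩
    · rw [← ht]
      exact (isLocalHomeomorph_sliceMk hd).apply_self_mem_localInverseAt_source
    · intro x hx φ
      have h1 : pickMap hd (φ • x) = pickMap hd x := pickMap_smul φ x
      refine ⟨?_, ?_⟩
      · change pickMap hd (φ • x) ∈ (pickLift hd t).source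
        rw [h1]
        exact hx
      · change (pickMap hd (φ • x), frame (ord (pickLift hd t (pickMap hd (φ • x))) (φ • x).1)) = _
        have h2 : pickMap hd x = sliceMk hd (pickLift hd t (pickMap hd x)) :=
          (sliceMk_pickLift hx).symm
        rw [h1, ord_smul h2, frame_smul φ (isFree_of_normalForm_eq (ord_spec h2).2).1]
        rfl
    · intro u hu
      refine ContMDiffAt.contMDiffWithinAt ?_
      rw [← ContMDiffAt.subtypeVal_comp_iff]
      have h1 := ContMDiffAt.comp u contMDiff_sliceConf.contMDiffAt (contMDiffAt_pickLift hA hu)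
      refine (ContMDiffAt.comp u (X0.isQuotientAtlas.contMDiff X0.hasSmoothDecks).contMDiffAt
        h1).congr_of_eventuallyEq (.of_forall fun b => ?_)
      change ((1 : BallAut d) • regMk hd _).1 = _
      rw [one_smul]
      rfl
    · rintro ⟨x, z⟩ ⟨hx, -⟩
      refine ContMDiffAt.contMDiffWithinAt ?_
      have h1 := ord_spec (sliceMk_pickLift hx).symm
      have hgen := (isFree_of_normalForm_eq h1.2).1
      have h2 : ContMDiffAt (𝓘(ℝ, Fin (d + 1) → Cn d).prod 𝓘(ℝ, Cn d))
          𝓘(ℝ, (Fin (d + 1) → Cn d) × Cn d) ∞ (fun q : X0reg d (d + 1) × Ball d =>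
            ((ord (pickLift hd t (pickMap hd q.1)) q.1.1).1, (q.2 : Cn d))) (x, z) := by
        refine ContMDiffAt.prodMk_space ?_ ?_
        · exact ContMDiffAt.comp (x, z) contMDiff_subtype_val.contMDiffAt
            (ContMDiffAt.comp (x, z) (contMDiffAt_ord hx) contMDiffAt_fst)
        · exact ContMDiffAt.comp (x, z) contMDiff_subtype_val.contMDiffAt contMDiffAt_snd
      refine (ContMDiffAt.comp (x, z) (contDiffAt_frameFun hgen z).contMDiffAt
        h2).congr_of_eventuallyEq ?_
      have hev : ∀ᶠ q : X0reg d (d + 1) × Ball d in 𝓝 (x, z),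
          pickMap hd q.1 ∈ (pickLift hd t).source :=
        (continuous_pickMap.comp continuous_fst).continuousAt.preimage_mem_nhds
          ((pickLift hd t).open_source.mem_nhds hx)
      filter_upwards [hev] with q hq
      exact coe_frame_smul (isFree_of_normalForm_eq (ord_spec (sliceMk_pickLift hq).symm).2).1 q.2

end
end PickSpace

namespace PickSpace
noncomputable section
open scoped Manifold ContDiff Topology ComplexConjugate
open InnerProductSpace

variable {d n : ℕ}

/-! ### Normalized kernel functions -/

theorem daKer_re_pos (z w : Ball d) : 0 < (daKer z w).re := by
  have h1 : ‖inner ℂ (w : Cn d) (z : Cn d)‖ < 1 := (norm_inner_le_norm _ _).trans_lt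
    (mul_lt_one_of_nonneg_of_lt_one_left (norm_nonneg _) (ball_norm_lt w) (ball_norm_lt z).le)
  have h2 := (Complex.re_le_norm (inner ℂ (w : Cn d) (z : Cn d))).trans_lt h1
  rw [daKer, one_div, Complex.inv_re]
  refine div_pos ?_ (Complex.normSq_pos.2 (one_sub_inner_ne_zero (ball_norm_lt w) (ball_norm_lt z)))
  rw [Complex.sub_re, Complex.one_re]
  linarith

theorem autWeight_re_pos (φ : BallAut d) (z : Ball d) : 0 < (autWeight φ z).re := by
  rw [autWeight, Complex.re_ofReal_mul]
  refine mul_pos (Real.sqrt_pos.2 ?_) (daKer_re_pos _ _)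
  have h1 := ball_norm_lt (φ⁻¹ • Ball.origin d)
  nlinarith [norm_nonneg ((φ⁻¹ • Ball.origin d : Ball d) : Cn d)]

/-- Each of the four arguments is less than `π / 2` in absolute value, so the discrepancy is a
multiple of `2π` that is less than `2π`. -/
theorem log_conj_mul_mul {a b k : ℂ} (ha : 0 < a.re) (hb : 0 < b.re) (hk : 0 < k.re)
    (h : 0 < (conj a * b * k).re) : Complex.log (conj a * b * k) =
      conj (Complex.log a) + Complex.log b + Complex.log k := by
  have hne : ∀ {w : ℂ}, 0 < w.re → w ≠ 0 := fun hw h0 => by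
    rw [h0, Complex.zero_re] at hw
    exact lt_irrefl _ hw
  have harg : ∀ {w : ℂ}, 0 < w.re → |w.arg| < Real.pi / 2 := fun hw =>
    Complex.abs_arg_lt_pi_div_two_iff.2 (Or.inl hw)
  have hexp : Complex.exp (Complex.log (conj a * b * k)) =
      Complex.exp (conj (Complex.log a) + Complex.log b + Complex.log k) := by
    rw [Complex.exp_add, Complex.exp_add, Complex.exp_conj, Complex.exp_log (hne ha),
      Complex.exp_log (hne hb), Complex.exp_log (hne hk), Complex.exp_log (hne h)]
  obtain ⟨m, hm⟩ := Complex.exp_eq_exp_iff_exists_int.1 hexp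
  have him := congrArg Complex.im hm
  simp only [Complex.add_im, Complex.log_im, Complex.conj_im, Complex.mul_im, Complex.intCast_re,
    Complex.intCast_im, Complex.re_ofNat, Complex.im_ofNat, Complex.ofReal_re, Complex.ofReal_im,
    Complex.I_re, Complex.I_im, Complex.mul_re] at him
  have h1 := abs_lt.1 (harg ha)
  have h2 := abs_lt.1 (harg hb)
  have h3 := abs_lt.1 (harg hk)
  have h4 := abs_lt.1 (harg h)
  have hpi := Real.pi_pos
  have hm1 : (m : ℝ) < 1 := by nlinarith
  have hm2 : (-1 : ℝ) < m := by nlinarith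
  have hm0 : m = 0 := by
    have h5 : m < 1 := by exact_mod_cast hm1
    have h6 : -1 < m := by exact_mod_cast hm2
    omega
  rw [hm, hm0, Int.cast_zero, zero_mul, add_zero]

/-- Weights for the kernel functions of a configuration, for which the rescaled kernel functions
are carried along by automorphisms up to a common phase. -/
def confWeight (y : Conf d (n + 1)) (i : Fin (n + 1)) : ℂ :=
  Complex.exp (((n : ℂ) + 1)⁻¹ * ∑ j, (Complex.log (daKer (confPt y j) (confPt y j)) / 2 -
    Complex.log (daKer (confPt y j) (confPt y i))))

theorem confWeight_ne_zero (y : Conf d (n + 1)) (i : Fin (n + 1)) : confWeight y i ≠ 0 :=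
  Complex.exp_ne_zero _

theorem continuous_confWeight (i : Fin (n + 1)) :
    Continuous fun y : Conf d (n + 1) => confWeight y i := by
  have h1 : ∀ i j, Continuous fun y : Conf d (n + 1) =>
      Complex.log (daKer (confPt y i) (confPt y j)) := fun i j =>
    (continuous_daKer.comp ((continuous_confPt i).prodMk (continuous_confPt j))).clog
      fun y => Or.inl (daKer_re_pos _ _)
  exact Complex.continuous_exp.comp (continuous_const.mul
    (continuous_finsetSum _ fun j _ => ((h1 j j).div_const 2).sub (h1 j i)))

theorem confWeight_perm (σ : Equiv.Perm (Fin (n + 1))) (y : Conf d (n + 1)) (i : Fin (n + 1)) :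
    confWeight (σ • y) i = confWeight y (σ⁻¹ i) := by
  rw [confWeight, confWeight]
  congr 2
  simp only [confPt_perm]
  exact Equiv.sum_comp σ⁻¹ fun j => Complex.log (daKer (confPt y j) (confPt y j)) / 2 -
    Complex.log (daKer (confPt y j) (confPt y (σ⁻¹ i)))

/-- With `A j` the logarithm of the weight at the point `j`, the off-diagonal logarithms contribute
`conj (A j) + A i` and the diagonal ones `-(conj (A j) + A j) / 2`. Averaging over `j` gives `A i`
plus the mean of `(conj (A j) - A j) / 2`, which is purely imaginary and independent of `i`. -/
theorem exists_confWeight_smul (φ : BallAut d) (y : Conf d (n + 1)) : ∃ c : ℂ, ‖c‖ = 1 ∧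
    ∀ i, confWeight (φ • y : Conf d (n + 1)) i = c * autWeight φ (confPt y i) * confWeight y i := by
  set A : Fin (n + 1) → ℂ := fun i => Complex.log (autWeight φ (confPt y i)) with hA
  have hlog : ∀ i j, Complex.log (daKer (confPt y i) (confPt y j)) = conj (A i) + A j +
      Complex.log (daKer (confPt (φ • y) i) (confPt (φ • y) j)) := by
    intro i j
    have h1 := daKer_smul φ (confPt y i) (confPt y j)
    have h2 := daKer_re_pos (confPt y i) (confPt y j)
    rw [h1] at h2 ⊢
    exact log_conj_mul_mul (autWeight_re_pos _ _) (autWeight_re_pos _ _) (daKer_re_pos _ _) h2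
  refine ⟨Complex.exp (((n : ℂ) + 1)⁻¹ * ∑ j, (conj (A j) - A j) / 2), ?_, fun i => ?_⟩
  · have h1 : ((n : ℂ) + 1)⁻¹ * ∑ j, (conj (A j) - A j) / 2 =
        ((((n : ℝ) + 1)⁻¹ * ∑ j, -(A j).im : ℝ) : ℂ) * Complex.I := by
      push_cast
      rw [mul_assoc, Finset.sum_mul]
      congr 1
      refine Finset.sum_congr rfl fun j _ => ?_
      have h2 : A j - conj (A j) = 2 * (A j).im * Complex.I := by
        rw [Complex.sub_conj]
        push_cast
        ring
      linear_combination (-1 / 2 : ℂ) * h2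
    rw [h1, Complex.norm_exp_ofReal_mul_I]
  · have hn : ((n : ℂ) + 1) ≠ 0 := by exact_mod_cast n.succ_ne_zero
    have h3 : autWeight φ (confPt y i) = Complex.exp (((n : ℂ) + 1)⁻¹ * ∑ _j : Fin (n + 1), A i) := by
      rw [Finset.sum_const, Finset.card_univ, Fintype.card_fin, nsmul_eq_mul, Nat.cast_succ,
        inv_mul_cancel_left₀ hn, hA, Complex.exp_log (autWeight_ne_zero _ _)]
    rw [h3, confWeight, confWeight, ← Complex.exp_add, ← Complex.exp_add, ← mul_add, ← mul_add,
      ← Finset.sum_add_distrib, ← Finset.sum_add_distrib]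
    congr 2
    refine Finset.sum_congr rfl fun j _ => ?_
    rw [hlog j j, hlog j i]
    ring

theorem continuous_of_continuous_inner {X E : Type*} [TopologicalSpace X] [NormedAddCommGroup E]
    [InnerProductSpace ℂ E] {f : X → E} (h : Continuous fun q : X × X => inner ℂ (f q.1) (f q.2)) :
    Continuous f := by
  rw [continuous_iff_continuousAt]
  intro w
  rw [ContinuousAt, tendsto_iff_norm_sub_tendsto_zero]
  have h1 : ∀ z, ‖f z - f w‖ = √(inner ℂ (f z) (f z) - inner ℂ (f z) (f w) -
      (inner ℂ (f w) (f z) - inner ℂ (f w) (f w))).re := by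
    intro z
    rw [norm_eq_sqrt_re_inner (𝕜 := ℂ), inner_sub_left, inner_sub_right, inner_sub_right]
    rfl
  have h3 : Continuous fun z => inner ℂ (f z) (f z) := h.comp (continuous_id.prodMk continuous_id)
  have h4 : Continuous fun z => inner ℂ (f z) (f w) :=
    h.comp (continuous_id.prodMk continuous_const)
  have h5 : Continuous fun z => inner ℂ (f w) (f z) :=
    h.comp (continuous_const.prodMk continuous_id)
  have h2 : Continuous fun z => √(inner ℂ (f z) (f z) - inner ℂ (f z) (f w) -
      (inner ℂ (f w) (f z) - inner ℂ (f w) (f w))).re :=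
    (Complex.continuous_re.comp ((h3.sub h4).sub (h5.sub continuous_const))).sqrt
  have h6 := h2.tendsto w
  simp only [sub_self, Complex.zero_re, Real.sqrt_zero] at h6
  exact h6.congr fun z => (h1 z).symm

theorem continuous_daFun : Continuous (daFun : Ball d → DA d) :=
  continuous_of_continuous_inner
    ((continuous_daKer.comp continuous_id).congr fun _ => inner_daFun.symm)

/-- The rescaled kernel functions of a configuration. -/
def frameVec (y : Conf d (n + 1)) (i : Fin (n + 1)) : DA d := confWeight y i • daFun (confPt y i)

theorem continuous_frameVec (i : Fin (n + 1)) :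
    Continuous fun y : Conf d (n + 1) => frameVec y i :=
  (continuous_confWeight i).smul (continuous_daFun.comp (continuous_confPt i))

theorem frameVec_perm (σ : Equiv.Perm (Fin (n + 1))) (y : Conf d (n + 1)) (i : Fin (n + 1)) :
    frameVec (σ • y) i = frameVec y (σ⁻¹ i) := by
  rw [frameVec, confWeight_perm, confPt_perm, frameVec]

theorem linearIndependent_frameVec (y : Conf d (n + 1)) : LinearIndependent ℂ (frameVec y) :=
  (linearIndependent_daFun (confPt_injective y)).units_smul
    fun i => Units.mk0 _ (confWeight_ne_zero y i)

theorem hasPoint_mk_iff {y : Conf d n} {z : Ball d} :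
    (X0.mk y).HasPoint z ↔ ∃ i, confPt y i = z := by
  constructor
  · rintro ⟨y', hy', i, rfl⟩
    obtain ⟨σ, rfl⟩ := X0.mk_eq_mk_iff.1 hy'
    exact ⟨_, (confPt_perm σ y i).symm⟩
  · rintro ⟨i, rfl⟩
    exact ⟨y, rfl, i, rfl⟩

theorem tautFibre_mk (y : Conf d (n + 1)) :
    tautFibre (X0.mk y) = Submodule.span ℂ (Set.range (frameVec y)) := by
  have h1 : {f | ∃ z, (X0.mk y).HasPoint z ∧ daFun z = f} =
      Set.range fun i => daFun (confPt y i) := by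
    ext f
    simp [hasPoint_mk_iff]
  rw [tautFibre, h1]
  refine le_antisymm (Submodule.span_le.2 ?_) (Submodule.span_le.2 ?_)
  · rintro _ ⟨i, rfl⟩
    have h2 : daFun (confPt y i) = (confWeight y i)⁻¹ • frameVec y i := by
      rw [frameVec, inv_smul_smul₀ (confWeight_ne_zero y i)]
    simp only [h2]
    exact Submodule.smul_mem _ _ (Submodule.subset_span ⟨i, rfl⟩)
  · rintro _ ⟨i, rfl⟩
    exact Submodule.smul_mem _ _ (Submodule.subset_span ⟨i, rfl⟩)

/-- The linear combinations of the rescaled kernel functions. -/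
def frameComb (y : Conf d (n + 1)) {x : X0 d (n + 1)} (h : X0.mk y = x) :
    (Fin (n + 1) → ℂ) →ₗ[ℂ] tautFibre x :=
  (Fintype.linearCombination ℂ (frameVec y)).codRestrict _ fun a => by
    rw [← h, tautFibre_mk, ← Fintype.range_linearCombination]
    exact ⟨a, rfl⟩

theorem frameComb_bijective (y : Conf d (n + 1)) {x : X0 d (n + 1)} (h : X0.mk y = x) :
    Function.Bijective (frameComb y h) := by
  constructor
  · intro a b hab
    exact (linearIndependent_iff_injective_fintypeLinearCombination.1 (linearIndependent_frameVec y))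
      (congrArg Subtype.val hab)
  · rintro ⟨v, hv⟩
    have hv' := hv
    rw [← h, tautFibre_mk, ← Fintype.range_linearCombination] at hv'
    obtain ⟨a, ha⟩ := hv'
    exact ⟨a, Subtype.ext ha⟩

/-- The coordinates with respect to the rescaled kernel functions. -/
def frameEquiv (y : Conf d (n + 1)) {x : X0 d (n + 1)} (h : X0.mk y = x) :
    tautFibre x ≃ₗ[ℂ] (Fin (n + 1) → ℂ) :=
  (LinearEquiv.ofBijective (frameComb y h) (frameComb_bijective y h)).symm

theorem sum_frameEquiv (y : Conf d (n + 1)) {x : X0 d (n + 1)} (h : X0.mk y = x)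
    (v : tautFibre x) : ∑ i, frameEquiv y h v i • frameVec y i = v.1 :=
  congrArg Subtype.val
    ((LinearEquiv.ofBijective (frameComb y h) (frameComb_bijective y h)).apply_symm_apply v)

theorem frameEquiv_eq {y : Conf d (n + 1)} {x : X0 d (n + 1)} (h : X0.mk y = x)
    {v : tautFibre x} {a : Fin (n + 1) → ℂ} (hv : v.1 = ∑ i, a i • frameVec y i) :
    frameEquiv y h v = a := by
  rw [frameEquiv, LinearEquiv.symm_apply_eq]
  exact Subtype.ext hv

theorem frameEquiv_perm (σ : Equiv.Perm (Fin (n + 1))) {y y' : Conf d (n + 1)}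
    {x : X0 d (n + 1)} (h : X0.mk y = x) (h' : X0.mk y' = x) (hσ : y' = σ • y) (v : tautFibre x) :
    frameEquiv y' h' v = frameEquiv y h v ∘ ⇑σ⁻¹ := by
  refine frameEquiv_eq h' ?_
  rw [← sum_frameEquiv y h v, hσ]
  simp only [frameVec_perm, Function.comp_apply]
  exact (Equiv.sum_comp σ⁻¹ fun i => frameEquiv y h v i • frameVec y i).symm

theorem frameEquiv_daFun {y : Conf d (n + 1)} {x : X0 d (n + 1)} (h : X0.mk y = x)
    {i : Fin (n + 1)} {v : tautFibre x} (hv : v.1 = daFun (confPt y i)) :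
    frameEquiv y h v = (confWeight y i)⁻¹ • Pi.single i 1 := by
  refine frameEquiv_eq h ?_
  rw [hv, Finset.sum_eq_single i]
  · rw [frameVec, Pi.smul_apply, Pi.single_eq_same, smul_eq_mul, mul_one,
      inv_smul_smul₀ (confWeight_ne_zero y i)]
  · intro j _ hj
    rw [Pi.smul_apply, Pi.single_eq_of_ne hj, smul_zero, zero_smul]
  · simp

/-- The coordinates with respect to the rescaled kernel functions, by Cramer's rule. -/
def frameCoord (y : Conf d (n + 1)) (v : DA d) : Fin (n + 1) → ℂ :=
  (Matrix.gram ℂ (frameVec y))⁻¹.mulVec fun i => inner ℂ (frameVec y i) v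

theorem isUnit_det_gram_frameVec (y : Conf d (n + 1)) :
    IsUnit (Matrix.gram ℂ (frameVec y)).det := by
  rw [isUnit_iff_ne_zero]
  exact Matrix.det_gram_ne_zero_iff_linearIndependent.2 (linearIndependent_frameVec y)

/-- This closed formula makes the coordinates jointly continuous in the configuration and the
vector. -/
theorem frameEquiv_eq_frameCoord (y : Conf d (n + 1)) {x : X0 d (n + 1)} (h : X0.mk y = x)
    (v : tautFibre x) : frameEquiv y h v = frameCoord y v.1 := by
  have h1 : (fun i => inner ℂ (frameVec y i) v.1) =
      (Matrix.gram ℂ (frameVec y)).mulVec (frameEquiv y h v) := by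
    funext i
    conv_lhs => rw [← sum_frameEquiv y h v]
    rw [inner_sum, Matrix.mulVec, dotProduct]
    refine Finset.sum_congr rfl fun j _ => ?_
    rw [inner_smul_right, Matrix.gram_apply, mul_comm]
  rw [frameCoord, h1, Matrix.mulVec_mulVec, Matrix.nonsing_inv_mul _ (isUnit_det_gram_frameVec y),
    Matrix.one_mulVec]

theorem continuous_frameCoord :
    Continuous fun q : Conf d (n + 1) × DA d => frameCoord q.1 q.2 := by
  have hG : Continuous fun q : Conf d (n + 1) × DA d => Matrix.gram ℂ (frameVec q.1) :=
    continuous_matrix fun i j => ((continuous_frameVec i).comp continuous_fst).inner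
      ((continuous_frameVec j).comp continuous_fst)
  have hinv : Continuous fun q : Conf d (n + 1) × DA d => (Matrix.gram ℂ (frameVec q.1))⁻¹ := by
    simp only [Matrix.inv_def, Ring.inverse_eq_inv']
    exact (hG.matrix_det.inv₀ fun q => (isUnit_det_gram_frameVec q.1).ne_zero).smul
      hG.matrix_adjugate
  exact hinv.matrix_mulVec (continuous_pi fun i =>
    ((continuous_frameVec i).comp continuous_fst).inner continuous_snd)

end
end PickSpace

namespace PickSpace
noncomputable section
open scoped Manifold ContDiff Topology ComplexConjugate

variable {d : ℕ} {hd : d ≠ 1}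

/-! ### The vector bundle on the regular part of the space of complete Pick spaces -/

theorem normalForm_perm_normalForm (σ : Equiv.Perm (Fin (d + 1))) {y : Conf d (d + 1)}
    (hy : IsGeneral y.1) : normalForm (σ • normalForm y) = normalForm (σ • y) := by
  rw [normalForm.eq_def y, ← smul_perm_comm, normalForm_smul _ (isGeneral_perm σ hy)]

theorem slicePerm_slicePerm (σ τ : Equiv.Perm (Fin (d + 1))) (t : freeSlice d) :
    slicePerm σ (slicePerm τ t) = slicePerm (σ * τ) t := by
  apply sliceConf_injective
  rw [sliceConf_slicePerm, sliceConf_slicePerm, sliceConf_slicePerm, mul_smul,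
    normalForm_perm_normalForm σ (isFree_perm τ (isFree_sliceConf t)).1]

theorem slicePerm_left_injective (t : freeSlice d) :
    Function.Injective fun σ : Equiv.Perm (Fin (d + 1)) => slicePerm σ t := by
  intro σ τ h
  by_contra hne
  refine slicePerm_ne (σ := τ⁻¹ * σ) (fun h1 => hne (inv_mul_eq_one.1 h1).symm) t ?_
  have h2 : slicePerm σ t = slicePerm τ t := h
  rw [← slicePerm_slicePerm, h2, slicePerm_slicePerm, inv_mul_cancel, slicePerm_one]

/-- The permutation that takes one point of the slice to another one of the same class. -/
def permBetween (t t' : freeSlice d) : Equiv.Perm (Fin (d + 1)) :=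
  open scoped Classical in if h : ∃ σ, t' = slicePerm σ t then h.choose else 1

theorem permBetween_eq {t t' : freeSlice d} {σ : Equiv.Perm (Fin (d + 1))}
    (h : t' = slicePerm σ t) : permBetween t t' = σ := by
  have h' : ∃ σ, t' = slicePerm σ t := ⟨σ, h⟩
  rw [permBetween, dif_pos h']
  exact slicePerm_left_injective t (h'.choose_spec.symm.trans h)

theorem ord_slicePerm {t : freeSlice d} {x : X0reg d (d + 1)} (h : pickMap hd x = sliceMk hd t)
    (σ : Equiv.Perm (Fin (d + 1))) : ord (slicePerm σ t) x.1 = σ • ord t x.1 := by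
  have h1 := ord_spec h
  have h2 : x.1 = X0.mk (σ • ord t x.1) := by rw [X0.mk_perm, h1.1]
  conv_lhs => rw [h2]
  apply ord_mk
  rw [← normalForm_perm_normalForm σ (isFree_of_normalForm_eq h1.2).1, h1.2, sliceConf_slicePerm]

theorem exists_pickLift_eq_slicePerm {t t' : freeSlice d} {b : PickReg (d + 1)}
    (hb : b ∈ (pickLift hd t).source) (hb' : b ∈ (pickLift hd t').source) :
    ∃ σ, pickLift hd t' b = slicePerm σ (pickLift hd t b) :=
  sliceMk_eq_sliceMk_iff.1 ((sliceMk_pickLift hb).trans (sliceMk_pickLift hb').symm)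

/-- The permutation of coordinates by `σ`. -/
def permCLM (σ : Equiv.Perm (Fin (d + 1))) : (Fin (d + 1) → ℂ) →L[ℂ] (Fin (d + 1) → ℂ) :=
  ContinuousLinearMap.pi fun i => ContinuousLinearMap.proj (σ⁻¹ i)

/-- The transition permutation is locally constant, since both sides are continuous local lifts that
agree at `b`. -/
theorem eventually_pickLift_eq_slicePerm {t t' : freeSlice d} {b : PickReg (d + 1)}
    (hb : b ∈ (pickLift hd t).source) (hb' : b ∈ (pickLift hd t').source)
    {σ : Equiv.Perm (Fin (d + 1))} (hσ : pickLift hd t' b = slicePerm σ (pickLift hd t b)) :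
    ∀ᶠ b' in 𝓝 b, pickLift hd t' b' = slicePerm σ (pickLift hd t b') := by
  have h1 : ContinuousAt (fun b' => slicePerm σ (pickLift hd t b')) b :=
    (contMDiff_slicePerm σ).continuous.continuousAt.comp ((pickLift hd t).continuousAt hb)
  have h2 : slicePerm σ (pickLift hd t b) ∈ (pickLift hd t').target := by
    rw [← hσ]
    exact (pickLift hd t').map_source hb'
  filter_upwards [h1.eventually ((pickLift hd t').open_target.mem_nhds h2),
    (pickLift hd t).open_source.mem_nhds hb] with b' h3 h4
  have h5 : sliceMk hd (slicePerm σ (pickLift hd t b')) = b' :=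
    (sliceMk_eq_sliceMk_iff.2 ⟨σ, rfl⟩).symm.trans (sliceMk_pickLift h4)
  conv_lhs => rw [← h5]
  exact localInverseAt_apply_of_mem _ h3

variable (hd) in
/-- The vector bundle whose fibres are the spans of the kernel functions of the configurations in
the slice, with the rescaled kernel functions as frames. -/
def pickBundle : VectorBundleCore ℂ (PickReg (d + 1)) (Fin (d + 1) → ℂ) (freeSlice d) where
  baseSet t := (pickLift hd t).source
  isOpen_baseSet t := (pickLift hd t).open_source
  indexAt b := Function.surjInv (sliceMk_surjective (hd := hd)) b
  mem_baseSet_at b := by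
    have h := (isLocalHomeomorph_sliceMk hd).apply_self_mem_localInverseAt_source
      (x := Function.surjInv (sliceMk_surjective (hd := hd)) b)
    rwa [Function.surjInv_eq (sliceMk_surjective (hd := hd)) b] at h
  coordChange t t' b := permCLM (permBetween (pickLift hd t b) (pickLift hd t' b))
  coordChange_self t b _ v := by
    rw [permBetween_eq (slicePerm_one _).symm]
    rfl
  continuousOn_coordChange t t' := by
    intro b hb
    obtain ⟨σ, hσ⟩ := exists_pickLift_eq_slicePerm hb.1 hb.2
    refine (ContinuousAt.congr (continuousAt_const (y := permCLM σ)) ?_).continuousWithinAt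
    filter_upwards [eventually_pickLift_eq_slicePerm hb.1 hb.2 hσ] with b' hb'
    rw [permBetween_eq hb']
  coordChange_comp t t' t'' b hb v := by
    obtain ⟨σ, hσ⟩ := exists_pickLift_eq_slicePerm hb.1.1 hb.1.2
    obtain ⟨τ, hτ⟩ := exists_pickLift_eq_slicePerm hb.1.2 hb.2
    have h := hτ
    rw [hσ, slicePerm_slicePerm] at h
    rw [permBetween_eq hσ, permBetween_eq hτ, permBetween_eq h]
    funext i
    change v (σ⁻¹ (τ⁻¹ i)) = v ((τ * σ)⁻¹ i)
    rw [mul_inv_rev, Equiv.Perm.mul_apply]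

/-- The configurations over a neighbourhood in the base, ordered consistently. -/
abbrev localOrd (hd : d ≠ 1) (t : freeSlice d) (x : X0reg d (d + 1)) : Conf d (d + 1) :=
  ord (pickLift hd t (pickMap hd x)) x.1

theorem mk_localOrd {t : freeSlice d} {x : X0reg d (d + 1)}
    (hx : pickMap hd x ∈ (pickLift hd t).source) : X0.mk (localOrd hd t x) = x.1 :=
  (ord_spec (sliceMk_pickLift hx).symm).1

theorem continuousAt_localOrd {t : freeSlice d} {x : X0reg d (d + 1)}
    (hx : pickMap hd x ∈ (pickLift hd t).source) : ContinuousAt (localOrd hd t) x :=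
  (contMDiffAt_ord hx).continuousAt

theorem coordChange_frameEquiv {t t' : freeSlice d} {x : X0reg d (d + 1)}
    (hx : pickMap hd x ∈ (pickLift hd t).source) (hx' : pickMap hd x ∈ (pickLift hd t').source)
    (v : tautFibre x.1) :
    (pickBundle hd).coordChange t t' (pickMap hd x) (frameEquiv _ (mk_localOrd hx) v) =
      frameEquiv _ (mk_localOrd hx') v := by
  obtain ⟨σ, hσ⟩ := exists_pickLift_eq_slicePerm hx hx'
  have h1 : localOrd hd t' x = σ • localOrd hd t x := by
    rw [localOrd, hσ, ord_slicePerm (sliceMk_pickLift hx).symm]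
  rw [frameEquiv_perm σ (mk_localOrd hx) (mk_localOrd hx') h1]
  change permCLM (permBetween _ _) _ = _
  rw [permBetween_eq hσ]
  rfl

variable (hd) in
/-- The isomorphism of the tautological bundle with the pullback of `pickBundle`. -/
def tautEquiv (x : X0reg d (d + 1)) :
    tautFibre x.1 ≃ₗ[ℂ] (pickBundle hd).Fiber (pickMap hd x) :=
  frameEquiv _ (mk_localOrd ((pickBundle hd).mem_baseSet_at (pickMap hd x)))

variable (hd) in
/-- The map of total spaces induced by `tautEquiv`. -/
def tautMap (e : TautTotal d (d + 1)) :
    X0reg d (d + 1) × Bundle.TotalSpace (Fin (d + 1) → ℂ) (pickBundle hd).Fiber :=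
  (e.1.1, Bundle.TotalSpace.mk' (Fin (d + 1) → ℂ) (pickMap hd e.1.1)
    (tautEquiv hd e.1.1 ⟨e.1.2, e.2⟩))

theorem localTriv_tautMap {t : freeSlice d} {e : TautTotal d (d + 1)}
    (he : pickMap hd e.1.1 ∈ (pickLift hd t).source) :
    ((pickBundle hd).localTriv t (tautMap hd e).2).2 =
      frameEquiv _ (mk_localOrd he) ⟨e.1.2, e.2⟩ :=
  coordChange_frameEquiv ((pickBundle hd).mem_baseSet_at (pickMap hd e.1.1)) he _

theorem continuous_tautTotal_fst : Continuous fun e : TautTotal d (d + 1) => e.1.1 :=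
  continuous_fst.comp continuous_subtype_val

theorem continuousAt_frameCoord_localOrd {t : freeSlice d} {e : TautTotal d (d + 1)}
    (he : pickMap hd e.1.1 ∈ (pickLift hd t).source) :
    ContinuousAt (fun e : TautTotal d (d + 1) => frameCoord (localOrd hd t e.1.1) e.1.2) e := by
  have h1 : ContinuousAt (fun e : TautTotal d (d + 1) => localOrd hd t e.1.1) e :=
    (continuousAt_localOrd he).comp (f := fun e : TautTotal d (d + 1) => e.1.1)
      continuous_tautTotal_fst.continuousAt
  have h2 : ContinuousAt (fun e : TautTotal d (d + 1) => e.1.2) e :=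
    (continuous_snd.comp continuous_subtype_val).continuousAt
  have h3 : ContinuousAt (fun e : TautTotal d (d + 1) => (localOrd hd t e.1.1, e.1.2)) e :=
    h1.prodMk h2
  exact ContinuousAt.comp (f := fun e : TautTotal d (d + 1) => (localOrd hd t e.1.1, e.1.2))
    (g := fun q : Conf d (d + 1) × DA d => frameCoord q.1 q.2)
    continuous_frameCoord.continuousAt h3

theorem continuousAt_localTriv_tautMap {t : freeSlice d} {e : TautTotal d (d + 1)}
    (he : pickMap hd e.1.1 ∈ (pickLift hd t).source) :
    ContinuousAt (fun e => ((pickBundle hd).localTriv t (tautMap hd e).2).2) e := by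
  refine (continuousAt_frameCoord_localOrd he).congr ?_
  have h : ∀ᶠ e' in 𝓝 e, pickMap hd e'.1.1 ∈ (pickLift hd t).source :=
    (continuous_pickMap.comp continuous_tautTotal_fst).continuousAt.preimage_mem_nhds
      ((pickLift hd t).open_source.mem_nhds he)
  filter_upwards [h] with e' he'
  rw [localTriv_tautMap he', frameEquiv_eq_frameCoord]

theorem continuous_tautMap : Continuous (tautMap hd) := by
  have h : Continuous fun e => (tautMap hd e).2 := by
    rw [continuous_iff_continuousAt]
    intro e
    rw [FiberBundle.continuousAt_totalSpace]
    exact ⟨(continuous_pickMap.comp continuous_tautTotal_fst).continuousAt,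
      continuousAt_localTriv_tautMap ((pickBundle hd).mem_baseSet_at (pickMap hd e.1.1))⟩
  exact continuous_tautTotal_fst.prodMk h

theorem tautMap_injective : Function.Injective (tautMap hd) := by
  rintro ⟨⟨x, v⟩, hv⟩ ⟨⟨x', v'⟩, hv'⟩ h
  obtain rfl : x = x' := congrArg Prod.fst h
  have h1 := congrArg Prod.snd h
  have h2 := (tautEquiv hd x).injective (Bundle.TotalSpace.mk_injective _ h1)
  have h3 : v = v' := congrArg Subtype.val h2
  subst h3
  rfl

/-- In a local trivialization the vector is recovered continuously from its coordinates as a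
combination of rescaled kernel functions; `R` is this local left inverse. -/
theorem isEmbedding_tautMap (hd : d ≠ 1) : Topology.IsEmbedding (tautMap hd) := by
  refine ⟨Topology.isInducing_iff_nhds.2 fun e => le_antisymm
    (continuous_tautMap.tendsto e).le_comap ?_, tautMap_injective⟩
  set t := (pickBundle hd).indexAt (pickMap hd e.1.1)
  have ht : pickMap hd e.1.1 ∈ (pickLift hd t).source := (pickBundle hd).mem_baseSet_at _
  let R : X0reg d (d + 1) × Bundle.TotalSpace (Fin (d + 1) → ℂ) (pickBundle hd).Fiber →
      X0reg d (d + 1) × DA d := fun w =>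
    (w.1, ∑ i, ((pickBundle hd).localTriv t w.2).2 i • frameVec (localOrd hd t w.1) i)
  have hR : ContinuousAt R (tautMap hd e) := by
    refine continuousAt_fst.prodMk (tendsto_finsetSum _ fun i _ => ?_)
    have h1 : ContinuousAt (fun w => ((pickBundle hd).localTriv t w).2) (tautMap hd e).2 :=
      continuous_snd.continuousAt.comp (((pickBundle hd).localTriv t).continuousAt ht)
    have h2 : ContinuousAt (localOrd hd t) (tautMap hd e).1 := continuousAt_localOrd ht
    exact (((continuous_apply i).continuousAt.comp h1).comp continuousAt_snd).smul
      (((continuous_frameVec i).continuousAt.comp h2).comp continuousAt_fst)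
  have hsum : ∀ e' : TautTotal d (d + 1), pickMap hd e'.1.1 ∈ (pickLift hd t).source →
      R (tautMap hd e') = e'.1 := by
    intro e' he'
    refine Prod.ext rfl ?_
    have h1 := sum_frameEquiv _ (mk_localOrd he') ⟨e'.1.2, e'.2⟩
    rw [← localTriv_tautMap he'] at h1
    exact h1
  rw [nhds_induced, ← Filter.tendsto_iff_comap]
  have h1 := hR.tendsto.comp (Filter.tendsto_comap (f := tautMap hd))
  rw [hsum e ht] at h1
  refine h1.congr' ?_
  have h2 : (fun w : X0reg d (d + 1) × Bundle.TotalSpace (Fin (d + 1) → ℂ) (pickBundle hd).Fiber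
      => pickMap hd w.1) ⁻¹' (pickLift hd t).source ∈ 𝓝 (tautMap hd e) :=
    (continuous_pickMap.comp continuous_fst).continuousAt.preimage_mem_nhds
      ((pickLift hd t).open_source.mem_nhds ht)
  filter_upwards [Filter.preimage_mem_comap h2] with e' he'
  exact hsum e' he'

/-- The selected ordering is equivariant, and a kernel function has the inverse of its weight as its
only coordinate. The rule for `confWeight` under `φ` thus becomes the identity, with one phase for
all points. -/
theorem exists_tautEquiv_smul (φ : BallAut d) (x : X0reg d (d + 1)) : ∃ c : ℂ, ‖c‖ = 1 ∧
    ∀ z, x.1.HasPoint z → ∀ (v : tautFibre x.1) (w : tautFibre (φ • x).1),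
      v.1 = daFun z → w.1 = daFun (φ • z) →
        Bundle.TotalSpace.mk' (Fin (d + 1) → ℂ) (pickMap hd x) (tautEquiv hd x v) =
          Bundle.TotalSpace.mk' (Fin (d + 1) → ℂ) (pickMap hd (φ • x))
            ((c * autWeight φ z) • tautEquiv hd (φ • x) w) := by
  set t := (pickBundle hd).indexAt (pickMap hd x)
  have ht : pickMap hd x ∈ (pickLift hd t).source := (pickBundle hd).mem_baseSet_at _
  have hφ := pickMap_smul (hd := hd) φ x
  have ht' : pickMap hd (φ • x) ∈ (pickLift hd t).source := by rwa [hφ]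
  have hord : localOrd hd t (φ • x) = φ • localOrd hd t x := by
    rw [localOrd, hφ]
    exact ord_smul (sliceMk_pickLift ht).symm φ
  obtain ⟨c, hc, h⟩ := exists_confWeight_smul φ (localOrd hd t x)
  refine ⟨c, hc, fun z hz v w hv hw => ?_⟩
  rw [← mk_localOrd ht, hasPoint_mk_iff] at hz
  obtain ⟨i, rfl⟩ := hz
  have hv' := frameEquiv_daFun (mk_localOrd ht) hv
  have hw' := frameEquiv_daFun (i := i) (mk_localOrd ht') (v := w) (by
    rw [hw, hord, confPt_smul])
  -- The base points for `x` and `φ • x` are equal but not definitionally so; the comparison takes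
  -- place in the total space, where only coordinates matter.
  have key : ∀ (b : PickReg (d + 1)) (a a' : Fin (d + 1) → ℂ), b = pickMap hd x → a = a' →
      (Bundle.TotalSpace.mk' (Fin (d + 1) → ℂ) (pickMap hd x) a' :
        Bundle.TotalSpace (Fin (d + 1) → ℂ) (pickBundle hd).Fiber) =
      Bundle.TotalSpace.mk' (Fin (d + 1) → ℂ) b a := by
    rintro b a a' rfl rfl
    rfl
  have hidx : ∀ h, tautEquiv hd (φ • x) w = frameEquiv (localOrd hd t (φ • x)) h w := by
    intro h
    have : ∀ b (hb : b = pickMap hd (φ • x)) h', tautEquiv hd (φ • x) w =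
      frameEquiv (localOrd hd ((pickBundle hd).indexAt b) (φ • x)) h' w := by
        rintro b rfl h'
        rfl
    exact this _ hφ.symm h
  refine key _ _ _ hφ ?_
  rw [hidx (mk_localOrd ht'), hw', hord, h]
  have h4 : ∀ (a b : ℂ) (u : Fin (d + 1) → ℂ), a ≠ 0 → a • ((a * b)⁻¹ • u) = b⁻¹ • u := by
    intro a b u ha
    rw [smul_smul, mul_inv, mul_inv_cancel_left₀ ha]
  have h3 : c ≠ 0 := fun h0 => by simp [h0] at hc
  exact (h4 _ _ _ (mul_ne_zero h3 (autWeight_ne_zero φ _))).trans hv'.symm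

end
end PickSpace

open scoped Manifold ContDiff in
theorem theorem6p1 (n : ℕ) (hn : 1 ≤ n) (hn2 : n ≠ 2) :
    -- the regular points are exactly the points with trivial stabilizer
    (∀ x : PickSpace.X0 (n - 1) n, x ∈ PickSpace.X0reg (n - 1) n ↔
      MulAction.stabilizer (PickSpace.BallAut (n - 1)) x = ⊥) ∧
    -- the regular points form a smooth manifold
    IsManifold 𝓘(ℝ, Fin n → PickSpace.Cn (n - 1)) ∞ (PickSpace.X0reg (n - 1) n) ∧
    -- their image in the space of complete Pick spaces is open and dense
    IsOpen (PickSpace.PickReg n) ∧ Dense (PickSpace.PickReg n) ∧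
    -- `p` is the map that sends a regular configuration to the class of its complete Pick space
    ∃ p : PickSpace.X0reg (n - 1) n → PickSpace.PickReg n,
      (∀ x, PickSpace.IsClassOf (p x).1 x.1) ∧
      -- the image is a smooth manifold, and `p` is a smooth principal bundle over it
      T2Space (PickSpace.PickReg n) ∧ SecondCountableTopology (PickSpace.PickReg n) ∧
      (∃ (m : ℕ) (_ : ChartedSpace (EuclideanSpace ℝ (Fin m)) (PickSpace.PickReg n)),
        IsManifold (𝓡 m) ∞ (PickSpace.PickReg n) ∧
        PickSpace.IsSmoothPrincipalBundle (n - 1) (Fin n → PickSpace.Cn (n - 1))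
          (EuclideanSpace ℝ (Fin m)) p) ∧
      -- the tautological bundle descends to a vector bundle `V` on the image
      ∃ (V : PickSpace.PickReg n → Type) (_ : ∀ b, AddCommGroup (V b)) (_ : ∀ b, Module ℂ (V b))
        (_ : ∀ b, TopologicalSpace (V b))
        (_ : TopologicalSpace (Bundle.TotalSpace (Fin n → ℂ) V))
        (_ : FiberBundle (Fin n → ℂ) V) (_ : VectorBundle ℂ (Fin n → ℂ) V)
        (θ : ∀ x : PickSpace.X0reg (n - 1) n, PickSpace.tautFibre x.1 ≃ₗ[ℂ] V (p x)),
        -- `θ` is an isomorphism of the tautological bundle with the pullback of `V` along `p`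
        Topology.IsEmbedding (fun e : PickSpace.TautTotal (n - 1) n =>
          (e.1.1, Bundle.TotalSpace.mk' (Fin n → ℂ) (p e.1.1) (θ e.1.1 ⟨e.1.2, e.2⟩))) ∧
        -- up to phases, `V` identifies the fibres along the orbits by the natural unitaries
        ∀ (φ : PickSpace.BallAut (n - 1)) (x : PickSpace.X0reg (n - 1) n), ∃ c : ℂ, ‖c‖ = 1 ∧
          ∀ z, x.1.HasPoint z →
            ∀ (v : PickSpace.tautFibre x.1) (w : PickSpace.tautFibre (φ • x).1),
              v.1 = PickSpace.daFun z → w.1 = PickSpace.daFun (φ • z) →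
                Bundle.TotalSpace.mk' (Fin n → ℂ) (p x) (θ x v) =
                  Bundle.TotalSpace.mk' (Fin n → ℂ) (p (φ • x))
                    ((c * PickSpace.autWeight φ z) • θ (φ • x) w) := by
  obtain ⟨d, rfl⟩ : ∃ d, n = d + 1 := ⟨n - 1, by omega⟩
  have hd : d ≠ 1 := by omega
  refine ⟨PickSpace.mem_X0reg_iff hd, PickSpace.isManifold_X0reg, PickSpace.isOpen_pickReg hd,
    PickSpace.dense_pickReg hd, PickSpace.pickMap hd, PickSpace.isClassOf_pickMap,
    PickSpace.t2Space_pickReg hd, PickSpace.secondCountableTopology_pickReg hd, ?_, ?_⟩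
  · let c : ChartedSpace (PickSpace.SliceModel d) (PickSpace.PickReg (d + 1)) :=
      (PickSpace.isLocalHomeomorph_sliceMk hd).chartedSpace PickSpace.sliceMk_surjective
    have hA : PickSpace.IsQuotientAtlas (E := PickSpace.SliceModel d)
        (PickSpace.isLocalHomeomorph_sliceMk hd) := by
      rintro e ⟨q, rfl⟩
      exact ⟨_, rfl⟩
    have h1 := hA.isManifold PickSpace.hasSmoothDecks_sliceMk
    have h2 := PickSpace.isSmoothPrincipalBundle_pickMap hA
    exact ⟨_, c, h1, h2⟩
  · exact ⟨(PickSpace.pickBundle hd).Fiber, inferInstance, inferInstance, inferInstance,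
      inferInstance, inferInstance, inferInstance, PickSpace.tautEquiv hd,
      PickSpace.isEmbedding_tautMap hd, PickSpace.exists_tautEquiv_smul⟩
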